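/- Let $\Lambda_{q,t}$ be the algebra of symmetric functions in infinitely many variables over $\mathbb C(q,t)$, i.e. the polynomial ring over $\mathbb C(q,t)$ in the Newton functions $p_1,p_2,\dots$. Let $P_\mu=P_\mu(x;q,t)$ be the Macdonald functions: the basis of $\Lambda_{q,t}$ with $P_\lambda=m_\lambda+\sum_{\mu<\lambda}u_{\lambda\mu}m_\mu$ (dominance order, $m_\mu$ monomial symmetric functions) that is orthogonal for $(p_\lambda,p_\mu)_{q,t}=\delta_{\lambda\mu}z_\lambda\prod_i\frac{1-q^{\lambda_i}}{1-t^{\lambda_i}}$. For a cell $s=(i,j)\in\mu$ (row $i$, column $j$) put $l'(s)=i-1$, $a'(s)=j-1$. Let $\Lambda^m,\Sigma^m,\Psi^m$ be the linear operators on $\Lambda_{q,t}$ that multiply every $P_\mu$ by $e_m$, $h_m$, $p_m$ (elementary, complete, Newton), respectively, evaluated at $\{t^{-l'(s)}q^{a'(s)}\}_{s\in\mu}$. Let $D_n^r=t^{r(r-1)/2}\sum_{I\subset\{1,\dots,n\},|I|=r}\ \prod_{i\in I,\,j\notin I}\frac{tx_i-x_j}{x_i-x_j}\prod_{i\in I}T_{q,x_i}$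 be the Macdonald operators on symmetric polynomials in $x_1,\dots,x_n$, where $T_{q,x_i}$ substitutes $qx_i$ for $x_i$, and put $c_j=e_j(t^{-1},t^{-2},\dots)=\prod_{a=1}^j(t^a-1)^{-1}$. Let $\tilde E^r$ be the operator on $\Lambda_{q,t}$ whose restriction to symmetric polynomials in $n$ variables is, for every $n$, $$\tilde E^r_n=\sum_{j=0}^r e_j(t^{-n-1},t^{-n-2},\dots)\,t^{-(r-j)n}D_n^{r-j},\qquad e_j(t^{-n-1},t^{-n-2},\dots)=t^{-jn}c_j .$$ For a partition $\lambda$ write $\tilde E^\lambda=\tilde E^{\lambda_1}\tilde E^{\lambda_2}\cdots$ and $c_\lambda=c_{\lambda_1}c_{\lambda_2}\cdots$. Define $\alpha_\lambda\in\mathbb Q$ by $\log\sum_{n\ge0}e_nz^n=\sum_\lambda\alpha_\lambda e_\lambda z^{|\lambda|}$ ($e_0=1$). An operator $A$ on $\Lambda_{q,t}$ that has all $P_\mu$ as eigenvectors is called vertex realizable of weight $r\ge1$ if $$A=\Bigl[K(z_r,\dots,z_1)\exp\Bigl(\sum_{n\ge1}\tfrac{1-t^{-n}}n\,p_n\sum_{\alpha=1}^rz_\alpha^n\Bigr)\exp\Bigl(-\sum_{n\ge1}\tfrac{1-q^n}n\sum_{\alpha=1}^rz_\alpha^{-n}\,n\tfrac{\partial}{\partial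 p_n}\Bigr)\Bigr]_{z_r^0\cdots z_1^0}$$ for some (iterated) Laurent series $K\in\mathbb C(q,t)((z_r))\cdots((z_1))$; scalar operators are regarded as vertex realizable of weight $0$, and linear combinations of vertex realizable operators of different weights are also called vertex realizable. Then the Macdonald basis and the operators $\tilde E^r$ ($r\ge0$) exist, and the following hold. 1. The operators $\tilde E^r$ commute with each other, and $\tilde E^r$ is vertex realizable of weight $r$ for $r\ge1$. 2. $\Lambda^m$, $\Sigma^m$ and $\Psi^m$ are weighted homogeneous polynomials of weight $m$ in the operators $\tilde E^r$ (of weight $r$) and the constants $c_r$ (of weight $r$). For $\Lambda^m$ and $\Sigma^m$ this means: there are $\beta_\lambda,\gamma_\lambda\in\mathbb C(q)$, indexed by partitions and independent of $m$, such that for all $m\ge0$ $$\Lambda^m=t^m\sum_{|\lambda|+|\nu|=m}\gamma_\lambda\,\beta_\nu\,c_\nu\,\tilde E^\lambda,\qquad \Sigma^m=(-t)^m\sum_{|\lambda|+|\nu|=m}\beta_\lambda\,\gamma_\nu\,c_\nu\,\tilde E^\lambda .$$ For $\Psi^m$ it is the explicit formula, for all $m\ge1$, $$\Psi^m=\frac{(-1)^m\,m\,t^m}{1-q^m}\sum_{|\lambda|=m}\alpha_\lambda\,\tilde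 E^\lambda+\frac1{(1-q^m)(1-t^{-m})},$$ whose last term equals $-\frac{(-1)^m\,m\,t^m}{1-q^m}\sum_{|\lambda|=m}\alpha_\lambda c_\lambda$. 3. Hence $\Lambda^m$ and $\Sigma^m$ ($m\ge0$) and $\Psi^m$ ($m\ge1$) are vertex realizable. -/

import Mathlib

noncomputable section

namespace MacdonaldVertex

open Finset

/-! ### Coefficients and symmetric functions -/

/-- The field `ℂ(q)`. -/
abbrev CQ : Type := RatFunc ℂ

/-- The field `ℂ(q, t)`, realized as `ℂ(q)(t)`. -/
abbrev CQT : Type := RatFunc CQ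

/-- The indeterminate `q` in `ℂ(q, t)`. -/
def qv : CQT := RatFunc.C (RatFunc.X : CQ)

/-- The indeterminate `t` in `ℂ(q, t)`. -/
def tv : CQT := RatFunc.X

/-- The algebra `Λ_{q,t}` of symmetric functions in infinitely many variables over `ℂ(q, t)`,
presented as the polynomial ring in the power sums: the variable `X n` is the Newton function
`p_n`, `n ≥ 1`. -/
abbrev SymFun : Type := MvPolynomial ℕ+ CQT

/-- Restriction of a symmetric function to the `n` variables `x_0, …, x_{n-1}`
(all the other variables are set to `0`). -/
def restrictVars (n : ℕ) : SymFun →ₐ[CQT] MvPolynomial (Fin n) CQT :=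
  MvPolynomial.aeval fun k : ℕ+ => MvPolynomial.psum (Fin n) CQT (k : ℕ)

/-- The monomial symmetric polynomial `m_μ(x_0, …, x_{n-1})` (zero if `μ` has more than `n`
rows). -/
def monomialSymm (n : ℕ) (μ : YoungDiagram) : MvPolynomial (Fin n) CQT :=
  MvPolynomial.msymm (Fin n) CQT (Nat.Partition.ofMultiset (μ.rowLens : Multiset ℕ))

/-- Strict dominance `μ < lam` of partitions: same size, all partial sums of the rows of `μ` are at
most those of `lam`, and `μ ≠ lam`. -/
def StrictlyDominated (μ lam : YoungDiagram) : Prop :=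
  μ.card = lam.card ∧ μ ≠ lam ∧
    ∀ k : ℕ, ∑ i ∈ range k, μ.rowLen i ≤ ∑ i ∈ range k, lam.rowLen i

/-- The scalar product `(·,·)_{q,t}`. The monomial `d` in the power sums is `p_ν`, with `ν` the
partition that has `d k` parts equal to `k`; so
`(p_ν, p_ν) = ∏_k k ^ (d k) (d k)! ((1 - q^k) / (1 - t^k)) ^ (d k)`. -/
def scalarProd (f g : SymFun) : CQT :=
  ∑ d ∈ f.support, MvPolynomial.coeff d f * MvPolynomial.coeff d g *
    d.prod fun k m => ((k : ℕ) : CQT) ^ m * (m.factorial : CQT) *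
      ((1 - qv ^ (k : ℕ)) / (1 - tv ^ (k : ℕ))) ^ m

/-- `P` is the basis of Macdonald functions `P_μ(x; q, t)`: it is unitriangular with respect to the
monomial symmetric functions and the dominance order (with coefficients that do not depend on the
number of variables), and it is orthogonal for `(·,·)_{q,t}`. -/
structure IsMacdonaldBasis (P : Module.Basis YoungDiagram CQT SymFun) : Prop where
  triangular : ∀ lam : YoungDiagram, ∃ u : YoungDiagram →₀ CQT,
    (∀ μ ∈ u.support, StrictlyDominated μ lam) ∧
    ∀ n : ℕ, restrictVars n (P lam) =
      monomialSymm n lam + u.sum fun μ c => c • monomialSymm n μ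
  orthogonal : ∀ lam μ : YoungDiagram, lam ≠ μ → scalarProd (P lam) (P μ) = 0

/-! ### The operators of the eigenvalues `e_m`, `h_m`, `p_m` -/

/-- The quantity `t^{-l'(s)} q^{a'(s)}` of a cell `s = (i, j)` (row `i`, column `j`, both counted
from `0`), where `l'(s) = i` and `a'(s) = j`. -/
def cellWeight (μ : YoungDiagram) (s : μ.cells) : CQT := tv⁻¹ ^ s.1.1 * qv ^ s.1.2

/-- The operator that multiplies the basis vector `P μ` by `c μ`. -/
def diagOp (P : Module.Basis YoungDiagram CQT SymFun) (c : YoungDiagram → CQT) :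
    Module.End CQT SymFun :=
  P.constr CQT fun μ => c μ • P μ

/-- `Λ^m`: multiplies `P_μ` by `e_m` of the cell weights of `μ`. -/
def LambdaOp (P : Module.Basis YoungDiagram CQT SymFun) (m : ℕ) : Module.End CQT SymFun :=
  diagOp P fun μ => MvPolynomial.aeval (cellWeight μ) (MvPolynomial.esymm μ.cells CQT m)

/-- `Σ^m`: multiplies `P_μ` by `h_m` of the cell weights of `μ`. -/
def SigmaOp (P : Module.Basis YoungDiagram CQT SymFun) (m : ℕ) : Module.End CQT SymFun :=
  diagOp P fun μ => MvPolynomial.aeval (cellWeight μ) (MvPolynomial.hsymm μ.cells CQT m)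

/-- `Ψ^m`: multiplies `P_μ` by `p_m` of the cell weights of `μ`. -/
def PsiOp (P : Module.Basis YoungDiagram CQT SymFun) (m : ℕ) : Module.End CQT SymFun :=
  diagOp P fun μ => MvPolynomial.aeval (cellWeight μ) (MvPolynomial.psum μ.cells CQT m)

/-! ### The modified Macdonald operators -/

/-- The field of rational functions in `n` variables over `ℂ(q, t)`. -/
abbrev RatVars (n : ℕ) : Type := FractionRing (MvPolynomial (Fin n) CQT)

/-- The variable `x_i` as a rational function. -/
def xVar (n : ℕ) (i : Fin n) : RatVars n :=
  algebraMap (MvPolynomial (Fin n) CQT) (RatVars n) (MvPolynomial.X i)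

/-- `∏_{i ∈ I} T_{q, x_i}`: the substitution `x_i ↦ q x_i` for `i ∈ I`. -/
def shiftVars (n : ℕ) (I : Finset (Fin n)) :
    MvPolynomial (Fin n) CQT →ₐ[CQT] MvPolynomial (Fin n) CQT :=
  MvPolynomial.aeval fun i =>
    if i ∈ I then MvPolynomial.C qv * MvPolynomial.X i else MvPolynomial.X i

/-- Macdonald's operator
`D_n^r = ∑_{|I| = r} t^{r(r-1)/2} ∏_{i ∈ I, j ∉ I} (t x_i - x_j)/(x_i - x_j) ∏_{i ∈ I} T_{q,x_i}`,
applied to a polynomial. -/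
def macdonaldD (n r : ℕ) (f : MvPolynomial (Fin n) CQT) : RatVars n :=
  ∑ I ∈ powersetCard r (univ : Finset (Fin n)),
    algebraMap CQT (RatVars n) (tv ^ (r * (r - 1) / 2)) *
      (∏ i ∈ I, ∏ j ∈ Iᶜ,
        (algebraMap CQT (RatVars n) tv * xVar n i - xVar n j) / (xVar n i - xVar n j)) *
      algebraMap (MvPolynomial (Fin n) CQT) (RatVars n) (shiftVars n I f)

/-- `e_j(t^{-n-1}, t^{-n-2}, t^{-n-3}, …)`, an element of `ℂ(q, t)` by Euler's summation
`e_j(t^{-n-1}, t^{-n-2}, …) = t^{-jn} / ((t - 1)(t^2 - 1) ⋯ (t^j - 1))`. -/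
def eTail (n j : ℕ) : CQT := tv⁻¹ ^ (j * n) * (∏ a ∈ Icc 1 j, (tv ^ a - 1))⁻¹

/-- The operator `Ẽ_n^r = ∑_{j ≤ r} e_j(t^{-n-1}, t^{-n-2}, …) t^{-(r-j)n} D_n^{r-j}`,
applied to a polynomial. -/
def tildeEn (n r : ℕ) (f : MvPolynomial (Fin n) CQT) : RatVars n :=
  ∑ j ∈ range (r + 1),
    algebraMap CQT (RatVars n) (eTail n j * tv⁻¹ ^ ((r - j) * n)) * macdonaldD n (r - j) f

/-- `T` is the operator `Ẽ^r` on `Λ_{q,t}`: for every `n` its restriction to symmetric polynomials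
in `n` variables is `Ẽ_n^r`. -/
def IsTildeE (r : ℕ) (T : Module.End CQT SymFun) : Prop :=
  ∀ (n : ℕ) (f : SymFun),
    algebraMap (MvPolynomial (Fin n) CQT) (RatVars n) (restrictVars n (T f)) =
      tildeEn n r (restrictVars n f)

/-- `Ẽ^lam = Ẽ^{lam_1} Ẽ^{lam_2} ⋯ Ẽ^{lam_l}` for a partition `lam`. -/
def tildeEPart (E : ℕ → Module.End CQT SymFun) {n : ℕ} (lam : n.Partition) :
    Module.End CQT SymFun :=
  ((lam.parts.sort (· ≥ ·)).map E).prod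

/-- `e_ν(t^{-1}, t^{-2}, …) = ∏_i e_{ν_i}(t^{-1}, t^{-2}, …)` for a partition `ν`. -/
def eTailPart {n : ℕ} (ν : n.Partition) : CQT := (ν.parts.map (eTail 0)).prod

/-- The rational number `α_lam` defined by
`log (∑_{n ≥ 0} e_n z^n) = ∑_lam α_lam e_lam z^{|lam|}`, where `e_0 = 1` and the `e_n`, `n ≥ 1`, are
independent variables. -/
def alphaCoeff {m : ℕ} (lam : m.Partition) : ℚ :=
  MvPolynomial.coeff (Multiset.toFinsupp lam.parts)
    (PowerSeries.coeff m
      ((PowerSeries.log (MvPolynomial ℕ ℚ)).subst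
        (PowerSeries.mk fun n : ℕ => if n = 0 then (0 : MvPolynomial ℕ ℚ) else MvPolynomial.X n)))

/-! ### Vertex realizable operators -/

/-- Exponents of Laurent monomials in `z_1, …, z_r` (the index `0` belongs to `z_1`), ordered
lexicographically, the exponent of `z_1` being the most significant one. A Hahn series with these
exponents is an iterated Laurent series, an element of `R((z_r))((z_{r-1}))⋯((z_1))`: a series
expanded in the region `|z_1| < |z_2| < ⋯ < |z_r|`. -/
abbrev Expo (r : ℕ) : Type := Lex (Fin r → ℤ)

/-- The series `exp (∑_{n ≥ 1} (1 - t^{-n})/n p_n z^n)` in one variable `z`. -/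
def creationSeries : PowerSeries SymFun :=
  (PowerSeries.exp SymFun).subst (PowerSeries.mk fun n : ℕ =>
    if h : 0 < n then
      MvPolynomial.C ((1 - tv⁻¹ ^ n) / (n : CQT)) * MvPolynomial.X (⟨n, h⟩ : ℕ+)
    else (0 : SymFun))

/-- The exponent of `z_α ^ n`. -/
def expoSingle {r : ℕ} (α : Fin r) (n : ℤ) : Expo r := toLex (Pi.single α n)

theorem expoSingle_le_iff {r : ℕ} (α : Fin r) (m n : ℕ) :
    expoSingle α (m : ℤ) ≤ expoSingle α (n : ℤ) ↔ m ≤ n := by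
  have hs : StrictMono fun k : ℕ => expoSingle α (k : ℤ) := fun a b hab =>
    Pi.toLex_strictMono (Pi.single_strictMono α (by exact_mod_cast hab))
  exact hs.le_iff_le

/-- Substitution `z ↦ z_α` of a power series in one variable `z`. -/
def inVariable {r : ℕ} (α : Fin r) (f : PowerSeries SymFun) : HahnSeries (Expo r) SymFun :=
  HahnSeries.embDomain
    (OrderEmbedding.ofMapLEIff (fun n : ℕ => expoSingle α (n : ℤ)) (expoSingle_le_iff α))
    (HahnSeries.toPowerSeries.symm f)

/-- The series `exp (∑_{n ≥ 1} (1 - t^{-n})/n p_n ∑_α z_α^n)`, as the product over `α` of the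
series in one variable. -/
def creation (r : ℕ) : HahnSeries (Expo r) SymFun :=
  ∏ α : Fin r, inVariable α creationSeries

/-- The operator `exp (- ∑_{n ≥ 1} (1 - q^n)/n ∑_α z_α^{-n} n ∂/∂p_n)`. The exponential of a
derivation with constant coefficients is a translation: it is the algebra homomorphism
`p_n ↦ p_n - (1 - q^n) ∑_α z_α^{-n}`. -/
def annihilation (r : ℕ) : SymFun →ₐ[CQT] HahnSeries (Expo r) SymFun :=
  MvPolynomial.aeval fun n : ℕ+ =>
    HahnSeries.C (MvPolynomial.X n : SymFun) -
      ∑ α : Fin r, HahnSeries.single (expoSingle α (-((n : ℕ) : ℤ)))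
        (MvPolynomial.C (1 - qv ^ (n : ℕ)) : SymFun)

/-- A kernel, seen as a series with coefficients in `Λ_{q,t}`. -/
def kernelSeries (r : ℕ) (κ : HahnSeries (Expo r) CQT) : HahnSeries (Expo r) SymFun :=
  κ.map (MvPolynomial.C : CQT →+* SymFun)

/-- The vertex operator with kernel `κ(z_r, …, z_1)`: the constant term in `z_r, …, z_1` of
`κ · exp (∑ (1 - t^{-n})/n p_n ∑_α z_α^n) · exp (- ∑ (1 - q^n)/n ∑_α z_α^{-n} n ∂/∂p_n)`. -/
def vertexOp (r : ℕ) (κ : HahnSeries (Expo r) CQT) : Module.End CQT SymFun where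
  toFun f := (kernelSeries r κ * creation r * annihilation r f).coeff 0
  map_add' f g := by simp [mul_add]
  map_smul' c f := by
    rw [map_smul, Algebra.mul_smul_comm, HahnSeries.coeff_smul, RingHom.id_apply]

/-- An operator is vertex realizable of weight `r` if the Macdonald functions are eigenvectors of it
and it is the vertex operator of some kernel in `r` variables. For `r = 0` these are the scalar
operators. -/
def IsVertexRealizableOfWeight (P : Module.Basis YoungDiagram CQT SymFun) (r : ℕ)
    (A : Module.End CQT SymFun) : Prop :=
  (∀ μ : YoungDiagram, ∃ a : CQT, A (P μ) = a • P μ) ∧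
    ∃ κ : HahnSeries (Expo r) CQT, A = vertexOp r κ

/-- An operator is vertex realizable if it is a linear combination of a scalar operator and of
vertex realizable operators of weights `r ≥ 1`. -/
def IsVertexRealizable (P : Module.Basis YoungDiagram CQT SymFun)
    (A : Module.End CQT SymFun) : Prop :=
  A ∈ Submodule.span CQT
    ({1} ∪ {B : Module.End CQT SymFun | ∃ r : ℕ, 1 ≤ r ∧ IsVertexRealizableOfWeight P r B})

end MacdonaldVertex

end

open MacdonaldVertex

noncomputable section

namespace MacdonaldVertex

open Finset

/-! ### Hahn series: coefficients of products, power series along an exponent -/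

section HahnTools

variable {Γ : Type*} [AddCommGroup Γ] [LinearOrder Γ] [IsOrderedAddMonoid Γ]
variable {R S : Type*} [CommRing R] [CommRing S]

/-! Everything rests on one residue computation. Take the kernel ∏_{α<β} (1 - z_α/z_β)/(1 - t⁻¹
z_α/z_β), divided by ∏_{a≤r} (t^a - 1). In n variables the creation part becomes ∏_i (1 - t⁻¹ x_i
z)/(1 - x_i z) for each z = z_α, so the constant term in the last variable is a sum over partial
fractions. The pole z = 1/x_i makes the annihilation part replace x_i by q x_i, and the pair factors
involving the last variable cancel the i-th factor in the other variables. The value at infinity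
contributes t⁻ⁿ and shifts nothing. Iteration gives a sum over the sets I of shifted variables
(`constTerm_ratioProd`), with coefficients given by a q-Pascal recursion (`residueCoeff_eq`); they
are those of Ẽ_n^r (`isTildeE_vertexOp`). As a symmetric function is determined by its restrictions
(`symFun_ext`), Ẽ^r is this vertex operator.

Diagonalization uses two properties of Ẽ^r. It is triangular on monomial symmetric functions:
multiply by the Vandermonde product, compare leading terms in dominance order, divide again
(`IsTildeE.hasLeading`). It is self-adjoint: the adjoint of a vertex operator inverts the z_α, and
the kernel has degree 0 and survives inversion combined with reversal of the order of the variables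
(`coeffAdjoint`, `scalarWith_vertexOp`). The eigenvalues of Ẽ^1 separate partitions, so its
eigenvectors form a Macdonald basis. Conversely a triangular self-adjoint operator is diagonal in
every Macdonald basis (`apply_eq_smul_of_selfAdjoint`), so all Ẽ^r commute.

For the eigenvalues put, formally, E(z) = ∏_{i≥1} (1 + t⁻ⁱ q^{λ_i} z), let T(z) be the same product
for the empty partition, and C(z) = ∏_s (1 + w_s z) over the cell weights w_s. The coefficients of E
are the eigenvalues of the Ẽ^r, those of T the constants c_r. Telescoping along rows gives E(tz)
C(z) = T(tz) C(qz) (`rescale_eigenSeries_mul`). If G is the universal solution of G(qz) = G(z)(1 + ∑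
e_n zⁿ), then C(z) = G_E(tz)/G_T(tz) (`cellSeries_eq_universal`); the coefficients of G and 1/G are
γ and β. Replacing C(z) by 1/C(-z) gives Σ^m, and the logarithmic derivative of the same equation
gives Ψ^m (`psum_cellWeight`).

Finally, normal ordering a product of two vertex operators produces only a scalar series, which is
absorbed into the kernel (`vertexOp_mul_vertexOp`); hence polynomials in the Ẽ^r are vertex
realizable. -/

theorem hahn_finite_support_mul (x y : HahnSeries Γ R) (a : Γ) :
    (Function.support fun i => x.coeff i * y.coeff (a - i)).Finite := by
  refine ((Finset.antidiagonal x.isPWO_support y.isPWO_support a).image Prod.fst).finite_toSet.subset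
    fun i hi => ?_
  have h1 := left_ne_zero_of_mul (Function.mem_support.1 hi)
  have h2 := right_ne_zero_of_mul (Function.mem_support.1 hi)
  simp only [coe_image, Set.mem_image, mem_coe, Finset.mem_antidiagonal]
  exact ⟨(i, a - i), ⟨h1, h2, by simp⟩, rfl⟩

/-- Summing over the whole exponent group instead of the supports allows convolutions to be
reindexed by equivalences of exponents and split into iterated sums. -/
theorem hahn_coeff_mul (x y : HahnSeries Γ R) (a : Γ) :
    (x * y).coeff a = ∑ᶠ i, x.coeff i * y.coeff (a - i) := by
  rw [HahnSeries.coeff_mul, finsum_eq_sum_of_support_subset (s := (Finset.antidiagonal x.isPWO_support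
    y.isPWO_support a).image Prod.fst)]
  · rw [sum_image]
    · refine sum_congr rfl fun ij hij => ?_
      rw [Finset.mem_antidiagonal] at hij
      rw [← hij.2.2, add_sub_cancel_left]
    · intro p hp p' hp' h
      rw [mem_coe, Finset.mem_antidiagonal] at hp hp'
      refine Prod.ext h ?_
      have := hp.2.2.trans hp'.2.2.symm
      rw [h] at this
      exact add_left_cancel this
  · intro i hi
    have h1 := left_ne_zero_of_mul (Function.mem_support.1 hi)
    have h2 := right_ne_zero_of_mul (Function.mem_support.1 hi)
    simp only [coe_image, Set.mem_image, mem_coe, Finset.mem_antidiagonal]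
    exact ⟨(i, a - i), ⟨h1, h2, by simp⟩, rfl⟩

/-- A ring homomorphism applied to the coefficients of Hahn series. -/
def hahnMap (φ : R →+* S) : HahnSeries Γ R →+* HahnSeries Γ S where
  toFun x := x.map φ
  map_one' := by
    ext a
    rw [HahnSeries.map_coeff, HahnSeries.coeff_one, HahnSeries.coeff_one]
    split_ifs <;> simp
  map_mul' x y := HahnSeries.map_mul (φ : R →ₙ+* S)
  map_zero' := by ext; simp
  map_add' x y := by ext; simp

@[simp]
theorem hahnMap_coeff (φ : R →+* S) (x : HahnSeries Γ R) (a : Γ) :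
    (hahnMap φ x).coeff a = φ (x.coeff a) := rfl

@[simp]
theorem hahnMap_single (φ : R →+* S) (a : Γ) (c : R) :
    hahnMap φ (HahnSeries.single a c) = HahnSeries.single a (φ c) := by
  ext b
  rw [hahnMap_coeff, HahnSeries.coeff_single, HahnSeries.coeff_single]
  split_ifs <;> simp

@[simp]
theorem hahnMap_C (φ : R →+* S) (c : R) :
    hahnMap φ (HahnSeries.C c : HahnSeries Γ R) = HahnSeries.C (φ c) := hahnMap_single φ 0 c

theorem hahn_coeff_C_mul (c : R) (x : HahnSeries Γ R) (a : Γ) :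
    (HahnSeries.C c * x).coeff a = c * x.coeff a := by
  rw [HahnSeries.C_apply, HahnSeries.coeff_single_zero_mul]

/-- The multiple `n • g`. -/
def expMul {Γ : Type*} [AddCommGroup Γ] (g : Γ) (n : ℕ) : Γ := n • g

theorem expMul_zero {Γ : Type*} [AddCommGroup Γ] (g : Γ) : expMul g 0 = 0 := zero_nsmul g

theorem expMul_one {Γ : Type*} [AddCommGroup Γ] (g : Γ) : expMul g 1 = g := one_nsmul g

theorem expMul_succ {Γ : Type*} [AddCommGroup Γ] (g : Γ) (n : ℕ) :
    expMul g (n + 1) = expMul g n + g := succ_nsmul g n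

theorem zero_expMul {Γ : Type*} [AddCommGroup Γ] (n : ℕ) : expMul (0 : Γ) n = 0 := nsmul_zero n

theorem expMul_strictMono {g : Γ} (hg : 0 < g) : StrictMono (expMul g) :=
  fun _ _ h => nsmul_lt_nsmul_left hg h

/-- The power series `f`, evaluated at the monomial with the positive exponent `g`. -/
def powAlong {g : Γ} (hg : 0 < g) : PowerSeries R →+* HahnSeries Γ R :=
  (HahnSeries.embDomainRingHom (multiplesHom Γ g) (expMul_strictMono hg).injective
    fun _ _ => (expMul_strictMono hg).le_iff_le).comp
      (RingEquiv.toRingHom HahnSeries.toPowerSeries.symm)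

theorem coeff_powAlong_nsmul {g : Γ} (hg : 0 < g) (f : PowerSeries R) (n : ℕ) :
    (powAlong hg f).coeff (expMul g n) = PowerSeries.coeff n f :=
  HahnSeries.embDomain_mk_coeff (f := multiplesHom Γ g) (expMul_strictMono hg).injective
    (fun _ _ => (expMul_strictMono hg).le_iff_le)

theorem coeff_powAlong_of_notMem {g : Γ} (hg : 0 < g) (f : PowerSeries R) {a : Γ}
    (ha : ∀ n : ℕ, expMul g n ≠ a) : (powAlong hg f).coeff a = 0 :=
  HahnSeries.embDomain_of_notMem_range (by rintro ⟨n, hn⟩; exact ha n hn)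

theorem eq_powAlong {g : Γ} (hg : 0 < g) (f : PowerSeries R) (x : HahnSeries Γ R)
    (h1 : ∀ n : ℕ, x.coeff (expMul g n) = PowerSeries.coeff n f)
    (h2 : ∀ a, (∀ n : ℕ, expMul g n ≠ a) → x.coeff a = 0) : x = powAlong hg f := by
  ext a
  by_cases ha : ∃ n : ℕ, expMul g n = a
  · obtain ⟨n, rfl⟩ := ha
    rw [h1, coeff_powAlong_nsmul]
  · push Not at ha
    rw [h2 a ha, coeff_powAlong_of_notMem hg f ha]

theorem powAlong_X {g : Γ} (hg : 0 < g) :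
    powAlong hg (PowerSeries.X : PowerSeries R) = HahnSeries.single g 1 := by
  refine (eq_powAlong hg _ _ (fun n => ?_) fun a ha => ?_).symm
  · rw [HahnSeries.coeff_single, PowerSeries.coeff_X]
    have : expMul g n = g ↔ n = 1 :=
      ⟨fun h => (expMul_strictMono hg).injective (h.trans (expMul_one g).symm),
        fun h => h ▸ expMul_one g⟩
    simp only [this]
  · exact HahnSeries.coeff_single_of_ne fun h => ha 1 (by rw [h, expMul_one])

theorem powAlong_C {g : Γ} (hg : 0 < g) (c : R) :
    powAlong hg (PowerSeries.C c) = HahnSeries.C c := by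
  refine (eq_powAlong hg _ _ (fun n => ?_) fun a ha => ?_).symm
  · rw [HahnSeries.C_apply, HahnSeries.coeff_single, PowerSeries.coeff_C]
    have : expMul g n = 0 ↔ n = 0 :=
      ⟨fun h => (expMul_strictMono hg).injective (h.trans (expMul_zero g).symm),
        fun h => h ▸ expMul_zero g⟩
    simp only [this]
  · exact HahnSeries.coeff_single_of_ne fun h => ha 0 (by rw [h, expMul_zero])

theorem hahnMap_powAlong {g : Γ} (hg : 0 < g) (φ : R →+* S) (f : PowerSeries R) :
    hahnMap φ (powAlong hg f) = powAlong hg (PowerSeries.map φ f) := by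
  refine eq_powAlong hg _ _ (fun n => ?_) fun a ha => ?_
  · rw [hahnMap_coeff, coeff_powAlong_nsmul, PowerSeries.coeff_map]
  · rw [hahnMap_coeff, coeff_powAlong_of_notMem hg f ha, map_zero]

/-- Hahn series whose support lies in a given additive submonoid of the exponents. -/
def hahnSupported (R : Type*) [CommRing R] (A : AddSubmonoid Γ) : Subring (HahnSeries Γ R) where
  carrier := {x | ∀ a, x.coeff a ≠ 0 → a ∈ A}
  mul_mem' := by
    intro x y hx hy a ha
    rw [hahn_coeff_mul] at ha
    obtain ⟨i, hi⟩ : ∃ i, x.coeff i * y.coeff (a - i) ≠ 0 := by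
      by_contra! h
      exact ha (finsum_eq_zero_of_forall_eq_zero h)
    have := A.add_mem (hx i (left_ne_zero_of_mul hi)) (hy _ (right_ne_zero_of_mul hi))
    simpa using this
  one_mem' := by
    intro a ha
    rw [HahnSeries.coeff_one] at ha
    split_ifs at ha with h
    · exact h ▸ A.zero_mem
    · exact absurd rfl ha
  add_mem' := by
    intro x y hx hy a ha
    rw [HahnSeries.coeff_add] at ha
    by_cases h : x.coeff a = 0
    · exact hy a (by simpa [h] using ha)
    · exact hx a h
  zero_mem' := by intro a ha; simp at ha
  neg_mem' := by intro x hx a ha; exact hx a (by simpa using ha)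

theorem mem_hahnSupported {A : AddSubmonoid Γ} {x : HahnSeries Γ R} :
    x ∈ hahnSupported R A ↔ ∀ a, x.coeff a ≠ 0 → a ∈ A := Iff.rfl

theorem single_mem_hahnSupported {A : AddSubmonoid Γ} {g : Γ} (hg : g ∈ A) (c : R) :
    HahnSeries.single g c ∈ hahnSupported R A := by
  intro a ha
  rw [HahnSeries.coeff_single] at ha
  split_ifs at ha with h
  · exact h ▸ hg
  · exact absurd rfl ha

theorem C_mem_hahnSupported (A : AddSubmonoid Γ) (c : R) :
    (HahnSeries.C c : HahnSeries Γ R) ∈ hahnSupported R A :=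
  single_mem_hahnSupported A.zero_mem c

theorem powAlong_mem_hahnSupported {A : AddSubmonoid Γ} {g : Γ} (hg : 0 < g) (hA : g ∈ A)
    (f : PowerSeries R) : powAlong hg f ∈ hahnSupported R A := by
  intro a ha
  by_contra h
  exact ha (coeff_powAlong_of_notMem hg f fun n hn => h (hn ▸ A.nsmul_mem hA n))

end HahnTools

/-! ### Exponents -/

section Exponents

variable {R S : Type*} [CommRing R] [CommRing S]

theorem expoSingle_pos {r : ℕ} (α : Fin r) : 0 < expoSingle α 1 := by
  have h := (expoSingle_le_iff α 1 0).not.2 (by norm_num)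
  have h0 : expoSingle α ((0 : ℕ) : ℤ) = 0 := by simp [expoSingle]
  rw [h0] at h
  exact lt_of_not_ge h

theorem neg_expoSingle {r : ℕ} (α : Fin r) (n : ℤ) : -expoSingle α n = expoSingle α (-n) := by
  simp only [expoSingle]
  rw [← toLex_neg, ← Pi.single_neg]

theorem expoSingle_add {r : ℕ} (α : Fin r) (m n : ℤ) :
    expoSingle α (m + n) = expoSingle α m + expoSingle α n := by
  simp only [expoSingle]
  rw [← toLex_add, ← Pi.single_add]

@[simp]
theorem expoSingle_zero {r : ℕ} (α : Fin r) : expoSingle α 0 = 0 := by simp [expoSingle]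

theorem expMul_expoSingle {r : ℕ} (α : Fin r) (k : ℕ) (n : ℤ) :
    expMul (expoSingle α n) k = expoSingle α (k * n) := by
  induction k with
  | zero => simp [expMul_zero]
  | succ k ih => rw [expMul_succ, ih, ← expoSingle_add]; push_cast; ring_nf

theorem inVariable_eq_powAlong {r : ℕ} (α : Fin r) (f : PowerSeries SymFun) :
    inVariable α f = powAlong (expoSingle_pos α) f := by
  refine eq_powAlong _ _ _ (fun n => ?_) fun a ha => ?_
  · rw [expMul_expoSingle, mul_one]
    exact HahnSeries.embDomain_coeff (f := OrderEmbedding.ofMapLEIff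
      (fun n : ℕ => expoSingle α (n : ℤ)) (expoSingle_le_iff α))
  · refine HahnSeries.embDomain_of_notMem_range ?_
    rintro ⟨n, hn⟩
    refine ha n ?_
    rw [expMul_expoSingle, mul_one]
    exact hn

/-- Concatenation of exponents. -/
def expoAppend {s r : ℕ} (a : Expo s) (b : Expo r) : Expo (s + r) :=
  toLex (Fin.append (ofLex a) (ofLex b))

/-- The exponents of the first variables. -/
def expoLeft {s r : ℕ} (e : Expo (s + r)) : Expo s := toLex fun i => ofLex e (Fin.castAdd r i)

/-- The exponents of the last variables. -/
def expoRight {s r : ℕ} (e : Expo (s + r)) : Expo r := toLex fun i => ofLex e (Fin.natAdd s i)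

@[simp]
theorem expoLeft_append {s r : ℕ} (a : Expo s) (b : Expo r) : expoLeft (expoAppend a b) = a := by
  apply ofLex.injective; ext i; simp [expoLeft, expoAppend]

@[simp]
theorem expoRight_append {s r : ℕ} (a : Expo s) (b : Expo r) : expoRight (expoAppend a b) = b := by
  apply ofLex.injective; ext i; simp [expoRight, expoAppend]

@[simp]
theorem expoAppend_left_right {s r : ℕ} (e : Expo (s + r)) :
    expoAppend (expoLeft e) (expoRight e) = e := by
  apply ofLex.injective; ext i
  refine Fin.addCases (fun j => ?_) (fun j => ?_) i <;> simp [expoLeft, expoRight, expoAppend]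

theorem expoAppend_apply_left {s r : ℕ} (a : Expo s) (b : Expo r) (j : Fin s) :
    expoAppend a b (Fin.castAdd r j) = a j := by simp [expoAppend]

theorem expoAppend_apply_right {s r : ℕ} (a : Expo s) (b : Expo r) (j : Fin r) :
    expoAppend a b (Fin.natAdd s j) = b j := by simp [expoAppend]

theorem expo_ext {s r : ℕ} {e e' : Expo (s + r)} (h1 : expoLeft e = expoLeft e')
    (h2 : expoRight e = expoRight e') : e = e' := by
  rw [← expoAppend_left_right e, h1, h2, expoAppend_left_right]

theorem expoLeft_add {s r : ℕ} (e e' : Expo (s + r)) :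
    expoLeft (e + e') = expoLeft e + expoLeft e' := rfl

theorem expoRight_add {s r : ℕ} (e e' : Expo (s + r)) :
    expoRight (e + e') = expoRight e + expoRight e' := rfl

theorem expoLeft_zero {s r : ℕ} : expoLeft (0 : Expo (s + r)) = 0 := rfl

theorem expoRight_zero {s r : ℕ} : expoRight (0 : Expo (s + r)) = 0 := rfl

theorem expoAppend_add {s r : ℕ} (a a' : Expo s) (b b' : Expo r) :
    expoAppend (a + a') (b + b') = expoAppend a b + expoAppend a' b' :=
  expo_ext (by simp [expoLeft_add]) (by simp [expoRight_add])

theorem expoLeft_sub {s r : ℕ} (e e' : Expo (s + r)) :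
    expoLeft (e - e') = expoLeft e - expoLeft e' := rfl

theorem expoRight_sub {s r : ℕ} (e e' : Expo (s + r)) :
    expoRight (e - e') = expoRight e - expoRight e' := rfl

@[simp]
theorem expoAppend_zero_zero {s r : ℕ} : expoAppend (0 : Expo s) (0 : Expo r) = 0 :=
  expo_ext (by simp [expoLeft_zero]) (by simp [expoRight_zero])

theorem expoAppend_lt_of_left {s r : ℕ} {a a' : Expo s} (b b' : Expo r) (h : a < a') :
    expoAppend a b < expoAppend a' b' := by
  obtain ⟨i, h1, h2⟩ := h
  refine ⟨Fin.castAdd r i, fun j hj => ?_, ?_⟩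
  · obtain ⟨k, rfl⟩ : ∃ k : Fin s, j = Fin.castAdd r k :=
      ⟨⟨j, lt_trans (Fin.lt_def.1 hj) i.2⟩, rfl⟩
    exact (expoAppend_apply_left _ _ _).trans
      ((h1 k (Fin.lt_def.2 (Fin.lt_def.1 hj))).trans (expoAppend_apply_left _ _ _).symm)
  · exact (expoAppend_apply_left a b i).trans_lt
      (lt_of_lt_of_eq h2 (expoAppend_apply_left a' b' i).symm)

theorem expoAppend_lt_of_right {s r : ℕ} (a : Expo s) {b b' : Expo r} (h : b < b') :
    expoAppend a b < expoAppend a b' := by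
  obtain ⟨i, h1, h2⟩ := h
  refine ⟨Fin.natAdd s i, fun j hj => ?_, ?_⟩
  · induction j using Fin.addCases with
    | left j => exact (expoAppend_apply_left _ _ _).trans (expoAppend_apply_left _ _ _).symm
    | right j =>
      exact (expoAppend_apply_right _ _ _).trans ((h1 j (Fin.lt_def.2 (by
        have := Fin.lt_def.1 hj; simp only [Fin.val_natAdd] at this; omega))).trans
        (expoAppend_apply_right _ _ _).symm)
  · exact (expoAppend_apply_right a b i).trans_lt
      (lt_of_lt_of_eq h2 (expoAppend_apply_right a b' i).symm)

/-- A monotone image of a partially well-ordered set is partially well-ordered; this is what makes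
the support in `joinFun` admissible. -/
theorem expoAppend_monotone {s r : ℕ} :
    Monotone fun p : Expo s ×ₗ Expo r => expoAppend (ofLex p).1 (ofLex p).2 := by
  intro p p' h
  rcases Prod.Lex.le_iff.1 h with h | ⟨h, h'⟩
  · exact (expoAppend_lt_of_left _ _ h).le
  · rcases h'.lt_or_eq with h' | h'
    · simp only [h]
      exact (expoAppend_lt_of_right _ h').le
    · simp only [h, h']; exact le_rfl

/-- An iterated Hahn series as a Hahn series in all the variables. -/
def joinFun {s r : ℕ} (X : HahnSeries (Expo s) (HahnSeries (Expo r) R)) :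
    HahnSeries (Expo (s + r)) R where
  coeff e := (X.coeff (expoLeft e)).coeff (expoRight e)
  isPWO_support' := by
    refine ((HahnSeries.ofIterate X).isPWO_support.image_of_monotone
      (expoAppend_monotone (s := s) (r := r))).mono fun e he => ?_
    exact ⟨toLex (expoLeft e, expoRight e), he, expoAppend_left_right e⟩

/-- Fubini: cutting an exponent into its left and right parts turns one convolution into an iterated
one, legitimate because the convolution has finite support. -/
theorem joinFun_mul {s r : ℕ} (X Y : HahnSeries (Expo s) (HahnSeries (Expo r) R)) :
    joinFun (X * Y) = joinFun X * joinFun Y := by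
  ext e
  rw [hahn_coeff_mul]
  have hcoeff : ∀ (Z : HahnSeries (Expo s) (HahnSeries (Expo r) R)) e,
      (joinFun Z).coeff e = (Z.coeff (expoLeft e)).coeff (expoRight e) := fun _ _ => rfl
  let eqv : Expo s × Expo r ≃ Expo (s + r) :=
    { toFun := fun p => expoAppend p.1 p.2
      invFun := fun e => (expoLeft e, expoRight e)
      left_inv := fun p => by simp
      right_inv := fun e => by simp }
  rw [← finsum_comp_equiv eqv, finsum_curry]
  · rw [hcoeff, hahn_coeff_mul]
    have hfin := hahn_finite_support_mul X Y (expoLeft e)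
    rw [finsum_eq_sum_of_support_subset (s := hfin.toFinset) _ (by simp), HahnSeries.coeff_sum,
      finsum_eq_sum_of_support_subset (s := hfin.toFinset)]
    · refine sum_congr rfl fun a _ => ?_
      rw [hahn_coeff_mul]
      refine finsum_congr fun b => ?_
      simp only [hcoeff, eqv, Equiv.coe_fn_mk, expoLeft_append, expoRight_append, expoLeft_sub,
        expoRight_sub]
    · intro a ha
      simp only [Set.Finite.coe_toFinset, Function.mem_support]
      intro h0
      refine ha ?_
      have : ∀ b, (X.coeff a).coeff b * (Y.coeff (expoLeft e - a)).coeff (expoRight e - b) =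
          (joinFun X).coeff (eqv (a, b)) * (joinFun Y).coeff (e - eqv (a, b)) := fun b => by
        simp only [hcoeff, eqv, Equiv.coe_fn_mk, expoLeft_append, expoRight_append, expoLeft_sub,
          expoRight_sub]
      simp only [← this]
      rw [← hahn_coeff_mul, h0, HahnSeries.coeff_zero]
  · exact (hahn_finite_support_mul (joinFun X) (joinFun Y) e).preimage eqv.injective.injOn

/-- Iterated Hahn series as Hahn series in all the variables. -/
def hahnJoin (s r : ℕ) : HahnSeries (Expo s) (HahnSeries (Expo r) R) →+*
    HahnSeries (Expo (s + r)) R where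
  toFun := joinFun
  map_mul' := joinFun_mul
  map_one' := by
    ext e
    change ((1 : HahnSeries (Expo s) (HahnSeries (Expo r) R)).coeff (expoLeft e)).coeff
      (expoRight e) = _
    rw [HahnSeries.coeff_one, HahnSeries.coeff_one]
    split_ifs with h1 h2 h2
    · subst h2
      rw [HahnSeries.coeff_one, if_pos expoRight_zero]
    · rw [HahnSeries.coeff_one, if_neg]
      intro h3
      exact h2 (by rw [← expoAppend_left_right e, h1, h3, expoAppend_zero_zero])
    · subst h2
      exact absurd rfl h1
    · simp
  map_zero' := rfl
  map_add' _ _ := rfl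

theorem hahnJoin_coeff {s r : ℕ} (X : HahnSeries (Expo s) (HahnSeries (Expo r) R))
    (e : Expo (s + r)) :
    (hahnJoin s r X).coeff e = (X.coeff (expoLeft e)).coeff (expoRight e) := rfl

theorem hahnJoin_single_single {s r : ℕ} (a : Expo s) (b : Expo r) (c : R) :
    hahnJoin s r (HahnSeries.single a (HahnSeries.single b c)) =
      HahnSeries.single (expoAppend a b) c := by
  ext e
  rw [hahnJoin_coeff, HahnSeries.coeff_single, HahnSeries.coeff_single]
  split_ifs with h1 h2 h2
  · subst h2
    rw [expoRight_append, HahnSeries.coeff_single_same]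
  · rw [HahnSeries.coeff_single_of_ne]
    intro h3
    exact h2 (by rw [← expoAppend_left_right e, h1, h3])
  · subst h2
    exact absurd (expoLeft_append a b) h1
  · simp

@[simp]
theorem hahnJoin_C_C {s r : ℕ} (c : R) :
    hahnJoin s r (HahnSeries.C (HahnSeries.C c)) = HahnSeries.C c := by
  simp only [HahnSeries.C_apply]
  rw [hahnJoin_single_single, expoAppend_zero_zero]

theorem expoAppend_single_left {s r : ℕ} (α : Fin s) (n : ℤ) :
    expoAppend (expoSingle α n) (0 : Expo r) = expoSingle (Fin.castAdd r α) n := by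
  apply ofLex.injective; ext i
  refine Fin.addCases (fun j => ?_) (fun j => ?_) i
  · simp [expoAppend, expoSingle, Pi.single_apply]
  · have : Fin.natAdd s j ≠ Fin.castAdd r α := by
      intro h; have := congrArg Fin.val h; simp at this; omega
    simp [expoAppend, expoSingle, this]

theorem expoAppend_single_right {s r : ℕ} (α : Fin r) (n : ℤ) :
    expoAppend (0 : Expo s) (expoSingle α n) = expoSingle (Fin.natAdd s α) n := by
  apply ofLex.injective; ext i
  refine Fin.addCases (fun j => ?_) (fun j => ?_) i
  · have : Fin.castAdd r j ≠ Fin.natAdd s α := by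
      intro h; have := congrArg Fin.val h; simp at this; omega
    simp [expoAppend, expoSingle, this]
  · simp [expoAppend, expoSingle, Pi.single_apply]

theorem expMul_expoAppend {s r : ℕ} (n : ℕ) (a : Expo s) (b : Expo r) :
    expMul (expoAppend a b) n = expoAppend (expMul a n) (expMul b n) := by
  induction n with
  | zero => simp [expMul_zero]
  | succ n ih => rw [expMul_succ, expMul_succ, expMul_succ, expoAppend_add, ih]

theorem hahnJoin_map_powAlong {s r : ℕ} {g : Expo s} (hg : 0 < g)
    (hg' : 0 < expoAppend g (0 : Expo r)) (f : PowerSeries R) :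
    hahnJoin s r (hahnMap HahnSeries.C (powAlong hg f)) = powAlong hg' f := by
  refine eq_powAlong hg' _ _ (fun n => ?_) fun a ha => ?_
  · rw [hahnJoin_coeff, expMul_expoAppend, expoLeft_append, expoRight_append, hahnMap_coeff,
      coeff_powAlong_nsmul, zero_expMul, HahnSeries.C_apply, HahnSeries.coeff_single_same]
  · rw [hahnJoin_coeff, hahnMap_coeff]
    by_cases h0 : expoRight a = 0
    · rw [coeff_powAlong_of_notMem, map_zero, HahnSeries.coeff_zero]
      intro n hn
      apply ha n
      rw [expMul_expoAppend, hn, zero_expMul, ← h0, expoAppend_left_right]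
    · rw [HahnSeries.C_apply, HahnSeries.coeff_single_of_ne h0]

theorem hahnJoin_C_powAlong {s r : ℕ} {g : Expo r} (hg : 0 < g)
    (hg' : 0 < expoAppend (0 : Expo s) g) (f : PowerSeries R) :
    hahnJoin s r (HahnSeries.C (powAlong hg f)) = powAlong hg' f := by
  refine eq_powAlong hg' _ _ (fun n => ?_) fun a ha => ?_
  · rw [hahnJoin_coeff, expMul_expoAppend, expoLeft_append, expoRight_append, zero_expMul,
      HahnSeries.C_apply, HahnSeries.coeff_single_same, coeff_powAlong_nsmul]
  · rw [hahnJoin_coeff, HahnSeries.C_apply, HahnSeries.coeff_single]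
    split_ifs with h0
    · refine coeff_powAlong_of_notMem _ _ fun n hn => ?_
      apply ha n
      rw [expMul_expoAppend, hn, zero_expMul, ← h0, expoAppend_left_right]
    · simp

theorem hahnMap_hahnJoin {s r : ℕ} (φ : R →+* S)
    (X : HahnSeries (Expo s) (HahnSeries (Expo r) R)) :
    hahnMap φ (hahnJoin s r X) = hahnJoin s r (hahnMap (hahnMap φ) X) := rfl

end Exponents

/-! ### Power series with a given logarithmic derivative -/

section LogDeriv

open PowerSeries

variable {R S : Type*} [CommRing R] [CommRing S]

/-- `F` has constant coefficient `1` and logarithmic derivative `A`. -/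
def HasLogDeriv (A F : PowerSeries R) : Prop :=
  constantCoeff F = 1 ∧ d⁄dX R F = A * F

/-- The equation F' = A F expresses (n + 1) F_{n+1} through lower coefficients, and n + 1 is
invertible over ℚ. The creation exponential is identified with rational series in this way. -/
theorem HasLogDeriv.unique [Algebra ℚ R] {A F G : PowerSeries R} (hF : HasLogDeriv A F)
    (hG : HasLogDeriv A G) : F = G := by
  have hfin : ∀ n, coeff n F = coeff n G := by
    intro n
    induction n using Nat.strong_induction_on with
    | _ n ih =>
      cases n with
      | zero => rw [coeff_zero_eq_constantCoeff_apply, coeff_zero_eq_constantCoeff_apply, hF.1, hG.1]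
      | succ n =>
        have h1 := congrArg (coeff n) hF.2
        have h2 := congrArg (coeff n) hG.2
        rw [coeff_derivative, coeff_mul] at h1 h2
        have h3 : coeff (n + 1) F * ((n : R) + 1) = coeff (n + 1) G * ((n : R) + 1) := by
          rw [h1, h2]
          refine sum_congr rfl fun p hp => ?_
          rw [ih p.2 (by rw [HasAntidiagonal.mem_antidiagonal] at hp; omega)]
        have hu : IsUnit ((n : R) + 1) := by
          have : ((n : R) + 1) = algebraMap ℚ R (n + 1) := by simp
          rw [this]
          exact (IsUnit.mk0 _ (by positivity)).map _
        exact hu.mul_right_cancel h3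
  exact ext hfin

theorem HasLogDeriv.mul {A B F G : PowerSeries R} (hF : HasLogDeriv A F) (hG : HasLogDeriv B G) :
    HasLogDeriv (A + B) (F * G) := by
  refine ⟨by rw [map_mul, hF.1, hG.1, one_mul], ?_⟩
  rw [Derivation.leibniz, hF.2, hG.2, smul_eq_mul, smul_eq_mul]
  ring

theorem HasLogDeriv.one : HasLogDeriv (0 : PowerSeries R) 1 := ⟨by simp, by simp⟩

theorem HasLogDeriv.prod {ι : Type*} (s : Finset ι) {A F : ι → PowerSeries R}
    (h : ∀ i ∈ s, HasLogDeriv (A i) (F i)) : HasLogDeriv (∑ i ∈ s, A i) (∏ i ∈ s, F i) := by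
  classical
  induction s using Finset.induction_on with
  | empty => simpa using HasLogDeriv.one
  | insert a s ha ih =>
    rw [sum_insert ha, prod_insert ha]
    exact (h a (mem_insert_self _ _)).mul (ih fun i hi => h i (mem_insert_of_mem hi))

theorem derivative_map (φ : R →+* S) (F : PowerSeries R) :
    d⁄dX S (F.map φ) = (d⁄dX R F).map φ := by
  ext n
  simp [coeff_derivative]

theorem HasLogDeriv.map {A F : PowerSeries R} (h : HasLogDeriv A F) (φ : R →+* S) :
    HasLogDeriv (A.map φ) (F.map φ) := by
  refine ⟨?_, by rw [derivative_map, h.2, map_mul]⟩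
  rw [← coeff_zero_eq_constantCoeff_apply, coeff_map, coeff_zero_eq_constantCoeff_apply, h.1, map_one]

/-- The geometric series `1 / (1 - x z)`. -/
def geom (x : R) : PowerSeries R := mk fun n => x ^ n

theorem one_sub_mul_geom (x : R) : (1 - C x * X) * geom x = 1 := by
  ext n
  rw [sub_mul, one_mul, map_sub, mul_assoc, coeff_C_mul]
  cases n with
  | zero => simp [geom]
  | succ n =>
    rw [coeff_succ_X_mul]
    simp [geom, pow_succ', coeff_one]

theorem map_geom (φ : R →+* S) (x : R) : (geom x).map φ = geom (φ x) := by
  ext n; simp [geom]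

theorem constantCoeff_geom (x : R) : constantCoeff (geom x) = 1 := by
  rw [← coeff_zero_eq_constantCoeff_apply]; simp [geom]

theorem hasLogDeriv_geom (x : R) : HasLogDeriv (C x * geom x) (geom x) := by
  refine ⟨constantCoeff_geom x, ?_⟩
  have h := congrArg (d⁄dX R) (one_sub_mul_geom x)
  rw [Derivation.leibniz, smul_eq_mul, smul_eq_mul, map_sub, Derivation.leibniz, derivative_C,
    derivative_X, derivative_one] at h
  have h2 := one_sub_mul_geom x
  simp only [smul_eq_mul, mul_one, add_zero, mul_zero, zero_sub] at h
  linear_combination (geom x) * h - (d⁄dX R (geom x)) * h2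

theorem hasLogDeriv_one_sub (x : R) : HasLogDeriv (-(C x * geom x)) (1 - C x * X) := by
  refine ⟨by simp, ?_⟩
  rw [map_sub, Derivation.leibniz, derivative_C, derivative_X, derivative_one]
  simp only [smul_eq_mul, mul_one, mul_zero, add_zero, zero_sub]
  linear_combination (C x) * one_sub_mul_geom x

/-- The series `(1 - y z) / (1 - x z)`. -/
def ratioSeries (x y : R) : PowerSeries R := (1 - C y * X) * geom x

/-- In exponential form the series is exp(∑ (xⁿ - yⁿ) zⁿ/n). Creation parts in finitely many
variables and contractions are products of such factors. -/
theorem hasLogDeriv_ratioSeries (x y : R) :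
    HasLogDeriv (mk fun n => x ^ (n + 1) - y ^ (n + 1)) (ratioSeries x y) := by
  have h : (mk fun n => x ^ (n + 1) - y ^ (n + 1)) = -(C y * geom y) + C x * geom x := by
    ext n
    simp only [geom, pow_succ', coeff_mk, map_add, map_neg, coeff_C_mul]
    ring
  rw [h]
  exact (hasLogDeriv_one_sub y).mul (hasLogDeriv_geom x)

theorem map_ratioSeries (φ : R →+* S) (x y : R) :
    (ratioSeries x y).map φ = ratioSeries (φ x) (φ y) := by
  simp [ratioSeries, map_geom]

theorem ratioSeries_mul_swap (x y : R) : ratioSeries x y * ratioSeries y x = 1 := by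
  rw [ratioSeries, ratioSeries]
  linear_combination (1 - C x * X) * geom x * one_sub_mul_geom y + one_sub_mul_geom x

theorem ratioSeries_self (x : R) : ratioSeries x x = 1 := one_sub_mul_geom x

theorem constantCoeff_ratioSeries (x y : R) : constantCoeff (ratioSeries x y) = 1 :=
  (hasLogDeriv_ratioSeries x y).1

end LogDeriv

/-! ### The creation series -/

section Creation

open PowerSeries

/-- From here on `creationSeries` enters only through this logarithmic derivative; its definition by
substitution into exp is no longer needed. -/
theorem hasLogDeriv_creationSeries :
    HasLogDeriv (mk fun n : ℕ => MvPolynomial.C (1 - tv⁻¹ ^ (n + 1)) *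
      (MvPolynomial.X n.succPNat : SymFun)) creationSeries := by
  set G : PowerSeries SymFun := PowerSeries.mk fun n : ℕ =>
    if h : 0 < n then
      MvPolynomial.C ((1 - tv⁻¹ ^ n) / (n : CQT)) * MvPolynomial.X (⟨n, h⟩ : ℕ+)
    else (0 : SymFun) with hG
  have hG0 : constantCoeff G = 0 := by
    rw [← coeff_zero_eq_constantCoeff_apply, hG, coeff_mk, dif_neg (lt_irrefl 0)]
  have hs : HasSubst G := HasSubst.of_constantCoeff_zero' hG0
  have hc : creationSeries = (PowerSeries.exp SymFun).subst G := rfl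
  refine ⟨?_, ?_⟩
  · rw [hc, ← coeff_zero_eq_constantCoeff_apply, coeff_subst' hs, finsum_eq_single _ 0]
    · simp
    · intro n hn
      rw [coeff_zero_eq_constantCoeff_apply, map_pow, hG0, zero_pow hn, smul_zero]
  · rw [hc, derivative_subst hs, derivative_exp, mul_comm]
    congr 1
    ext1 n
    have key : coeff (n + 1) G = (MvPolynomial.C ((1 - tv⁻¹ ^ (n + 1)) / ((n + 1 : ℕ) : CQT)) :
        SymFun) * MvPolynomial.X n.succPNat := by
      rw [hG, coeff_mk, dif_pos n.succ_pos]
      rfl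
    rw [coeff_derivative, key, coeff_mk]
    have hn : ((n : CQT) + 1) ≠ 0 := by exact_mod_cast n.succ_ne_zero
    have h1 : (MvPolynomial.C ((1 - tv⁻¹ ^ (n + 1)) / ((n + 1 : ℕ) : CQT)) : SymFun) *
        ((n : SymFun) + 1) = MvPolynomial.C (1 - tv⁻¹ ^ (n + 1)) := by
      have h2 : ((n : SymFun) + 1) = MvPolynomial.C ((n : CQT) + 1) := by simp
      rw [h2, ← map_mul]
      congr 1
      push_cast
      field_simp
    linear_combination (MvPolynomial.X n.succPNat : SymFun) * h1

/-- A ring homomorphism sends the creation series to any series with the right logarithmic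
derivative. -/
theorem map_creationSeries_eq {R : Type*} [CommRing R] [Algebra ℚ R] (φ : SymFun →+* R)
    (A F : PowerSeries R) (hF : HasLogDeriv A F)
    (h : ∀ n : ℕ, φ (MvPolynomial.C (1 - tv⁻¹ ^ (n + 1))) *
      φ (MvPolynomial.X n.succPNat) = coeff n A) :
    creationSeries.map φ = F := by
  refine (hasLogDeriv_creationSeries.map φ).unique ?_
  convert hF using 1
  ext n
  rw [coeff_map, coeff_mk, map_mul, h]

end Creation

/-! ### Constant terms in the last variable -/

section ConstantTerm

variable {R S : Type*} [CommRing R] [CommRing S]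

/-- The exponent of `z_α / z_β`. -/
def expoPair {r : ℕ} (α β : Fin r) : Expo r := expoSingle α 1 + expoSingle β (-1)

/-- For α < β the variable z_α is the more significant one, so z_α/z_β counts as small and pair
factors are expanded in its powers. -/
theorem expoPair_pos {r : ℕ} {α β : Fin r} (h : α < β) : 0 < expoPair α β := by
  refine ⟨α, fun j hj => ?_, ?_⟩
  · change (0 : ℤ) = (Pi.single α 1 : Fin r → ℤ) j + (Pi.single β (-1) : Fin r → ℤ) j
    rw [Pi.single_eq_of_ne hj.ne, Pi.single_eq_of_ne (hj.trans h).ne, add_zero]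
  · change (0 : ℤ) < (Pi.single α 1 : Fin r → ℤ) α + (Pi.single β (-1) : Fin r → ℤ) α
    rw [Pi.single_eq_same, Pi.single_eq_of_ne h.ne]
    norm_num

theorem powAlong_congr {Γ : Type*} [AddCommGroup Γ] [LinearOrder Γ] [IsOrderedAddMonoid Γ]
    {g g' : Γ} (h : g = g') (hg : 0 < g) (hg' : 0 < g') (f : PowerSeries R) :
    powAlong hg f = powAlong hg' f := by
  subst h; rfl

/-- Series in the first `r` variables, as series in `r + 1` variables. -/
def hahnIncl (R : Type*) [CommRing R] (r : ℕ) :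
    HahnSeries (Expo r) R →+* HahnSeries (Expo (r + 1)) R :=
  (hahnJoin r 1).comp (hahnMap HahnSeries.C)

theorem hahnIncl_coeff {r : ℕ} (y : HahnSeries (Expo r) R) (e : Expo (r + 1)) :
    (hahnIncl R r y).coeff e =
      (HahnSeries.C (y.coeff (expoLeft e)) : HahnSeries (Expo 1) R).coeff (expoRight e) := rfl

theorem hahnIncl_C {r : ℕ} (c : R) : hahnIncl R r (HahnSeries.C c) = HahnSeries.C c := by
  rw [hahnIncl, RingHom.comp_apply, hahnMap_C, hahnJoin_C_C]

theorem hahnIncl_single {r : ℕ} (a : Expo r) (c : R) :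
    hahnIncl R r (HahnSeries.single a c) =
      HahnSeries.single (expoAppend a (0 : Expo 1)) c := by
  rw [hahnIncl, RingHom.comp_apply, hahnMap_single, HahnSeries.C_apply, hahnJoin_single_single]

theorem expoAppend_castSucc {r : ℕ} (α : Fin r) (n : ℤ) :
    expoAppend (expoSingle α n) (0 : Expo 1) = expoSingle α.castSucc n :=
  expoAppend_single_left α n

theorem expoAppend_pair {r : ℕ} (α β : Fin r) :
    expoAppend (expoPair α β) (0 : Expo 1) = expoPair α.castSucc β.castSucc := by
  rw [expoPair, expoPair, ← expoAppend_castSucc, ← expoAppend_castSucc, ← expoAppend_add, add_zero]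

theorem hahnIncl_powAlong {r : ℕ} {g : Expo r} {g' : Expo (r + 1)} (h : expoAppend g 0 = g')
    (hg : 0 < g) (hg' : 0 < g') (f : PowerSeries R) :
    hahnIncl R r (powAlong hg f) = powAlong hg' f := by
  subst h
  exact hahnJoin_map_powAlong hg hg' f

/-- The exponents with a nonpositive exponent of the last variable. -/
def lastNonpos (r : ℕ) : AddSubmonoid (Expo (r + 1)) where
  carrier := {e | ofLex e (Fin.last r) ≤ 0}
  add_mem' := fun ha hb => add_nonpos (α := ℤ) ha hb
  zero_mem' := le_refl (0 : ℤ)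

/-- The exponents with a nonnegative exponent of the last variable. -/
def lastNonneg (r : ℕ) : AddSubmonoid (Expo (r + 1)) where
  carrier := {e | 0 ≤ ofLex e (Fin.last r)}
  add_mem' := fun ha hb => add_nonneg (α := ℤ) ha hb
  zero_mem' := le_refl (0 : ℤ)

theorem hahnIncl_coeff_eq_zero {r : ℕ} (y : HahnSeries (Expo r) R) {e : Expo (r + 1)}
    (he : ofLex e (Fin.last r) ≠ 0) : (hahnIncl R r y).coeff e = 0 := by
  rw [hahnIncl_coeff, HahnSeries.C_apply, HahnSeries.coeff_single_of_ne]
  intro h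
  exact he (congrFun (congrArg ofLex h) 0)

theorem hahnIncl_mem_nonpos {r : ℕ} (y : HahnSeries (Expo r) R) :
    hahnIncl R r y ∈ hahnSupported R (lastNonpos r) := fun e he => by
  by_contra h
  exact he (hahnIncl_coeff_eq_zero y fun h0 => h h0.le)

theorem hahnIncl_mem_nonneg {r : ℕ} (y : HahnSeries (Expo r) R) :
    hahnIncl R r y ∈ hahnSupported R (lastNonneg r) := fun e he => by
  by_contra h
  exact he (hahnIncl_coeff_eq_zero y fun h0 => h h0.ge)

theorem hahnIncl_coeff_zero {r : ℕ} (y : HahnSeries (Expo r) R) :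
    (hahnIncl R r y).coeff 0 = y.coeff 0 := by
  rw [hahnIncl_coeff, expoLeft_zero, expoRight_zero, HahnSeries.C_apply,
    HahnSeries.coeff_single_same]

/-- The inverse of the last variable. -/
def lastInv (R : Type*) [CommRing R] (r : ℕ) : HahnSeries (Expo (r + 1)) R :=
  HahnSeries.single (expoSingle (Fin.last r) (-1)) 1

theorem lastInv_mem {r : ℕ} : lastInv R r ∈ hahnSupported R (lastNonpos r) := by
  refine single_mem_hahnSupported ?_ 1
  change (Pi.single (Fin.last r) (-1) : Fin (r + 1) → ℤ) (Fin.last r) ≤ 0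
  rw [Pi.single_eq_same]
  norm_num

/-- `F` agrees with `y` when the last variable is set to `1 / x`. -/
def LastEval {r : ℕ} (x : R) (F : HahnSeries (Expo (r + 1)) R) (y : HahnSeries (Expo r) R) :
    Prop :=
  ∃ Q ∈ hahnSupported R (lastNonpos r),
    F = hahnIncl R r y + (lastInv R r - HahnSeries.C x) * Q

theorem LastEval.incl {r : ℕ} (x : R) (y : HahnSeries (Expo r) R) :
    LastEval x (hahnIncl R r y) y := ⟨0, Subring.zero_mem _, by simp⟩

theorem LastEval.inv {r : ℕ} (x : R) :
    LastEval x (lastInv R r) (HahnSeries.C x) :=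
  ⟨1, Subring.one_mem _, by rw [hahnIncl_C]; ring⟩

theorem LastEval.mem {r : ℕ} {x : R} {F : HahnSeries (Expo (r + 1)) R}
    {y : HahnSeries (Expo r) R} (h : LastEval x F y) :
    F ∈ hahnSupported R (lastNonpos r) := by
  obtain ⟨Q, hQ, rfl⟩ := h
  exact Subring.add_mem _ (hahnIncl_mem_nonpos y)
    (Subring.mul_mem _ (Subring.sub_mem _ lastInv_mem (C_mem_hahnSupported _ _)) hQ)

theorem LastEval.add {r : ℕ} {x : R} {F F' : HahnSeries (Expo (r + 1)) R}
    {y y' : HahnSeries (Expo r) R} (h : LastEval x F y) (h' : LastEval x F' y') :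
    LastEval x (F + F') (y + y') := by
  obtain ⟨Q, hQ, rfl⟩ := h
  obtain ⟨Q', hQ', rfl⟩ := h'
  exact ⟨Q + Q', Subring.add_mem _ hQ hQ', by rw [map_add]; ring⟩

theorem LastEval.mul {r : ℕ} {x : R} {F F' : HahnSeries (Expo (r + 1)) R}
    {y y' : HahnSeries (Expo r) R} (h : LastEval x F y) (h' : LastEval x F' y') :
    LastEval x (F * F') (y * y') := by
  have hF' := h'.mem
  obtain ⟨Q, hQ, rfl⟩ := h
  obtain ⟨Q', hQ', h2⟩ := h'
  refine ⟨hahnIncl R r y * Q' + Q * F', Subring.add_mem _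
    (Subring.mul_mem _ (hahnIncl_mem_nonpos y) hQ') (Subring.mul_mem _ hQ hF'), ?_⟩
  rw [map_mul]
  linear_combination (hahnIncl R r y) * h2

/-- If F = y + (z⁻¹ - x) Q then F' = y' - (z⁻¹ - x) Q F' y'. The condition on the support of F'
keeps the new quotient free of positive powers of the last variable z. -/
theorem LastEval.inverse {r : ℕ} {x : R} {F F' : HahnSeries (Expo (r + 1)) R}
    {y y' : HahnSeries (Expo r) R} (h : LastEval x F y)
    (hF' : F' ∈ hahnSupported R (lastNonpos r)) (h1 : F * F' = 1) (h2 : y * y' = 1) :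
    LastEval x F' y' := by
  obtain ⟨Q, hQ, rfl⟩ := h
  refine ⟨-(Q * F' * hahnIncl R r y'), Subring.neg_mem _ (Subring.mul_mem _
    (Subring.mul_mem _ hQ hF') (hahnIncl_mem_nonpos y')), ?_⟩
  have h3 : hahnIncl R r y * hahnIncl R r y' = 1 := by rw [← map_mul, h2, map_one]
  linear_combination (hahnIncl R r y') * h1 - F' * h3

theorem LastEval.prod {r : ℕ} {x : R} {ι : Type*} (s : Finset ι)
    {F : ι → HahnSeries (Expo (r + 1)) R} {y : ι → HahnSeries (Expo r) R}
    (h : ∀ i, LastEval x (F i) (y i)) : LastEval x (∏ i ∈ s, F i) (∏ i ∈ s, y i) := by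
  classical
  induction s using Finset.induction_on with
  | empty => simpa using LastEval.incl (r := r) x 1
  | insert a s ha ih =>
    rw [prod_insert ha, prod_insert ha]
    exact (h a).mul ih

theorem LastEval.pow {r : ℕ} {x : R} {F : HahnSeries (Expo (r + 1)) R}
    {y : HahnSeries (Expo r) R} (h : LastEval x F y) (k : ℕ) : LastEval x (F ^ k) (y ^ k) := by
  simpa using LastEval.prod (range k) (F := fun _ => F) (y := fun _ => y) fun _ => h

theorem LastEval.polynomial {r : ℕ} (x : R) (p : Polynomial (HahnSeries (Expo r) R)) :
    LastEval x (p.eval₂ (hahnIncl R r) (lastInv R r)) (p.eval (HahnSeries.C x)) := by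
  induction p using Polynomial.induction_on' with
  | add p q hp hq =>
    rw [Polynomial.eval₂_add, Polynomial.eval_add]
    exact hp.add hq
  | monomial n a =>
    rw [Polynomial.eval₂_monomial, Polynomial.eval_monomial]
    exact (LastEval.incl x a).mul ((LastEval.inv x).pow n)

theorem powAlong_geom {Γ : Type*} [AddCommGroup Γ] [LinearOrder Γ] [IsOrderedAddMonoid Γ]
    {g : Γ} (hg : 0 < g) (x : R) :
    (1 - HahnSeries.C x * HahnSeries.single g 1) * powAlong hg (geom x) = 1 := by
  have h := congrArg (powAlong hg) (one_sub_mul_geom x)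
  rwa [map_mul, map_sub, map_mul, powAlong_C, powAlong_X, map_one] at h

theorem powAlong_ratioSeries {Γ : Type*} [AddCommGroup Γ] [LinearOrder Γ] [IsOrderedAddMonoid Γ]
    {g : Γ} (hg : 0 < g) (x y : R) :
    powAlong hg (ratioSeries x y) =
      (1 - HahnSeries.C y * HahnSeries.single g 1) * powAlong hg (geom x) := by
  rw [ratioSeries, map_mul, map_sub, map_mul, powAlong_C, powAlong_X, map_one]

theorem single_expoPair_last {r : ℕ} (α : Fin r) :
    (HahnSeries.single (expoPair α.castSucc (Fin.last r)) 1 : HahnSeries (Expo (r + 1)) R) =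
      hahnIncl R r (HahnSeries.single (expoSingle α 1) 1) * lastInv R r := by
  rw [hahnIncl_single, expoAppend_castSucc, lastInv, HahnSeries.single_mul_single, mul_one]
  rfl

theorem expoPair_last_mem {r : ℕ} (α : Fin r) :
    expoPair α.castSucc (Fin.last r) ∈ lastNonpos r := by
  change (Pi.single α.castSucc 1 : Fin (r + 1) → ℤ) (Fin.last r) +
    (Pi.single (Fin.last r) (-1) : Fin (r + 1) → ℤ) (Fin.last r) ≤ 0
  rw [Pi.single_eq_same, Pi.single_eq_of_ne (Fin.castSucc_lt_last α).ne']
  norm_num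

/-- Setting the inverse of the last variable to x turns a series in z_α/z_{r+1} into the same series
in x z_α. Numerator and denominator are linear and are evaluated separately. -/
theorem LastEval.pair {r : ℕ} (x c d : R) (α : Fin r) :
    LastEval x (powAlong (expoPair_pos (Fin.castSucc_lt_last α)) (ratioSeries c d))
      (powAlong (expoSingle_pos α) (ratioSeries (c * x) (d * x))) := by
  have key : ∀ a : R, LastEval x
      (1 - HahnSeries.C a * HahnSeries.single (expoPair α.castSucc (Fin.last r)) 1)
      (1 - HahnSeries.C (a * x) * HahnSeries.single (expoSingle α 1) 1) := by
    intro a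
    rw [single_expoPair_last]
    have h := (LastEval.incl x (1 : HahnSeries (Expo r) R)).add
      ((LastEval.incl x (-(HahnSeries.C a * HahnSeries.single (expoSingle α 1) 1))).mul
        (LastEval.inv x))
    convert h using 1
    · rw [(hahnIncl R r).map_one, map_neg, map_mul, hahnIncl_C]; ring_nf
    · rw [map_mul]; ring_nf
  rw [powAlong_ratioSeries, powAlong_ratioSeries]
  refine (key d).mul ((key c).inverse ?_ (powAlong_geom _ _) (powAlong_geom _ _))
  exact powAlong_mem_hahnSupported _ (expoPair_last_mem α) _

/-- The residue theorem in algebraic form. With g = 1/(1 - xz) one has g (z⁻¹ - x) = z⁻¹, hence g F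
= y + z (x g y) + z⁻¹ Q. The second term has only positive and the third only negative powers of z,
so y alone reaches the constant term. -/
theorem coeff_zero_of_lastEval {r : ℕ} {x : R} {F : HahnSeries (Expo (r + 1)) R}
    {y : HahnSeries (Expo r) R} (h : LastEval x F y) :
    (powAlong (expoSingle_pos (Fin.last r)) (geom x) * F).coeff 0 = y.coeff 0 := by
  obtain ⟨Q, hQ, rfl⟩ := h
  set g : HahnSeries (Expo (r + 1)) R := powAlong (expoSingle_pos (Fin.last r)) (geom x) with hg
  have h1 := powAlong_geom (expoSingle_pos (Fin.last r)) x
  rw [← hg] at h1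
  set z : HahnSeries (Expo (r + 1)) R := HahnSeries.single (expoSingle (Fin.last r) 1) 1 with hz
  have h2 : lastInv R r * z = 1 := by
    rw [lastInv, hz, HahnSeries.single_mul_single, ← expoSingle_add, mul_one]
    simp
  have h3 : g * (hahnIncl R r y + (lastInv R r - HahnSeries.C x) * Q) =
      hahnIncl R r y + z * (HahnSeries.C x * g * hahnIncl R r y) + lastInv R r * Q := by
    linear_combination (hahnIncl R r y) * h1 + lastInv R r * Q * h1 +
      (HahnSeries.C x * g * Q) * h2
  have hlast : ∀ m : ℤ, ofLex (expoSingle (Fin.last r) m) (Fin.last r) = m := fun m => by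
    simp [expoSingle]
  rw [h3, HahnSeries.coeff_add, HahnSeries.coeff_add, hahnIncl_coeff_zero]
  have h4 : (z * (HahnSeries.C x * g * hahnIncl R r y)).coeff 0 = 0 := by
    rw [hz, HahnSeries.coeff_single_mul, one_mul]
    by_contra h
    have hm : HahnSeries.C x * g * hahnIncl R r y ∈ hahnSupported R (lastNonneg r) :=
      Subring.mul_mem _ (Subring.mul_mem _ (C_mem_hahnSupported _ _)
        (powAlong_mem_hahnSupported _ (by change (0 : ℤ) ≤ _; rw [hlast]; norm_num) _))
        (hahnIncl_mem_nonneg y)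
    have := hm _ h
    rw [zero_sub, neg_expoSingle] at this
    have h5 : (0 : ℤ) ≤ ofLex (expoSingle (Fin.last r) (-1)) (Fin.last r) := this
    rw [hlast] at h5
    norm_num at h5
  have h5 : (lastInv R r * Q).coeff 0 = 0 := by
    rw [lastInv, HahnSeries.coeff_single_mul, one_mul]
    by_contra h
    have := hQ _ h
    rw [zero_sub, neg_expoSingle] at this
    have h5 : ofLex (expoSingle (Fin.last r) (- -1)) (Fin.last r) ≤ (0 : ℤ) := this
    rw [hlast] at h5
    norm_num at h5
  rw [h4, h5, add_zero, add_zero]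

end ConstantTerm

/-! ### The kernel -/

section Kernel

variable {R S : Type*} [CommRing R] [CommRing S]

/-- The factor `(1 - z_α / z_β) / (1 - c z_α / z_β)` if `α < β`, and `1` otherwise. -/
def pairFactor (c : R) {r : ℕ} (α β : Fin r) : HahnSeries (Expo r) R :=
  if h : α < β then powAlong (expoPair_pos h) (ratioSeries c 1) else 1

/-- The kernel `∏_{α < β} (1 - z_α / z_β) / (1 - c z_α / z_β)`. -/
def pairKernel (c : R) (r : ℕ) : HahnSeries (Expo r) R :=
  ∏ β : Fin r, ∏ α : Fin r, pairFactor c α β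

theorem pairKernel_succ (c : R) (r : ℕ) :
    pairKernel c (r + 1) = hahnIncl R r (pairKernel c r) *
      ∏ α : Fin r, powAlong (expoPair_pos (Fin.castSucc_lt_last α)) (ratioSeries c 1) := by
  rw [pairKernel, Fin.prod_univ_castSucc]
  congr 1
  · rw [pairKernel, map_prod]
    refine prod_congr rfl fun β _ => ?_
    rw [Fin.prod_univ_castSucc, map_prod]
    have h1 : pairFactor c (Fin.last r) β.castSucc = 1 :=
      dif_neg (not_lt.2 (Fin.castSucc_lt_last β).le)
    rw [h1, mul_one]
    refine prod_congr rfl fun α _ => ?_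
    by_cases h : α < β
    · have h' : α.castSucc < β.castSucc := Fin.castSucc_lt_castSucc_iff.2 h
      rw [pairFactor, pairFactor, dif_pos h, dif_pos h']
      exact (hahnIncl_powAlong (expoAppend_pair α β) _ _ _).symm
    · have h' : ¬α.castSucc < β.castSucc := fun h2 => h (Fin.castSucc_lt_castSucc_iff.1 h2)
      rw [pairFactor, pairFactor, dif_neg h, dif_neg h', map_one]
  · rw [Fin.prod_univ_castSucc]
    have h1 : pairFactor c (Fin.last r) (Fin.last r) = 1 := dif_neg (lt_irrefl _)
    rw [h1, mul_one]
    exact prod_congr rfl fun α _ => dif_pos (Fin.castSucc_lt_last α)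

theorem hahnMap_pairKernel (φ : R →+* S) (c : R) (r : ℕ) :
    hahnMap φ (pairKernel c r) = pairKernel (φ c) r := by
  rw [pairKernel, pairKernel, map_prod]
  refine prod_congr rfl fun β _ => ?_
  rw [map_prod]
  refine prod_congr rfl fun α _ => ?_
  rw [pairFactor, pairFactor]
  split_ifs with h
  · rw [hahnMap_powAlong, map_ratioSeries, map_one]
  · rw [map_one]

/-- The product over the variables of the series `u (z_α)`. -/
def seriesProd (u : PowerSeries R) (r : ℕ) : HahnSeries (Expo r) R :=
  ∏ α : Fin r, powAlong (expoSingle_pos α) u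

theorem seriesProd_succ (u : PowerSeries R) (r : ℕ) :
    seriesProd u (r + 1) = hahnIncl R r (seriesProd u r) *
      powAlong (expoSingle_pos (Fin.last r)) u := by
  rw [seriesProd, Fin.prod_univ_castSucc, seriesProd, map_prod]
  congr 1
  refine prod_congr rfl fun α _ => ?_
  exact (hahnIncl_powAlong (expoAppend_castSucc α 1) _ _ _).symm

theorem hahnMap_seriesProd (φ : R →+* S) (u : PowerSeries R) (r : ℕ) :
    hahnMap φ (seriesProd u r) = seriesProd (u.map φ) r := by
  rw [seriesProd, seriesProd, map_prod]
  exact prod_congr rfl fun α _ => hahnMap_powAlong _ _ _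

theorem seriesProd_mul (u v : PowerSeries R) (r : ℕ) :
    seriesProd (u * v) r = seriesProd u r * seriesProd v r := by
  simp only [seriesProd, map_mul, prod_mul_distrib]

theorem creation_eq_seriesProd (r : ℕ) : creation r = seriesProd creationSeries r :=
  prod_congr rfl fun α _ => inVariable_eq_powAlong α _

theorem lastInv_pow {r : ℕ} (k : ℕ) :
    lastInv R r ^ k = HahnSeries.single (expoSingle (Fin.last r) (-(k : ℤ))) 1 := by
  induction k with
  | zero => simp
  | succ k ih =>
    rw [pow_succ, ih, lastInv, HahnSeries.single_mul_single, ← expoSingle_add, mul_one]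
    congr 2
    push_cast
    ring_nf

variable [Algebra CQT R] [Algebra CQT S]

/-- The translation `p_k ↦ P_k - (1 - q^k) ∑_α z_α^{-k}`. -/
def translation (P : ℕ+ → R) (r : ℕ) : SymFun →ₐ[CQT] HahnSeries (Expo r) R :=
  MvPolynomial.aeval fun k : ℕ+ => HahnSeries.C (P k) -
    ∑ α : Fin r, HahnSeries.single (expoSingle α (-((k : ℕ) : ℤ)))
      (algebraMap CQT R (1 - qv ^ (k : ℕ)))

theorem annihilation_eq_translation (r : ℕ) :
    annihilation r = translation (fun k => MvPolynomial.X k) r := rfl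

theorem translation_X (P : ℕ+ → R) (r : ℕ) (k : ℕ+) :
    translation P r (MvPolynomial.X k) = HahnSeries.C (P k) -
      ∑ α : Fin r, HahnSeries.single (expoSingle α (-((k : ℕ) : ℤ)))
        (algebraMap CQT R (1 - qv ^ (k : ℕ))) := MvPolynomial.aeval_X _ _

theorem algebraMap_hahn {r : ℕ} (c : CQT) :
    algebraMap CQT (HahnSeries (Expo r) R) c = HahnSeries.C (algebraMap CQT R c) := rfl

theorem hahnMap_translation (φ : R →ₐ[CQT] S) (P : ℕ+ → R) (r : ℕ) (f : SymFun) :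
    hahnMap (φ : R →+* S) (translation P r f) = translation (fun k => φ (P k)) r f := by
  induction f using MvPolynomial.induction_on with
  | C a =>
    rw [← MvPolynomial.algebraMap_eq, AlgHom.commutes, AlgHom.commutes, algebraMap_hahn,
      algebraMap_hahn, hahnMap_C]
    simp
  | add f g hf hg => rw [map_add, map_add, hf, hg, map_add]
  | mul_X f k hf =>
    rw [map_mul, map_mul, hf, map_mul]
    congr 1
    rw [translation_X, translation_X, map_sub, map_sum, hahnMap_C]
    simp

theorem translation_zero_coeff (P : ℕ+ → R) (f : SymFun) :
    translation P 0 f = HahnSeries.C (MvPolynomial.aeval P f) := by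
  induction f using MvPolynomial.induction_on with
  | C a =>
    rw [← MvPolynomial.algebraMap_eq, AlgHom.commutes, AlgHom.commutes, algebraMap_hahn]
  | add f g hf hg => rw [map_add, map_add, hf, hg, map_add]
  | mul_X f k hf => rw [map_mul, map_mul, hf, map_mul, translation_X]; simp

/-- The translation in `r + 1` variables as a polynomial in the inverse of the last variable. -/
def translationPoly (P : ℕ+ → R) (r : ℕ) : SymFun →ₐ[CQT] Polynomial (HahnSeries (Expo r) R) :=
  MvPolynomial.aeval fun k : ℕ+ => Polynomial.C (translation P r (MvPolynomial.X k)) -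
    Polynomial.C (HahnSeries.C (algebraMap CQT R (1 - qv ^ (k : ℕ)))) * Polynomial.X ^ (k : ℕ)

theorem translationPoly_eval₂ (P : ℕ+ → R) (r : ℕ) (f : SymFun) :
    (translationPoly P r f).eval₂ (hahnIncl R r) (lastInv R r) = translation P (r + 1) f := by
  induction f using MvPolynomial.induction_on with
  | C a =>
    rw [← MvPolynomial.algebraMap_eq, AlgHom.commutes, AlgHom.commutes, algebraMap_hahn,
      Polynomial.algebraMap_apply, Polynomial.eval₂_C, algebraMap_hahn, hahnIncl_C]
  | add f g hf hg => rw [map_add, Polynomial.eval₂_add, hf, hg, map_add]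
  | mul_X f k hf =>
    rw [map_mul, Polynomial.eval₂_mul, hf, map_mul, translationPoly, MvPolynomial.aeval_X,
      translation_X, translation_X, Polynomial.eval₂_sub, Polynomial.eval₂_C, Polynomial.eval₂_mul,
      Polynomial.eval₂_C, Polynomial.eval₂_pow, Polynomial.eval₂_X, hahnIncl_C, map_sub, map_sum,
      hahnIncl_C, Fin.sum_univ_castSucc, lastInv_pow]
    congr 1
    rw [sub_sub]
    congr 2
    · refine sum_congr rfl fun α _ => ?_
      rw [hahnIncl_single, expoAppend_castSucc]
    · rw [HahnSeries.C_apply, HahnSeries.single_mul_single, zero_add, mul_one]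

/-- Evaluating the last variable subtracts (1 - q^k) x^k from the k-th power sum; when x is one of
the variables, this replaces x by q x. -/
theorem translationPoly_eval (P : ℕ+ → R) (r : ℕ) (x : R) (f : SymFun) :
    (translationPoly P r f).eval (HahnSeries.C x) =
      translation (fun k => P k - algebraMap CQT R (1 - qv ^ (k : ℕ)) * x ^ (k : ℕ)) r f := by
  induction f using MvPolynomial.induction_on with
  | C a =>
    rw [← MvPolynomial.algebraMap_eq, AlgHom.commutes, AlgHom.commutes, algebraMap_hahn,
      Polynomial.algebraMap_apply, Polynomial.eval_C, algebraMap_hahn]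
  | add f g hf hg => rw [map_add, Polynomial.eval_add, hf, hg, map_add]
  | mul_X f k hf =>
    rw [map_mul, Polynomial.eval_mul, hf, map_mul, translationPoly, MvPolynomial.aeval_X,
      translation_X, translation_X, Polynomial.eval_sub, Polynomial.eval_C, Polynomial.eval_mul,
      Polynomial.eval_C, Polynomial.eval_pow, Polynomial.eval_X,
      map_sub (HahnSeries.C : R →+* HahnSeries (Expo r) R) (P k),
      map_mul (HahnSeries.C : R →+* HahnSeries (Expo r) R),
      map_pow (HahnSeries.C : R →+* HahnSeries (Expo r) R)]
    congr 1
    ring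

/-- The constant term of the kernel, the series `u` in all the variables and the translation. -/
def constTerm (c : R) (u : PowerSeries R) (P : ℕ+ → R) (r : ℕ) (f : SymFun) : R :=
  (pairKernel c r * seriesProd u r * translation P r f).coeff 0

theorem constTerm_zero (c : R) (u : PowerSeries R) (P : ℕ+ → R) (f : SymFun) :
    constTerm c u P 0 f = MvPolynomial.aeval P f := by
  rw [constTerm, translation_zero_coeff, pairKernel, seriesProd, Fin.prod_univ_zero,
    Fin.prod_univ_zero, one_mul, one_mul, HahnSeries.C_apply, HahnSeries.coeff_single_same]

/-- If `u` is a combination of geometric series, the constant term in the last variable is a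
combination of values. -/
theorem constTerm_succ {ι : Type*} (s : Finset ι) (c : R) (u : PowerSeries R) (P : ℕ+ → R)
    (A x : ι → R) (hu : u = ∑ i ∈ s, PowerSeries.C (A i) * geom (x i)) (r : ℕ) (f : SymFun) :
    constTerm c u P (r + 1) f = ∑ i ∈ s, A i * constTerm c (u * ratioSeries (c * x i) (x i))
      (fun k => P k - algebraMap CQT R (1 - qv ^ (k : ℕ)) * x i ^ (k : ℕ)) r f := by
  have h1 : ∀ i, (powAlong (expoSingle_pos (Fin.last r)) (geom (x i)) *
      (hahnIncl R r (pairKernel c r * seriesProd u r) *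
        (∏ α : Fin r, powAlong (expoPair_pos (Fin.castSucc_lt_last α)) (ratioSeries c 1)) *
        translation P (r + 1) f)).coeff 0 = constTerm c (u * ratioSeries (c * x i) (x i))
      (fun k => P k - algebraMap CQT R (1 - qv ^ (k : ℕ)) * x i ^ (k : ℕ)) r f := by
    intro i
    rw [← translationPoly_eval₂, coeff_zero_of_lastEval (((LastEval.incl (x i) _).mul
      (LastEval.prod univ fun α => LastEval.pair (x i) c 1 α)).mul
      (LastEval.polynomial (x i) _)), constTerm, translationPoly_eval, seriesProd_mul, ← mul_assoc]
    simp only [one_mul]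
    rfl
  rw [constTerm, pairKernel_succ, seriesProd_succ]
  have h2 : powAlong (expoSingle_pos (Fin.last r)) u = ∑ i ∈ s, HahnSeries.C (A i) *
      powAlong (expoSingle_pos (Fin.last r)) (geom (x i)) := by
    conv_lhs => rw [hu]
    rw [map_sum]
    exact sum_congr rfl fun i _ => by rw [map_mul, powAlong_C]
  rw [h2]
  have h3 : hahnIncl R r (pairKernel c r) *
      (∏ α : Fin r, powAlong (expoPair_pos (Fin.castSucc_lt_last α)) (ratioSeries c 1)) *
      (hahnIncl R r (seriesProd u r) * ∑ i ∈ s, HahnSeries.C (A i) *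
        powAlong (expoSingle_pos (Fin.last r)) (geom (x i))) * translation P (r + 1) f =
      ∑ i ∈ s, HahnSeries.C (A i) * (powAlong (expoSingle_pos (Fin.last r)) (geom (x i)) *
      (hahnIncl R r (pairKernel c r * seriesProd u r) *
        (∏ α : Fin r, powAlong (expoPair_pos (Fin.castSucc_lt_last α)) (ratioSeries c 1)) *
        translation P (r + 1) f)) := by
    rw [map_mul, mul_sum, mul_sum, sum_mul]
    exact sum_congr rfl fun i _ => by ring
  rw [h3, HahnSeries.coeff_sum]
  refine sum_congr rfl fun i _ => ?_
  rw [hahn_coeff_C_mul, h1]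

end Kernel

/-! ### The restriction of the vertex operator to finitely many variables -/

section Residues

variable {K : Type*} [Field K] {ι : Type*}

theorem natDegree_one_sub_le (a : K) : (1 - Polynomial.C a * Polynomial.X).natDegree ≤ 1 := by
  compute_degree

theorem coeff_prod_one_sub (s : Finset ι) (a : ι → K) :
    (∏ i ∈ s, (1 - Polynomial.C (a i) * Polynomial.X)).coeff s.card = ∏ i ∈ s, (-a i) := by
  have h := Polynomial.coeff_prod_of_natDegree_le s
    (fun i => 1 - Polynomial.C (a i) * Polynomial.X) 1 fun i _ => natDegree_one_sub_le (a i)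
  rw [mul_one] at h
  rw [h]
  refine prod_congr rfl fun i _ => ?_
  simp [Polynomial.coeff_one]

theorem natDegree_prod_one_sub_le (s : Finset ι) (a : ι → K) :
    (∏ i ∈ s, (1 - Polynomial.C (a i) * Polynomial.X)).natDegree ≤ s.card := by
  refine (Polynomial.natDegree_prod_le _ _).trans ?_
  rw [card_eq_sum_ones]
  exact sum_le_sum fun i _ => natDegree_one_sub_le (a i)

variable [DecidableEq ι]

/-- The weight `(x_i - c x_j) / (x_i - x_j)`. -/
def crossWeight (c : K) (x : ι → K) (i j : ι) : K := (x i - c * x j) / (x i - x j)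

/-- Partial fractions with denominators cleared. Both sides have degree at most |s| with equal
coefficients in degree |s|, so the difference has degree below |s|, and it vanishes at the |s|
distinct points 1/x_i. -/
theorem prod_one_sub_eq (c : K) (x : ι → K) (hx : Function.Injective x) (h0 : ∀ i, x i ≠ 0)
    (s : Finset ι) :
    ∏ i ∈ s, (1 - Polynomial.C (c * x i) * Polynomial.X) =
      Polynomial.C (c ^ s.card) * ∏ i ∈ s, (1 - Polynomial.C (x i) * Polynomial.X) +
      ∑ i ∈ s, Polynomial.C ((1 - c) * ∏ j ∈ s.erase i, crossWeight c x i j) *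
        ∏ j ∈ s.erase i, (1 - Polynomial.C (x j) * Polynomial.X) := by
  classical
  rw [← sub_eq_zero]
  refine Polynomial.eq_zero_of_degree_lt_of_eval_finset_eq_zero (s.image fun i => (x i)⁻¹) ?_ ?_
  · have hinj : Function.Injective fun i => (x i)⁻¹ := inv_injective.comp hx
    rw [card_image_of_injective _ hinj, Polynomial.degree_lt_iff_coeff_zero]
    intro m hm
    rw [Polynomial.coeff_sub, Polynomial.coeff_add, Polynomial.coeff_C_mul,
      Polynomial.finsetSum_coeff]
    have h1 : ∑ i ∈ s, (Polynomial.C ((1 - c) * ∏ j ∈ s.erase i, crossWeight c x i j) *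
        ∏ j ∈ s.erase i, (1 - Polynomial.C (x j) * Polynomial.X)).coeff m = 0 := by
      refine sum_eq_zero fun i hi => ?_
      rw [Polynomial.coeff_C_mul, Polynomial.coeff_eq_zero_of_natDegree_lt, mul_zero]
      refine (natDegree_prod_one_sub_le _ _).trans_lt ?_
      rw [card_erase_of_mem hi]
      have := card_pos.2 ⟨i, hi⟩
      omega
    rw [h1, add_zero]
    rcases hm.eq_or_lt with rfl | hm
    · rw [coeff_prod_one_sub, coeff_prod_one_sub, ← prod_const, ← prod_mul_distrib, sub_eq_zero]
      exact prod_congr rfl fun i _ => by ring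
    · rw [Polynomial.coeff_eq_zero_of_natDegree_lt
        ((natDegree_prod_one_sub_le _ _).trans_lt hm), Polynomial.coeff_eq_zero_of_natDegree_lt
        ((natDegree_prod_one_sub_le _ _).trans_lt hm), mul_zero, sub_zero]
  · intro y hy
    obtain ⟨i, hi, rfl⟩ := mem_image.1 hy
    simp only [Polynomial.eval_sub, Polynomial.eval_add, Polynomial.eval_mul, Polynomial.eval_C,
      Polynomial.eval_finsetSum, Polynomial.eval_prod, Polynomial.eval_one, Polynomial.eval_X]
    have h1 : ∏ j ∈ s, (1 - x j * (x i)⁻¹) = 0 :=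
      prod_eq_zero hi (by rw [mul_inv_cancel₀ (h0 i), sub_self])
    rw [h1, mul_zero, zero_add, sum_eq_single i, ← mul_prod_erase s _ hi, mul_assoc (1 - c),
      ← prod_mul_distrib, sub_eq_zero]
    · congr 1
      · rw [mul_assoc c, mul_inv_cancel₀ (h0 i), mul_one]
      · refine prod_congr rfl fun j hj => ?_
        have hij : x i - x j ≠ 0 := sub_ne_zero.2 fun h => (ne_of_mem_erase hj) (hx h).symm
        have := h0 i
        rw [crossWeight]
        field_simp
    · intro j _ hji
      have h2 : ∏ k ∈ s.erase j, (1 - x k * (x i)⁻¹) = 0 :=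
        prod_eq_zero (mem_erase.2 ⟨hji.symm, hi⟩) (by rw [mul_inv_cancel₀ (h0 i), sub_self])
      rw [h2, mul_zero]
    · exact fun h => absurd hi h

/-- The series `∏_{i ∈ s} (1 - c x_i z) / (1 - x_i z)`. -/
def ratioProd (c : K) (x : ι → K) (s : Finset ι) : PowerSeries K :=
  ∏ i ∈ s, ratioSeries (x i) (c * x i)

/-- The constant c^|s| is the value at z = ∞; the remaining terms belong to the poles z = 1/x_i. -/
theorem ratioProd_eq_sum (c : K) (x : ι → K) (hx : Function.Injective x) (h0 : ∀ i, x i ≠ 0)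
    (s : Finset ι) :
    ratioProd c x s = PowerSeries.C (c ^ s.card) +
      ∑ i ∈ s, PowerSeries.C ((1 - c) * ∏ j ∈ s.erase i, crossWeight c x i j) * geom (x i) := by
  have h := congrArg (Polynomial.coeToPowerSeries.ringHom (R := K)) (prod_one_sub_eq c x hx h0 s)
  simp only [map_prod, map_add, map_mul, map_sum, map_sub, map_one] at h
  simp only [Polynomial.coeToPowerSeries.ringHom_apply, Polynomial.coe_C, Polynomial.coe_X] at h
  have hg : (∏ i ∈ s, (1 - PowerSeries.C (x i) * PowerSeries.X)) * ∏ i ∈ s, geom (x i) = 1 := by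
    rw [← prod_mul_distrib]
    exact prod_eq_one fun i _ => one_sub_mul_geom (x i)
  have h2 : ratioProd c x s = (∏ i ∈ s, (1 - PowerSeries.C (c * x i) * PowerSeries.X)) *
      ∏ i ∈ s, geom (x i) := by
    rw [ratioProd, ← prod_mul_distrib]; rfl
  have h' : ∏ i ∈ s, (1 - PowerSeries.C (c * x i) * PowerSeries.X) =
      PowerSeries.C (c ^ s.card) * ∏ i ∈ s, (1 - PowerSeries.C (x i) * PowerSeries.X) +
      ∑ i ∈ s, PowerSeries.C ((1 - c) * ∏ j ∈ s.erase i, crossWeight c x i j) *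
        ∏ j ∈ s.erase i, (1 - PowerSeries.C (x j) * PowerSeries.X) := by
    simpa only [map_mul, map_sub, map_one, map_prod, map_pow] using h
  rw [h2, h', add_mul, mul_assoc, hg, mul_one, sum_mul]
  congr 1
  refine sum_congr rfl fun i hi => ?_
  rw [mul_assoc, ← mul_prod_erase s (fun i => geom (x i)) hi]
  have hg' : (∏ j ∈ s.erase i, (1 - PowerSeries.C (x j) * PowerSeries.X)) *
      ∏ j ∈ s.erase i, geom (x j) = 1 := by
    rw [← prod_mul_distrib]
    exact prod_eq_one fun i _ => one_sub_mul_geom (x i)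
  linear_combination (PowerSeries.C ((1 - c) * ∏ j ∈ s.erase i, crossWeight c x i j) *
    geom (x i)) * hg'

/-- Evaluate the partial fraction expansion at z = 0. -/
theorem sum_crossWeight (c : K) (x : ι → K) (hx : Function.Injective x) (h0 : ∀ i, x i ≠ 0)
    (s : Finset ι) :
    ∑ i ∈ s, (1 - c) * ∏ j ∈ s.erase i, crossWeight c x i j = 1 - c ^ s.card := by
  have h := congrArg PowerSeries.constantCoeff (ratioProd_eq_sum c x hx h0 s)
  rw [ratioProd, map_prod, prod_eq_one fun i _ => constantCoeff_ratioSeries _ _, map_add,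
    map_sum, PowerSeries.constantCoeff_C] at h
  simp only [map_mul, PowerSeries.constantCoeff_C, constantCoeff_geom, mul_one] at h
  linear_combination -h

/-- The coefficients of the expansion of the constant term over the sets of shifted variables. -/
def residueCoeff (c : K) : ℕ → ℕ → ℕ → K
  | _, 0, k => if k = 0 then 1 else 0
  | n, r + 1, k => c ^ n * residueCoeff c n r k +
      (1 - c ^ k) * residueCoeff c (n - 1) r (k - 1)

/-- Taking the pole at i first and the poles in I \ {i} afterwards differs from the weight of I only
by a product inside I. Summing that product over i ∈ I is then a case of `sum_crossWeight`. -/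
theorem prod_crossWeight_insert (c : K) (x : ι → K) {s I : Finset ι} (hI : I ⊆ s) {i : ι}
    (hi : i ∈ I) :
    (∏ j ∈ s.erase i, crossWeight c x i j) *
        ∏ a ∈ I.erase i, ∏ b ∈ s \ I, crossWeight c x a b =
      (∏ j ∈ I.erase i, crossWeight c x i j) * ∏ a ∈ I, ∏ b ∈ s \ I, crossWeight c x a b := by
  rw [← mul_prod_erase I (fun a => ∏ b ∈ s \ I, crossWeight c x a b) hi, ← mul_assoc]
  congr 1
  rw [← prod_union]
  · refine prod_congr ?_ fun _ _ => rfl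
    ext j
    simp only [mem_erase, mem_union, mem_sdiff]
    constructor
    · rintro ⟨h1, h2⟩
      by_cases h : j ∈ I
      · exact Or.inl ⟨h1, h⟩
      · exact Or.inr ⟨h2, h⟩
    · rintro (⟨h1, h2⟩ | ⟨h1, h2⟩)
      · exact ⟨h1, hI h2⟩
      · exact ⟨fun h => h2 (h ▸ hi), h1⟩
  · rw [disjoint_left]
    intro j h1 h2
    exact (mem_sdiff.1 h2).2 (mem_of_mem_erase h1)

variable [Fintype ι] [Algebra CQT K]

/-- The power sums of the variables `x_i`, `i ∈ s`, and `q x_i`, `i ∉ s`. -/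
def shiftedPsum (x : ι → K) (s : Finset ι) (k : ℕ+) : K :=
  ∑ i ∈ s, x i ^ (k : ℕ) + ∑ i ∈ sᶜ, algebraMap CQT K (qv ^ (k : ℕ)) * x i ^ (k : ℕ)

theorem shiftedPsum_erase (x : ι → K) {s : Finset ι} {i : ι} (hi : i ∈ s) (k : ℕ+) :
    shiftedPsum x s k - algebraMap CQT K (1 - qv ^ (k : ℕ)) * x i ^ (k : ℕ) =
      shiftedPsum x (s.erase i) k := by
  rw [shiftedPsum, shiftedPsum, compl_erase, sum_insert (by simpa using hi), ← add_sum_erase s _ hi,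
    map_sub, map_one]
  ring

/-- Induction on the number of z-variables. The last one either takes the value at infinity, leaving
s unchanged, or the pole at 1/x_i, which shifts x_i and deletes i from s. For a fixed set I of
shifted variables, summing over the element taken first gives the factor 1 - c^|I|, whence the
recursion of `residueCoeff`. -/
theorem constTerm_ratioProd (c : K) (x : ι → K) (hx : Function.Injective x)
    (h0 : ∀ i, x i ≠ 0) (r : ℕ) (f : SymFun) (s : Finset ι) :
    constTerm c (ratioProd c x s) (shiftedPsum x s) r f =
      ∑ I ∈ s.powerset, residueCoeff c s.card r I.card *
        (∏ a ∈ I, ∏ b ∈ s \ I, crossWeight c x a b) *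
          MvPolynomial.aeval (shiftedPsum x (s \ I)) f := by
  induction r generalizing s with
  | zero =>
    rw [constTerm_zero, sum_eq_single ∅]
    · simp [residueCoeff]
    · intro I _ hI
      rw [residueCoeff, if_neg (by simpa using hI), zero_mul, zero_mul]
    · simp
  | succ r ih =>
    -- The value at infinity is treated as one more geometric series, with ratio 0; it carries the
    -- index `none`.
    have hu : ratioProd c x s = ∑ i ∈ s.insertNone,
        PowerSeries.C (i.elim (c ^ s.card) fun i => (1 - c) *
          ∏ j ∈ s.erase i, crossWeight c x i j) * geom (i.elim 0 x) := by
      rw [sum_insertNone, ratioProd_eq_sum c x hx h0]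
      congr 1
      have : (geom 0 : PowerSeries K) = 1 := by
        have := one_sub_mul_geom (0 : K)
        simpa using this
      simp [this]
    rw [constTerm_succ s.insertNone c _ _ _ _ hu, sum_insertNone]
    have hnone : constTerm c (ratioProd c x s * ratioSeries (c * 0) 0)
        (fun k => shiftedPsum x s k - algebraMap CQT K (1 - qv ^ (k : ℕ)) * 0 ^ (k : ℕ)) r f =
        constTerm c (ratioProd c x s) (shiftedPsum x s) r f := by
      congr 1
      · rw [mul_zero, ratioSeries_self, mul_one]
      · ext k
        rw [zero_pow k.pos.ne', mul_zero, sub_zero]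
    have hsome : ∀ i ∈ s, constTerm c (ratioProd c x s * ratioSeries (c * x i) (x i))
        (fun k => shiftedPsum x s k - algebraMap CQT K (1 - qv ^ (k : ℕ)) * x i ^ (k : ℕ)) r f =
        constTerm c (ratioProd c x (s.erase i)) (shiftedPsum x (s.erase i)) r f := by
      intro i hi
      congr 1
      -- The evaluated pair factors are inverse to the i-th factor of the creation part; this
      -- restores the shape needed for the induction, with i removed.
      · rw [ratioProd, ← mul_prod_erase s _ hi, mul_right_comm, ratioSeries_mul_swap, one_mul]
        rfl
      · ext k
        exact shiftedPsum_erase x hi k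
    simp only [Option.elim]
    rw [hnone, ih]
    have hsum : ∑ i ∈ s, ((1 - c) * ∏ j ∈ s.erase i, crossWeight c x i j) *
          constTerm c (ratioProd c x s * ratioSeries (c * x i) (x i))
          (fun k => shiftedPsum x s k - algebraMap CQT K (1 - qv ^ (k : ℕ)) * x i ^ (k : ℕ)) r f =
        ∑ I ∈ s.powerset, ((1 - c ^ I.card) * residueCoeff c (s.card - 1) r (I.card - 1)) *
          (∏ a ∈ I, ∏ b ∈ s \ I, crossWeight c x a b) *
          MvPolynomial.aeval (shiftedPsum x (s \ I)) f := by
      have e1 : ∀ i ∈ s, ((1 - c) * ∏ j ∈ s.erase i, crossWeight c x i j) *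
          constTerm c (ratioProd c x s * ratioSeries (c * x i) (x i))
          (fun k => shiftedPsum x s k - algebraMap CQT K (1 - qv ^ (k : ℕ)) * x i ^ (k : ℕ)) r f =
          ∑ I ∈ (s.erase i).powerset, ((1 - c) * ∏ j ∈ s.erase i, crossWeight c x i j) *
            (residueCoeff c (s.card - 1) r I.card *
            (∏ a ∈ I, ∏ b ∈ (s.erase i) \ I, crossWeight c x a b) *
              MvPolynomial.aeval (shiftedPsum x ((s.erase i) \ I)) f) := by
        intro i hi
        rw [hsome i hi, ih, card_erase_of_mem hi, mul_sum]
      have e2 : ∀ I ∈ s.powerset,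
          ((1 - c ^ I.card) * residueCoeff c (s.card - 1) r (I.card - 1)) *
          (∏ a ∈ I, ∏ b ∈ s \ I, crossWeight c x a b) *
          MvPolynomial.aeval (shiftedPsum x (s \ I)) f =
          ∑ i ∈ I, ((1 - c) * ∏ j ∈ s.erase i, crossWeight c x i j) *
            (residueCoeff c (s.card - 1) r (I.card - 1) *
            (∏ a ∈ I.erase i, ∏ b ∈ s \ I, crossWeight c x a b) *
              MvPolynomial.aeval (shiftedPsum x (s \ I)) f) := by
        intro I hI
        rw [mem_powerset] at hI
        rw [← sum_crossWeight c x hx h0 I, sum_mul, sum_mul, sum_mul]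
        refine sum_congr rfl fun i hi => ?_
        have := prod_crossWeight_insert c x hI hi
        linear_combination (-(1 - c) * residueCoeff c (s.card - 1) r (I.card - 1) *
          MvPolynomial.aeval (shiftedPsum x (s \ I)) f) * this
      rw [sum_congr rfl e1, sum_congr rfl e2, sum_sigma', sum_sigma']
      -- A first pole i and a later set of poles avoiding i amount to a nonempty set of poles with a
      -- marked element.
      refine sum_bij' (fun p _ => ⟨insert p.1 p.2, p.1⟩) (fun p _ => ⟨p.2, p.1.erase p.2⟩)
        ?_ ?_ ?_ ?_ ?_
      · rintro ⟨i, I⟩ h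
        simp only [mem_sigma, mem_powerset] at h ⊢
        exact ⟨insert_subset h.1 (h.2.trans (erase_subset _ _)), mem_insert_self _ _⟩
      · rintro ⟨I, i⟩ h
        simp only [mem_sigma, mem_powerset] at h ⊢
        exact ⟨h.1 h.2, erase_subset_erase _ h.1⟩
      · rintro ⟨i, I⟩ h
        simp only [mem_sigma, mem_powerset] at h
        have : i ∉ I := fun hi => by simpa using h.2 hi
        simp [erase_insert this]
      · rintro ⟨I, i⟩ h
        simp only [mem_sigma, mem_powerset] at h
        simp [insert_erase h.2]
      · rintro ⟨i, I⟩ h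
        simp only [mem_sigma, mem_powerset] at h
        have hiI : i ∉ I := fun hi => by simpa using h.2 hi
        have hset : s.erase i \ I = s \ insert i I := by
          ext j; simp only [mem_sdiff, mem_erase, mem_insert]; tauto
        simp only [card_insert_of_notMem hiI, erase_insert hiI, hset, Nat.add_sub_cancel]
    rw [hsum, mul_sum, ← sum_add_distrib]
    refine sum_congr rfl fun I _ => ?_
    rw [residueCoeff]
    ring

end Residues

/-! ### Closed form of the residue coefficients -/

section ResidueCoeff

variable {K : Type*} [Field K]

theorem residueCoeff_eq_zero (c : K) (n r k : ℕ) (h : r < k) : residueCoeff c n r k = 0 := by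
  induction r generalizing n k with
  | zero => rw [residueCoeff, if_neg (by omega)]
  | succ r ih => rw [residueCoeff, ih _ _ (by omega), ih _ _ (by omega), mul_zero, mul_zero, add_zero]

/-- The recursion is a q-Pascal rule. The product over a ≤ r cancels against the scalar in
`tildeKernel`, the inverse product over a ≤ r - k is the one in `eTail`, and t^{k(n-k)} turns the
factors x_i - t⁻¹ x_j into t x_i - x_j. -/
theorem residueCoeff_eq (t : K) (ht : t ≠ 0) (hroot : ∀ a : ℕ, 0 < a → t ^ a - 1 ≠ 0)
    (n r k : ℕ) (hk : k ≤ n) (hr : k ≤ r) :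
    residueCoeff t⁻¹ n r k = t⁻¹ ^ (n * r) * t ^ (k * (k - 1) / 2 + k * (n - k)) *
      (∏ a ∈ Icc 1 r, (t ^ a - 1)) * (∏ a ∈ Icc 1 (r - k), (t ^ a - 1))⁻¹ := by
  have hN : ∀ m, ∏ a ∈ Icc 1 m, (t ^ a - 1) ≠ 0 := fun m =>
    prod_ne_zero_iff.2 fun a ha => hroot a (by have := (mem_Icc.1 ha).1; omega)
  have hNs : ∀ m, ∏ a ∈ Icc 1 (m + 1), (t ^ a - 1) =
      (∏ a ∈ Icc 1 m, (t ^ a - 1)) * (t ^ (m + 1) - 1) := fun m =>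
    prod_Icc_succ_top (by omega) _
  induction r generalizing n k with
  | zero =>
    obtain rfl : k = 0 := by omega
    simp [residueCoeff]
  | succ r ih =>
    cases k with
    | zero =>
      rw [residueCoeff, ih n 0 (by omega) (by omega)]
      have := hN r
      have := hN (r + 1)
      simp only [Nat.sub_zero, pow_zero, sub_self, zero_mul, add_zero, Nat.zero_div]
      rw [mul_assoc, mul_inv_cancel₀ (hN r), mul_assoc _ _ (_)⁻¹, mul_inv_cancel₀ (hN (r + 1))]
      ring
    | succ k =>
      obtain ⟨m, rfl⟩ : ∃ m, n = m + 1 := ⟨n - 1, by omega⟩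
      have hE : (k + 1) * (k + 1 - 1) / 2 + (k + 1) * (m + 1 - (k + 1)) =
          (k * (k - 1) / 2 + k * (m - k)) + m := by
        obtain ⟨d, rfl⟩ : ∃ d, m = k + d := ⟨m - k, by omega⟩
        have h1 : k + d + 1 - (k + 1) = d := by omega
        have h2 : k + d - k = d := by omega
        have h3 : (k + 1) * (k + 1 - 1) / 2 = k * (k - 1) / 2 + k := by
          rw [← Finset.sum_range_id, ← Finset.sum_range_id, sum_range_succ]
        rw [h1, h2, h3]
        ring
      rw [hE]
      set E := k * (k - 1) / 2 + k * (m - k) with hEdef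
      have hsecond := ih m k (by omega) (by omega)
      rw [← hEdef] at hsecond
      have hrk : r + 1 - (k + 1) = r - k := by omega
      obtain ⟨d, rfl⟩ : ∃ d, r = k + d := ⟨r - k, by omega⟩
      have hd : k + d - k = d := by omega
      -- The factor t^d - 1 makes the formula valid also for d = 0, where the index k + 1 exceeds r
      -- and the coefficient vanishes.
      have hfirst : residueCoeff t⁻¹ (m + 1) (k + d) (k + 1) =
          t⁻¹ ^ ((m + 1) * (k + d)) * t ^ (E + m) * (∏ a ∈ Icc 1 (k + d), (t ^ a - 1)) *
            (∏ a ∈ Icc 1 d, (t ^ a - 1))⁻¹ * (t ^ d - 1) := by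
        cases d with
        | zero => rw [residueCoeff_eq_zero _ _ _ _ (by omega)]; simp
        | succ d =>
          rw [ih (m + 1) (k + 1) (by omega) (by omega), hE, hNs d]
          have h1 : k + (d + 1) - (k + 1) = d := by omega
          have h2 := hroot (d + 1) (by omega)
          have h3 := inv_mul_cancel₀ h2
          rw [h1, mul_inv]
          linear_combination -(t⁻¹ ^ ((m + 1) * (k + (d + 1))) * t ^ (E + m) *
            (∏ a ∈ Icc 1 (k + (d + 1)), (t ^ a - 1)) * (∏ a ∈ Icc 1 d, (t ^ a - 1))⁻¹) * h3
      rw [residueCoeff, hfirst, Nat.add_sub_cancel, Nat.add_sub_cancel, hsecond, hrk, hd, hNs (k + d)]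
      -- This is the recursion after the common products of t^a - 1 are removed; only powers of t
      -- remain to be compared.
      have h3 : t⁻¹ ^ (m + 1) * (t⁻¹ ^ ((m + 1) * (k + d)) * t ^ (E + m)) * (t ^ d - 1) +
          (1 - t⁻¹ ^ (k + 1)) * (t⁻¹ ^ (m * (k + d)) * t ^ E) =
          t⁻¹ ^ ((m + 1) * (k + d + 1)) * t ^ (E + m) * (t ^ (k + d + 1) - 1) := by
        have e1 : t⁻¹ ^ (m + 1) * t⁻¹ ^ ((m + 1) * (k + d)) =
            t⁻¹ ^ ((m + 1) * (k + d + 1)) := by rw [← pow_add]; ring_nf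
        have e2 : t⁻¹ ^ ((m + 1) * (k + d + 1)) * t ^ (E + m) * t ^ (k + d + 1) =
            t⁻¹ ^ (m * (k + d)) * t ^ E := by
          have : t⁻¹ ^ ((m + 1) * (k + d + 1)) =
              t⁻¹ ^ (m * (k + d)) * (t⁻¹ ^ m * t⁻¹ ^ (k + d + 1)) := by
            rw [← pow_add, ← pow_add]; ring_nf
          rw [this, pow_add t E m]
          have h4 : t⁻¹ ^ m * t ^ m = 1 := by rw [← mul_pow, inv_mul_cancel₀ ht, one_pow]
          have h5 : t⁻¹ ^ (k + d + 1) * t ^ (k + d + 1) = 1 := by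
            rw [← mul_pow, inv_mul_cancel₀ ht, one_pow]
          linear_combination (t⁻¹ ^ (m * (k + d)) * t ^ E) * (t⁻¹ ^ (k + d + 1) *
            t ^ (k + d + 1)) * h4 + (t⁻¹ ^ (m * (k + d)) * t ^ E) * h5
        have e3 : t⁻¹ ^ (k + 1) * t ^ (k + d + 1) = t ^ d := by
          have : t ^ (k + d + 1) = t ^ (k + 1) * t ^ d := by rw [← pow_add]; ring_nf
          rw [this, ← mul_assoc, ← mul_pow, inv_mul_cancel₀ ht, one_pow, one_mul]
        linear_combination t ^ (E + m) * (t ^ d - 1) * e1 - (1 - t⁻¹ ^ (k + 1)) * e2 -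
          t⁻¹ ^ ((m + 1) * (k + d + 1)) * t ^ (E + m) * e3
      linear_combination ((∏ a ∈ Icc 1 (k + d), (t ^ a - 1)) *
        (∏ a ∈ Icc 1 d, (t ^ a - 1))⁻¹) * h3

end ResidueCoeff

/-! ### The modified Macdonald operators as vertex operators -/

section Restriction

theorem isDomain_CQ : IsDomain CQ := inferInstance

theorem noZeroDivisors_CQT : NoZeroDivisors CQT :=
  haveI := isDomain_CQ
  IsDomain.to_noZeroDivisors CQT

attribute [local instance] noZeroDivisors_CQT

theorem algebraMap_inv_field {k K : Type*} [Field k] [Field K] [Algebra k K] (x : k) :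
    algebraMap k K x⁻¹ = (algebraMap k K x)⁻¹ := map_inv₀ _ x

theorem algebraMap_ne_zero_field {k K : Type*} [Field k] [Field K] [Algebra k K] {x : k}
    (hx : x ≠ 0) : algebraMap k K x ≠ 0 := (map_ne_zero _).2 hx

theorem prod_ne_zero_field {ι k : Type*} [Field k] {s : Finset ι} {g : ι → k}
    (h : ∀ i ∈ s, g i ≠ 0) : ∏ i ∈ s, g i ≠ 0 := prod_ne_zero_iff.2 h

theorem tv_ne_zero : tv ≠ 0 := RatFunc.X_ne_zero

theorem tv_pow_sub_one_ne_zero (a : ℕ) (ha : 0 < a) : tv ^ a - 1 ≠ 0 := by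
  have h1 : (Polynomial.X ^ a - 1 : Polynomial CQ) ≠ 0 := Polynomial.X_pow_sub_C_ne_zero ha 1
  have h2 : tv ^ a - 1 = algebraMap (Polynomial CQ) CQT (Polynomial.X ^ a - 1) := by
    rw [map_sub, map_pow, map_one, RatFunc.algebraMap_X]; rfl
  rw [h2]
  exact fun h => h1 ((map_eq_zero_iff _ (RatFunc.algebraMap_injective CQ)).1 h)

/-- The kernel of the vertex operator `Ẽ^r`. -/
def tildeKernel (r : ℕ) : HahnSeries (Expo r) CQT :=
  HahnSeries.C (∏ a ∈ Icc 1 r, (tv ^ a - 1))⁻¹ * pairKernel tv⁻¹ r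

/-- Restriction to `n` variables, with values in rational functions. -/
def restrictRat (n : ℕ) : SymFun →ₐ[CQT] RatVars n :=
  (IsScalarTower.toAlgHom CQT (MvPolynomial (Fin n) CQT) (RatVars n)).comp (restrictVars n)

theorem restrictRat_apply (n : ℕ) (f : SymFun) : restrictRat n f =
    algebraMap (MvPolynomial (Fin n) CQT) (RatVars n) (restrictVars n f) := rfl

theorem restrictRat_X (n : ℕ) (k : ℕ+) :
    restrictRat n (MvPolynomial.X k) = ∑ i : Fin n, xVar n i ^ (k : ℕ) := by
  rw [restrictRat_apply, restrictVars, MvPolynomial.aeval_X, MvPolynomial.psum, map_sum]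
  exact sum_congr rfl fun i _ => map_pow _ _ _

theorem restrictRat_C (n : ℕ) (c : CQT) :
    restrictRat n (MvPolynomial.C c) = algebraMap CQT (RatVars n) c :=
  (restrictRat n).commutes c

theorem xVar_injective (n : ℕ) : Function.Injective (xVar n) := fun _ _ h =>
  MvPolynomial.X_injective (IsFractionRing.injective (MvPolynomial (Fin n) CQT) (RatVars n) h)

theorem xVar_ne_zero (n : ℕ) (i : Fin n) : xVar n i ≠ 0 := fun h =>
  MvPolynomial.X_ne_zero (R := CQT) i
    ((map_eq_zero_iff _ (IsFractionRing.injective (MvPolynomial (Fin n) CQT) (RatVars n))).1 h)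

/-- On logarithmic derivatives: (1 - t⁻ᵐ) ∑ x_iᵐ = ∑ (x_iᵐ - (t⁻¹ x_i)ᵐ). -/
theorem map_creationSeries_restrictRat (n : ℕ) :
    creationSeries.map (restrictRat n : SymFun →+* RatVars n) =
      ratioProd (algebraMap CQT (RatVars n) tv⁻¹) (xVar n) univ := by
  refine map_creationSeries_eq _ _ _ (HasLogDeriv.prod univ fun i _ =>
    hasLogDeriv_ratioSeries (xVar n i) (algebraMap CQT (RatVars n) tv⁻¹ * xVar n i)) fun m => ?_
  rw [map_sum]
  simp only [PowerSeries.coeff_mk]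
  have h1 := restrictRat_X n m.succPNat
  have h2 := restrictRat_C n (1 - tv⁻¹ ^ (m + 1))
  simp only [RingHom.coe_coe]
  rw [h1, h2, mul_sum]
  refine sum_congr rfl fun i _ => ?_
  rw [map_sub, map_one, map_pow, Nat.succPNat_coe, mul_pow, Nat.succ_eq_add_one]
  ring

theorem restrictRat_vertexOp (n r : ℕ) (f : SymFun) :
    restrictRat n (vertexOp r (tildeKernel r) f) =
      algebraMap CQT (RatVars n) (∏ a ∈ Icc 1 r, (tv ^ a - 1))⁻¹ *
        constTerm (algebraMap CQT (RatVars n) tv⁻¹)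
          (ratioProd (algebraMap CQT (RatVars n) tv⁻¹) (xVar n) univ)
          (shiftedPsum (xVar n) univ) r f := by
  have h0 : restrictRat n (vertexOp r (tildeKernel r) f) =
      (hahnMap (restrictRat n : SymFun →+* RatVars n)
        (kernelSeries r (tildeKernel r) * creation r * annihilation r f)).coeff 0 := rfl
  have h1 : hahnMap (restrictRat n : SymFun →+* RatVars n) (kernelSeries r (tildeKernel r)) =
      hahnMap (algebraMap CQT (RatVars n)) (tildeKernel r) := by
    ext a
    exact restrictRat_C n _
  have h2 : (fun k => restrictRat n (MvPolynomial.X k)) = shiftedPsum (xVar n) univ := by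
    ext k
    rw [restrictRat_X, shiftedPsum, compl_univ, sum_empty, add_zero]
  rw [h0, map_mul, map_mul, h1, creation_eq_seriesProd, hahnMap_seriesProd,
    map_creationSeries_restrictRat, annihilation_eq_translation, hahnMap_translation, h2,
    tildeKernel, map_mul, hahnMap_C, hahnMap_pairKernel, mul_assoc, mul_assoc, hahn_coeff_C_mul,
    ← mul_assoc, constTerm]

theorem aeval_shiftedPsum_sdiff (n : ℕ) (I : Finset (Fin n)) (f : SymFun) :
    MvPolynomial.aeval (shiftedPsum (xVar n) (univ \ I)) f =
      algebraMap (MvPolynomial (Fin n) CQT) (RatVars n) (shiftVars n I (restrictVars n f)) := by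
  induction f using MvPolynomial.induction_on with
  | C a =>
    rw [← MvPolynomial.algebraMap_eq, AlgHom.commutes, AlgHom.commutes, AlgHom.commutes]
    exact IsScalarTower.algebraMap_apply CQT (MvPolynomial (Fin n) CQT) (RatVars n) a
  | add f g hf hg => rw [map_add, hf, hg, map_add, map_add, map_add]
  | mul_X f k hf =>
    rw [map_mul, hf, map_mul, map_mul, map_mul]
    congr 1
    rw [MvPolynomial.aeval_X, restrictVars, MvPolynomial.aeval_X, MvPolynomial.psum, map_sum,
      map_sum, shiftedPsum, ← compl_eq_univ_sdiff, compl_compl,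
      ← sum_add_sum_compl I (fun i => algebraMap (MvPolynomial (Fin n) CQT) (RatVars n)
        (shiftVars n I (MvPolynomial.X i ^ (k : ℕ)))), add_comm]
    congr 1
    · refine sum_congr rfl fun i hi => ?_
      rw [shiftVars, map_pow (MvPolynomial.aeval _), MvPolynomial.aeval_X, if_pos hi, mul_pow,
        map_mul, ← map_pow MvPolynomial.C, map_pow _ (MvPolynomial.X i)]
      rfl
    · refine sum_congr rfl fun i hi => ?_
      rw [shiftVars, map_pow, MvPolynomial.aeval_X, if_neg (mem_compl.1 hi), map_pow]
      rfl

/-- Both sides are sums over sets I of shifted variables and agree term by term. Sets with more than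
r elements are absent from Ẽ_n^r and have residue coefficient zero. -/
theorem isTildeE_vertexOp (r : ℕ) : IsTildeE r (vertexOp r (tildeKernel r)) := by
  intro n f
  rw [← restrictRat_apply, restrictRat_vertexOp, constTerm_ratioProd _ _ (xVar_injective n)
    (xVar_ne_zero n), tildeEn]
  set ψ := algebraMap CQT (RatVars n) with hψ
  set N : ℕ → CQT := fun m => ∏ a ∈ Icc 1 m, (tv ^ a - 1) with hN
  have hN0 : ∀ m, N m ≠ 0 := fun m => by
    simp only [hN]
    exact prod_ne_zero_field (k := CQT) fun a ha =>
      tv_pow_sub_one_ne_zero a (by have := (mem_Icc.1 ha).1; omega)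
  have hinv : ∀ x, ψ x⁻¹ = (ψ x)⁻¹ := fun x => algebraMap_inv_field (k := CQT) (K := RatVars n) x
  have hne : ∀ x, x ≠ 0 → ψ x ≠ 0 := fun x hx => algebraMap_ne_zero_field (k := CQT) (K := RatVars n) hx
  set F : ℕ → Finset (Fin n) → RatVars n := fun k I =>
    ψ (eTail n (r - k) * tv⁻¹ ^ (k * n)) * (ψ (tv ^ (k * (k - 1) / 2)) *
      (∏ i ∈ I, ∏ j ∈ Iᶜ, (ψ tv * xVar n i - xVar n j) / (xVar n i - xVar n j)) *
      algebraMap (MvPolynomial (Fin n) CQT) (RatVars n) (shiftVars n I (restrictVars n f))) with hF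
  have hR : ∑ j ∈ range (r + 1), ψ (eTail n j * tv⁻¹ ^ ((r - j) * n)) *
      macdonaldD n (r - j) (restrictVars n f) =
      ∑ k ∈ range (r + 1), ∑ I ∈ powersetCard k (univ : Finset (Fin n)), F k I := by
    rw [← Finset.sum_flip (fun k => ∑ I ∈ powersetCard k (univ : Finset (Fin n)), F k I)]
    refine sum_congr rfl fun j hj => ?_
    rw [macdonaldD, mul_sum]
    refine sum_congr rfl fun I _ => ?_
    have : r - (r - j) = j := by have := mem_range.1 hj; omega
    simp only [hF, this]
    rfl
  rw [hR]
  have hL : ∀ I : Finset (Fin n), ψ (N r)⁻¹ * (residueCoeff (ψ tv⁻¹) (univ : Finset (Fin n)).card r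
      I.card * (∏ a ∈ I, ∏ b ∈ univ \ I, crossWeight (ψ tv⁻¹) (xVar n) a b) *
      MvPolynomial.aeval (shiftedPsum (xVar n) (univ \ I)) f) =
      ∑ k ∈ range (r + 1), if I.card = k then F k I else 0 := by
    intro I
    rw [sum_ite_eq]
    by_cases hI : I.card ≤ r
    · rw [if_pos (mem_range.2 (by omega)), aeval_shiftedPsum_sdiff, hF, hinv tv]
      have hIn : I.card ≤ n := by simpa using card_le_univ I
      have ht : ψ tv ≠ 0 := hne _ tv_ne_zero
      rw [card_univ, Fintype.card_fin, residueCoeff_eq (ψ tv) ht (fun a ha => by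
        rw [← map_pow, ← map_one ψ, ← map_sub]
        exact hne _ (tv_pow_sub_one_ne_zero a ha)) n r I.card hIn hI]
      have hprod : ∀ m, ∏ a ∈ Icc 1 m, (ψ tv ^ a - 1) = ψ (N m) := fun m => by
        rw [hN, map_prod]
        exact prod_congr rfl fun a _ => by rw [map_sub, map_pow, map_one]
      rw [hprod, hprod]
      have hW : ∏ i ∈ I, ∏ j ∈ Iᶜ, (ψ tv * xVar n i - xVar n j) / (xVar n i - xVar n j) =
          ψ tv ^ (I.card * (n - I.card)) *
            ∏ a ∈ I, ∏ b ∈ univ \ I, crossWeight (ψ tv)⁻¹ (xVar n) a b := by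
        have h1 : ∀ i j, (ψ tv * xVar n i - xVar n j) / (xVar n i - xVar n j) =
            ψ tv * crossWeight (ψ tv)⁻¹ (xVar n) i j := fun i j => by
          rw [crossWeight, ← mul_div_assoc, mul_sub, mul_inv_cancel_left₀ ht]
        simp only [h1, prod_mul_distrib, prod_const, compl_eq_univ_sdiff, card_univ_sdiff,
          Fintype.card_fin]
        rw [← pow_mul, mul_comm (n - _)]
      have hte : eTail n (r - I.card) = tv⁻¹ ^ ((r - I.card) * n) * (N (r - I.card))⁻¹ := rfl
      simp only
      rw [hW, hte, map_mul, map_mul, map_pow, map_pow, map_pow, hinv, hinv, hinv, pow_add]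
      have hexp : (ψ tv)⁻¹ ^ (n * r) = (ψ tv)⁻¹ ^ ((r - I.card) * n) * (ψ tv)⁻¹ ^ (I.card * n) := by
        rw [← pow_add, ← add_mul, Nat.sub_add_cancel hI, mul_comm]
      rw [hexp]
      have hNr := inv_mul_cancel₀ (hne _ (hN0 r))
      linear_combination ((ψ tv)⁻¹ ^ ((r - I.card) * n) * (ψ tv)⁻¹ ^ (I.card * n) *
        ((ψ tv) ^ (I.card * (I.card - 1) / 2) * (ψ tv) ^ (I.card * (n - I.card))) *
        (ψ (N (r - I.card)))⁻¹ * (∏ a ∈ I, ∏ b ∈ univ \ I, crossWeight (ψ tv)⁻¹ (xVar n) a b) *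
        algebraMap (MvPolynomial (Fin n) CQT) (RatVars n)
          (shiftVars n I (restrictVars n f))) * hNr
    · rw [if_neg (by simpa using hI), residueCoeff_eq_zero _ _ _ _ (by omega)]
      ring
  rw [mul_sum, sum_congr rfl fun I _ => hL I, sum_comm]
  refine sum_congr rfl fun k _ => ?_
  rw [← sum_filter, powersetCard_eq_filter]

end Restriction

/-! ### Monomial symmetric functions -/

section Augmented

variable (R : Type*) [CommRing R]

/-- The augmented monomial symmetric polynomial: the sum of `∏_j x_{f j} ^ {a j}` over the
injections `f`. -/
def injSum (n : ℕ) {l : ℕ} (a : Fin l → ℕ) : MvPolynomial (Fin n) R :=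
  ∑ f : Fin l ↪ Fin n, ∏ j, MvPolynomial.X (f j) ^ a j

theorem sum_notMem_range_add_sum {n l : ℕ} {M : Type*} [AddCommMonoid M] (e : Fin l ↪ Fin n)
    (g : Fin n → M) : ∑ i : {i // i ∉ Set.range e}, g i + ∑ j, g (e j) = ∑ i, g i := by
  classical
  have h1 : ∑ j, g (e j) = ∑ i ∈ univ.map e, g i := by rw [sum_map]
  have h2 : ∑ i : {i // i ∉ Set.range e}, g i = ∑ i ∈ (univ.map e)ᶜ, g i :=
    (Finset.sum_subtype _ (fun i => by simp) g).symm
  rw [h1, h2, sum_compl_add_sum]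

/-- The variable chosen by the power sum is either new, which creates a part k, or already carries a
part, which then grows by k. Solving for the first kind of term gives the recursion of `augFun`. -/
theorem psum_mul_injSum (n k : ℕ) {l : ℕ} (a : Fin l → ℕ) :
    MvPolynomial.psum (Fin n) R k * injSum R n a =
      injSum R n (Fin.cons k a : Fin (l + 1) → ℕ) +
        ∑ j, injSum R n (Function.update a j (a j + k)) := by
  have h1 : injSum R n (Fin.cons k a : Fin (l + 1) → ℕ) =
      ∑ f : Fin l ↪ Fin n, ∑ i : {i // i ∉ Set.range f},
        MvPolynomial.X (i : Fin n) ^ k * ∏ j, MvPolynomial.X (f j) ^ a j := by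
    rw [injSum, ← (Equiv.embeddingFinSucc l (Fin n)).symm.sum_comp, Fintype.sum_sigma]
    refine sum_congr rfl fun f _ => sum_congr rfl fun i _ => ?_
    rw [Fin.prod_univ_succ, Equiv.coe_embeddingFinSucc_symm]
    simp
  rw [h1]
  simp only [injSum, MvPolynomial.psum]
  rw [sum_comm (γ := Fin l), ← sum_add_distrib, mul_sum]
  refine sum_congr rfl fun f _ => ?_
  rw [← sum_notMem_range_add_sum f, add_mul, sum_mul, sum_mul]
  congr 1
  refine sum_congr rfl fun j _ => ?_
  have hp : ∏ i ∈ univ.erase j, (MvPolynomial.X (f i) : MvPolynomial (Fin n) R) ^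
      Function.update a j (a j + k) i = ∏ i ∈ univ.erase j, MvPolynomial.X (f i) ^ a i :=
    prod_congr rfl fun i hi => by rw [Function.update_of_ne (ne_of_mem_erase hi)]
  rw [← mul_prod_erase univ (fun j => (MvPolynomial.X (f j) : MvPolynomial (Fin n) R) ^ a j)
      (mem_univ j), ← mul_prod_erase univ (fun i => (MvPolynomial.X (f i) :
      MvPolynomial (Fin n) R) ^ Function.update a j (a j + k) i) (mem_univ j), hp,
    Function.update_self, pow_add]
  ring

theorem coeff_injSum (n : ℕ) {l : ℕ} (a : Fin l → ℕ) (β : Fin n →₀ ℕ) :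
    MvPolynomial.coeff β (injSum R n a) =
      (Fintype.card {f : Fin l ↪ Fin n // ∑ j, Finsupp.single (f j) (a j) = β} : R) := by
  classical
  rw [injSum, MvPolynomial.coeff_sum, Fintype.card_subtype, ← sum_boole]
  refine sum_congr rfl fun f _ => ?_
  have : ∏ j, (MvPolynomial.X (f j) : MvPolynomial (Fin n) R) ^ a j =
      MvPolynomial.monomial (∑ j, Finsupp.single (f j) (a j)) 1 := by
    rw [MvPolynomial.monomial_sum_one]
    exact prod_congr rfl fun j _ => MvPolynomial.X_pow_eq_monomial
  rw [this, MvPolynomial.coeff_monomial]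

theorem coeff_msymm (n : ℕ) {m : ℕ} (μ : m.Partition) (β : Fin n →₀ ℕ) :
    MvPolynomial.coeff β (MvPolynomial.msymm (Fin n) R μ) =
      if β.support.val.map β = μ.parts then 1 else 0 := by
  have key : ∀ s : Sym (Fin n) m, MvPolynomial.coeff β
      ((s.1.map (MvPolynomial.X : Fin n → MvPolynomial (Fin n) R)).prod) =
      if Multiset.toFinsupp s.1 = β then 1 else 0 := by
    intro s
    have : (s.1.map (MvPolynomial.X : Fin n → MvPolynomial (Fin n) R)).prod =
        MvPolynomial.monomial (Multiset.toFinsupp s.1) 1 := by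
      generalize s.1 = t
      induction t using Multiset.induction_on with
      | empty => simp
      | cons a t ih =>
        rw [Multiset.map_cons, Multiset.prod_cons, ih, ← Multiset.singleton_add,
          Multiset.toFinsupp_add, Multiset.toFinsupp_singleton, MvPolynomial.X,
          MvPolynomial.monomial_mul, one_mul]
    rw [this, MvPolynomial.coeff_monomial]
  have hparts : ∀ s : Sym (Fin n) m, (Nat.Partition.ofSym s).parts =
      (Multiset.toFinsupp s.1).support.val.map (Multiset.toFinsupp s.1) := fun s => rfl
  rw [MvPolynomial.msymm, MvPolynomial.coeff_sum]
  simp only [key]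
  by_cases h : β.support.val.map β = μ.parts
  · rw [if_pos h]
    have hcard : Multiset.card (Finsupp.toMultiset β) = m := by
      rw [Finsupp.card_toMultiset, ← μ.parts_sum, ← h]
      rfl
    obtain ⟨s₀, hs₀⟩ : ∃ s₀ : Sym (Fin n) m, s₀.1 = Finsupp.toMultiset β := ⟨⟨_, hcard⟩, rfl⟩
    have hs₀' : Multiset.toFinsupp s₀.1 = β := by rw [hs₀, Finsupp.toMultiset_toFinsupp]
    have hof : Nat.Partition.ofSym s₀ = μ := by
      ext1
      rw [hparts, hs₀', h]
    rw [Finset.sum_eq_single ⟨s₀, hof⟩]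
    · rw [if_pos hs₀']
    · intro s _ hs
      refine if_neg fun h' => hs (Subtype.ext (Subtype.ext ?_))
      exact Multiset.toFinsupp.injective (h'.trans hs₀'.symm)
    · simp
  · rw [if_neg h]
    refine sum_eq_zero fun s _ => if_neg fun hs => h ?_
    rw [← s.2, hparts, hs]

theorem sum_single_embedding_apply {n l : ℕ} (f : Fin l ↪ Fin n) (a : Fin l → ℕ) (j : Fin l) :
    (∑ j, Finsupp.single (f j) (a j)) (f j) = a j := by
  rw [Finsupp.finsetSum_apply, Finset.sum_eq_single j]
  · simp
  · intro i _ hi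
    rw [Finsupp.single_apply, if_neg fun h => hi (f.injective h)]
  · simp

theorem sum_single_embedding_support {n l : ℕ} (f : Fin l ↪ Fin n) (a : Fin l → ℕ)
    (ha : ∀ j, 0 < a j) : (∑ j, Finsupp.single (f j) (a j)).support = univ.map f := by
  ext i
  rw [Finsupp.mem_support_iff, mem_map]
  constructor
  · intro h
    by_contra hi
    apply h
    rw [Finsupp.finsetSum_apply]
    refine sum_eq_zero fun j _ => ?_
    rw [Finsupp.single_apply, if_neg fun h => hi ⟨j, mem_univ _, h⟩]
  · rintro ⟨j, -, rfl⟩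
    rw [sum_single_embedding_apply]
    exact (ha j).ne'

theorem sum_single_embedding_eq_iff {n l : ℕ} (f : Fin l ↪ Fin n) (a : Fin l → ℕ)
    (ha : ∀ j, 0 < a j) (β : Fin n →₀ ℕ) :
    ∑ j, Finsupp.single (f j) (a j) = β ↔ β.support = univ.map f ∧ ∀ j, β (f j) = a j := by
  constructor
  · rintro rfl
    exact ⟨sum_single_embedding_support f a ha, sum_single_embedding_apply f a⟩
  · rintro ⟨h1, h2⟩
    ext i
    by_cases hi : i ∈ univ.map f
    · obtain ⟨j, -, rfl⟩ := mem_map.1 hi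
      rw [sum_single_embedding_apply, h2]
    · have h3 := hi
      rw [← h1, Finsupp.notMem_support_iff] at h3
      rw [← sum_single_embedding_support f a ha, Finsupp.notMem_support_iff] at hi
      rw [hi, h3]

/-- The permutations that fix a tuple. -/
def tupleStab {l : ℕ} (a : Fin l → ℕ) : ℕ := Fintype.card {σ : Equiv.Perm (Fin l) // a ∘ σ = a}

theorem tupleStab_pos {l : ℕ} (a : Fin l → ℕ) : 0 < tupleStab a :=
  Fintype.card_pos_iff.2 ⟨⟨1, rfl⟩⟩

theorem exists_equiv_of_map_eq {ι κ : Type*} [Fintype ι] [Fintype κ] {b : ι → ℕ} {a : κ → ℕ}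
    (h : (univ : Finset ι).val.map b = (univ : Finset κ).val.map a) :
    ∃ e : κ ≃ ι, ∀ j, b (e j) = a j := by
  have hc : ∀ v, Nonempty ({j // a j = v} ≃ {i // b i = v}) := fun v => by
    rw [← Fintype.card_eq, Fintype.card_subtype, Fintype.card_subtype]
    have := congrArg (Multiset.count v) h
    rw [Multiset.count_map, Multiset.count_map] at this
    simp only [eq_comm (a := v)] at this
    exact this.symm
  exact ⟨Equiv.ofFiberEquiv fun v => (hc v).some, fun j => Equiv.ofFiberEquiv_map _ j⟩

/-- If the nonzero exponents of β are the entries of a, the injections producing β are a torsor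
under the permutations fixing a. Positivity of a is used to recover the image of an injection as the
support of β. -/
theorem coeff_injSum_eq (n : ℕ) {l : ℕ} (a : Fin l → ℕ) (ha : ∀ j, 0 < a j) (β : Fin n →₀ ℕ) :
    MvPolynomial.coeff β (injSum R n a) =
      if β.support.val.map β = univ.val.map a then (tupleStab a : R) else 0 := by
  rw [coeff_injSum]
  split_ifs with h
  · have h' : (univ : Finset {i // i ∈ β.support}).val.map (fun i : {i // i ∈ β.support} => β i) = univ.val.map a := by
      rw [← h]
      conv_rhs => rw [← Finset.attach_map_val (s := β.support), map_val, Multiset.map_map]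
      rfl
    obtain ⟨e, he⟩ := exists_equiv_of_map_eq h'
    set f₀ : Fin l ↪ Fin n := e.toEmbedding.trans (Function.Embedding.subtype _) with hf₀
    have hf₀' : ∀ j, f₀ j = e j := fun j => rfl
    congr 1
    refine (Fintype.card_congr (Equiv.ofBijective (fun σ : {σ : Equiv.Perm (Fin l) // a ∘ σ = a} =>
      (⟨σ.1.toEmbedding.trans f₀, ?_⟩ : {f : Fin l ↪ Fin n //
        ∑ j, Finsupp.single (f j) (a j) = β})) ?_)).symm
    · rw [sum_single_embedding_eq_iff _ _ ha]
      constructor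
      · ext i
        rw [mem_map]
        constructor
        · intro hi
          refine ⟨σ.1.symm (e.symm ⟨i, hi⟩), mem_univ _, ?_⟩
          simp [hf₀]
        · rintro ⟨j, -, rfl⟩
          exact (e (σ.1 j)).2
      · intro j
        have := congrFun σ.2 j
        simp only [Function.comp_apply] at this
        rw [← this]
        exact he (σ.1 j)
    · constructor
      · intro σ τ hστ
        apply Subtype.ext
        ext1 j
        have h2 := DFunLike.congr_fun (Subtype.ext_iff.1 hστ) j
        exact f₀.injective h2
      · rintro ⟨f, hf⟩
        rw [sum_single_embedding_eq_iff _ _ ha] at hf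
        have hfm : ∀ j, f j ∈ β.support := fun j => by rw [hf.1]; simp
        have hinj : Function.Injective fun j => e.symm ⟨f j, hfm j⟩ := fun i j hij =>
          f.injective (Subtype.ext_iff.1 (e.symm.injective hij))
        refine ⟨⟨Equiv.ofBijective _ (Finite.injective_iff_bijective.1 hinj), ?_⟩, ?_⟩
        · ext j
          simp only [Function.comp_apply, Equiv.ofBijective_apply]
          rw [← he, Equiv.apply_symm_apply, hf.2]
        · apply Subtype.ext
          ext1 j
          simp [hf₀]
  · have : IsEmpty {f : Fin l ↪ Fin n // ∑ j, Finsupp.single (f j) (a j) = β} := by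
      refine ⟨fun f => h ?_⟩
      have hf := (sum_single_embedding_eq_iff _ _ ha β).1 f.2
      rw [hf.1, map_val, Multiset.map_map]
      exact Multiset.map_congr rfl fun j _ => hf.2 j
    rw [Fintype.card_eq_zero, Nat.cast_zero]

end Augmented

/-! ### The monomial basis and uniqueness of the modified Macdonald operators -/

section Monomials

attribute [local instance] isDomain_CQ noZeroDivisors_CQT

theorem charZero_CQT : CharZero CQT := algebraRat.charZero CQT

attribute [local instance] charZero_CQT

/-- The augmented monomial symmetric function with a given tuple of exponents. -/
def augFun : (l : ℕ) → (Fin l → ℕ+) → SymFun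
  | 0, _ => 1
  | l + 1, a => MvPolynomial.X (a 0) * augFun l (Fin.tail a) -
      ∑ j, augFun l (Function.update (Fin.tail a) j (Fin.tail a j + a 0))

theorem restrictVars_augFun (n l : ℕ) (a : Fin l → ℕ+) :
    restrictVars n (augFun l a) = injSum CQT n fun j => (a j : ℕ) := by
  induction l with
  | zero => simp [augFun, injSum]
  | succ l ih =>
    rw [augFun, map_sub, map_mul, ih, map_sum]
    simp only [ih]
    rw [restrictVars, MvPolynomial.aeval_X, psum_mul_injSum, sub_eq_iff_eq_add]
    congr 1
    · congr 1
      ext j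
      refine Fin.cases rfl (fun j => rfl) j
    · refine sum_congr rfl fun j _ => ?_
      congr 1
      ext i
      by_cases h : i = j
      · subst h
        rw [Function.update_self, Function.update_self, PNat.add_coe]
      · rw [Function.update_of_ne h, Function.update_of_ne h]

/-- The rows of a Young diagram, as a tuple. -/
def rowTuple (μ : YoungDiagram) : Fin (μ.colLen 0) → ℕ+ := fun i =>
  ⟨μ.rowLen i, YoungDiagram.mem_iff_lt_rowLen.1 (YoungDiagram.mem_iff_lt_colLen.2 i.2)⟩

theorem map_rowTuple (μ : YoungDiagram) :
    (univ : Finset (Fin (μ.colLen 0))).val.map (fun i => (rowTuple μ i : ℕ)) =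
      (μ.rowLens : Multiset ℕ) := by
  rw [YoungDiagram.rowLens, ← Multiset.map_coe, Fin.univ_val_map]
  congr 1
  apply List.ext_getElem <;> simp [rowTuple]

theorem rowLens_injective {μ ν : YoungDiagram}
    (h : (μ.rowLens : Multiset ℕ) = (ν.rowLens : Multiset ℕ)) : μ = ν := by
  have h1 : μ.rowLens = ν.rowLens := (Multiset.coe_eq_coe.1 h).eq_of_sortedGE
    μ.rowLens_sorted ν.rowLens_sorted
  exact YoungDiagram.equivListRowLens.injective (Subtype.ext h1)

theorem exists_rowLens_eq (s : Multiset ℕ) (hs : ∀ x ∈ s, 0 < x) :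
    ∃ μ : YoungDiagram, (μ.rowLens : Multiset ℕ) = s := by
  refine ⟨YoungDiagram.ofRowLens (s.sort (· ≥ ·)) (s.pairwise_sort (· ≥ ·)).sortedGE, ?_⟩
  rw [YoungDiagram.rowLens_ofRowLens_eq_self (by simpa using hs), Multiset.sort_eq]

theorem coeff_monomialSymm (n : ℕ) (μ : YoungDiagram) (β : Fin n →₀ ℕ) :
    MvPolynomial.coeff β (monomialSymm n μ) =
      if β.support.val.map β = (μ.rowLens : Multiset ℕ) then 1 else 0 := by
  rw [monomialSymm, coeff_msymm]
  have : (Nat.Partition.ofMultiset (μ.rowLens : Multiset ℕ)).parts =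
      (μ.rowLens : Multiset ℕ) :=
    Multiset.filter_eq_self.2 fun (x : ℕ) hx =>
      (μ.pos_of_mem_rowLens x (Multiset.mem_coe.1 hx)).ne'
  rw [this]

/-- The monomial symmetric function of a Young diagram. -/
def monoFun (μ : YoungDiagram) : SymFun :=
  (tupleStab fun i => (rowTuple μ i : ℕ) : CQT)⁻¹ • augFun _ (rowTuple μ)

theorem restrictVars_monoFun (n : ℕ) (μ : YoungDiagram) :
    restrictVars n (monoFun μ) = monomialSymm n μ := by
  rw [monoFun, map_smul, restrictVars_augFun]
  ext β
  rw [MvPolynomial.coeff_smul, coeff_injSum_eq _ _ (fun j => (rowTuple μ j : ℕ)) fun j => (rowTuple μ j).2, coeff_monomialSymm,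
    map_rowTuple]
  split_ifs
  · rw [smul_eq_mul, inv_mul_cancel₀ (Nat.cast_ne_zero.2 (tupleStab_pos _).ne')]
  · rw [smul_zero]

/-- The rows of a Young diagram, as an exponent. -/
def rowExp (n : ℕ) (μ : YoungDiagram) : Fin n →₀ ℕ :=
  Finsupp.equivFunOnFinite.symm fun i => μ.rowLen i

theorem rowExp_apply (n : ℕ) (μ : YoungDiagram) (i : Fin n) : rowExp n μ i = μ.rowLen i := rfl

theorem rowLen_pos_iff (μ : YoungDiagram) (i : ℕ) : 0 < μ.rowLen i ↔ i < μ.colLen 0 := by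
  rw [← YoungDiagram.mem_iff_lt_rowLen, YoungDiagram.mem_iff_lt_colLen]

theorem map_rowExp {n : ℕ} {μ : YoungDiagram} (h : μ.colLen 0 ≤ n) :
    (rowExp n μ).support.val.map (rowExp n μ) = (μ.rowLens : Multiset ℕ) := by
  have : (rowExp n μ).support = univ.map (Fin.castLEEmb h) := by
    ext i
    rw [Finsupp.mem_support_iff, rowExp_apply, ← Nat.pos_iff_ne_zero, rowLen_pos_iff, mem_map]
    constructor
    · exact fun hi => ⟨⟨i, hi⟩, mem_univ _, rfl⟩
    · rintro ⟨j, -, rfl⟩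
      exact j.2
  rw [this, map_val, Multiset.map_map, ← map_rowTuple]
  rfl

open scoped Classical in
theorem coeff_rowExp_monomialSymm {n : ℕ} {μ : YoungDiagram} (h : μ.colLen 0 ≤ n)
    (ν : YoungDiagram) :
    MvPolynomial.coeff (rowExp n μ) (monomialSymm n ν) = if ν = μ then 1 else 0 := by
  rw [coeff_monomialSymm, map_rowExp h]
  by_cases hν : ν = μ
  · rw [if_pos hν, if_pos (by rw [hν])]
  · rw [if_neg hν, if_neg fun h' => hν (rowLens_injective h').symm]

/-- The coefficient of a dominant monomial in the restriction to finitely many variables. -/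
def rowCoeff (n : ℕ) (μ : YoungDiagram) : SymFun →ₗ[CQT] CQT :=
  MvPolynomial.lcoeff CQT (rowExp n μ) ∘ₗ (restrictVars n).toLinearMap

theorem rowCoeff_apply (n : ℕ) (μ : YoungDiagram) (f : SymFun) :
    rowCoeff n μ f = MvPolynomial.coeff (rowExp n μ) (restrictVars n f) := rfl

open scoped Classical in
theorem rowCoeff_monoFun {n : ℕ} {μ : YoungDiagram} (h : μ.colLen 0 ≤ n) (ν : YoungDiagram) :
    rowCoeff n μ (monoFun ν) = if ν = μ then 1 else 0 := by
  rw [rowCoeff_apply, restrictVars_monoFun, coeff_rowExp_monomialSymm h]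

open scoped Classical in
theorem linearIndependent_monoFun : LinearIndependent CQT monoFun := by
  rw [linearIndependent_iff]
  intro u hu
  ext μ
  have := congrArg (rowCoeff (μ.colLen 0) μ) hu
  rw [map_zero, Finsupp.linearCombination_apply, Finsupp.sum, map_sum] at this
  simp only [map_smul, rowCoeff_monoFun le_rfl, smul_eq_mul, mul_ite, mul_one, mul_zero,
    sum_ite_eq'] at this
  by_cases hμ : μ ∈ u.support
  · rwa [if_pos hμ] at this
  · exact Finsupp.notMem_support_iff.1 hμ

/-- The span of the products of less than `l` power sums. -/
def shortSpan (l : ℕ) : Submodule CQT SymFun :=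
  Submodule.span CQT {f | ∃ s : Multiset ℕ+, Multiset.card s < l ∧ f = (s.map MvPolynomial.X).prod}

theorem X_mul_mem_shortSpan {l : ℕ} (k : ℕ+) {f : SymFun} (hf : f ∈ shortSpan l) :
    MvPolynomial.X k * f ∈ shortSpan (l + 1) := by
  induction hf using Submodule.span_induction with
  | mem f hf =>
    obtain ⟨s, hs, rfl⟩ := hf
    refine Submodule.subset_span ⟨k ::ₘ s, by simpa using hs, ?_⟩
    rw [Multiset.map_cons, Multiset.prod_cons]
  | zero => rw [mul_zero]; exact Submodule.zero_mem _
  | add f g _ _ hf hg => rw [mul_add]; exact Submodule.add_mem _ hf hg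
  | smul c f _ hf => rw [mul_smul_comm]; exact Submodule.smul_mem _ c hf

theorem shortSpan_mono {l l' : ℕ} (h : l ≤ l') : shortSpan l ≤ shortSpan l' :=
  Submodule.span_mono fun _ ⟨s, hs, hf⟩ => ⟨s, hs.trans_le h, hf⟩

/-- Merging two parts lowers the number of factors, so an augmented monomial function is a product
of power sums plus shorter products. -/
theorem augFun_sub_prod_mem_shortSpan (l : ℕ) (a : Fin l → ℕ+) :
    augFun l a - ∏ j, MvPolynomial.X (a j) ∈ shortSpan l := by
  have hprod : ∀ l (a : Fin l → ℕ+), ∏ j, (MvPolynomial.X (a j) : SymFun) ∈ shortSpan (l + 1) :=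
    fun l a => Submodule.subset_span ⟨univ.val.map a, by simp, by
      rw [Multiset.map_map]; rfl⟩
  induction l with
  | zero => simp [augFun]
  | succ l ih =>
    have hmem : ∀ a : Fin l → ℕ+, augFun l a ∈ shortSpan (l + 1) := fun a => by
      rw [← sub_add_cancel (augFun l a) (∏ j, MvPolynomial.X (a j))]
      exact Submodule.add_mem _ (shortSpan_mono (Nat.le_succ l) (ih a)) (hprod l a)
    rw [augFun, Fin.prod_univ_succ, sub_right_comm, ← mul_sub]
    exact Submodule.sub_mem _ (X_mul_mem_shortSpan _ (ih _))
      (Submodule.sum_mem _ fun j _ => hmem _)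

/-- The unitriangularity of `augFun_sub_prod_mem_shortSpan` is inverted by induction on the number
of factors. -/
theorem prod_mem_span_monoFun (l : ℕ) (s : Multiset ℕ+) (hs : Multiset.card s < l) :
    (s.map MvPolynomial.X).prod ∈ Submodule.span CQT (Set.range monoFun) := by
  induction l generalizing s with
  | zero => omega
  | succ l ih =>
    obtain ⟨μ, hμ⟩ := exists_rowLens_eq (s.map (fun k : ℕ+ => (k : ℕ))) (by
      simp only [Multiset.mem_map, forall_exists_index, and_imp]
      rintro x k - rfl
      exact k.2)
    have hs' : univ.val.map (rowTuple μ) = s := by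
      rw [← map_rowTuple] at hμ
      refine Multiset.map_injective PNat.coe_injective ?_
      rw [Multiset.map_map]
      exact hμ
    have hcard : μ.colLen 0 = Multiset.card s := by rw [← hs']; simp
    have hmem := augFun_sub_prod_mem_shortSpan _ (rowTuple μ)
    have hle : shortSpan (μ.colLen 0) ≤ Submodule.span CQT (Set.range monoFun) := by
      refine Submodule.span_le.2 ?_
      rintro _ ⟨s', hs'', rfl⟩
      exact ih s' (by omega)
    have haug : augFun _ (rowTuple μ) ∈ Submodule.span CQT (Set.range monoFun) := by
      have h0 : (tupleStab fun i => (rowTuple μ i : ℕ) : CQT) ≠ 0 :=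
        Nat.cast_ne_zero.2 (tupleStab_pos _).ne'
      have : augFun _ (rowTuple μ) =
          (tupleStab fun i => (rowTuple μ i : ℕ) : CQT) • monoFun μ := by
        rw [monoFun, smul_smul, mul_inv_cancel₀ h0, one_smul]
      rw [this]
      exact Submodule.smul_mem _ _ (Submodule.subset_span ⟨μ, rfl⟩)
    have := Submodule.sub_mem _ haug (hle hmem)
    rw [sub_sub_cancel] at this
    rw [← hs', Multiset.map_map]
    exact this

theorem span_monoFun : ⊤ ≤ Submodule.span CQT (Set.range monoFun) := by
  rintro f -
  induction f using MvPolynomial.induction_on' with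
  | monomial d c =>
    have : MvPolynomial.monomial d c =
        c • ((Finsupp.toMultiset d).map (MvPolynomial.X : ℕ+ → SymFun)).prod := by
      rw [Finsupp.toMultiset_map, Finsupp.prod_toMultiset, MvPolynomial.monomial_eq,
        MvPolynomial.smul_eq_C_mul, Finsupp.prod_mapDomain_index_inj (MvPolynomial.X_injective)]
    rw [this]
    exact Submodule.smul_mem _ _ (prod_mem_span_monoFun _ _ (Nat.lt_succ_self _))
  | add f g hf hg => exact Submodule.add_mem _ hf hg

/-- The basis of monomial symmetric functions. -/
def monoBasis : Module.Basis YoungDiagram CQT SymFun :=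
  Module.Basis.mk linearIndependent_monoFun span_monoFun

theorem monoBasis_apply (μ : YoungDiagram) : monoBasis μ = monoFun μ := Module.Basis.mk_apply _ _ _

open scoped Classical in
theorem monoBasis_repr {n : ℕ} {μ : YoungDiagram} (h : μ.colLen 0 ≤ n) (f : SymFun) :
    monoBasis.repr f μ = rowCoeff n μ f := by
  have : monoBasis.coord μ = rowCoeff n μ := monoBasis.ext fun ν => by
    rw [monoBasis_apply, rowCoeff_monoFun h, Module.Basis.coord_apply, ← monoBasis_apply,
      Module.Basis.repr_self, Finsupp.single_apply]
  rw [← this, Module.Basis.coord_apply]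

/-- The coordinate of f at m_μ is the coefficient of a dominant monomial in as many variables as μ
has rows. -/
theorem symFun_ext {f g : SymFun} (h : ∀ n, restrictVars n f = restrictVars n g) : f = g := by
  refine monoBasis.ext_elem fun μ => ?_
  rw [monoBasis_repr le_rfl, monoBasis_repr le_rfl, rowCoeff_apply, rowCoeff_apply, h]

theorem IsTildeE.unique {r : ℕ} {T T' : Module.End CQT SymFun} (h : IsTildeE r T)
    (h' : IsTildeE r T') : T = T' := by
  refine LinearMap.ext fun f => symFun_ext fun n => ?_
  exact IsFractionRing.injective (MvPolynomial (Fin n) CQT) (RatVars n)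
    ((h n f).trans (h' n f).symm)

/-- This replaces the description by restrictions with an explicit kernel, from which
self-adjointness and realizability are read off. -/
theorem IsTildeE.eq_vertexOp {r : ℕ} {T : Module.End CQT SymFun} (h : IsTildeE r T) :
    T = vertexOp r (tildeKernel r) := h.unique (isTildeE_vertexOp r)

end Monomials

/-! ### Dominance and leading terms -/

section Leading

variable {R : Type*} [CommRing R] {n : ℕ}

/-- The partial sum of the first `k` exponents. -/
def headSum (k : ℕ) (β : Fin n →₀ ℕ) : ℕ := ∑ i : Fin n, if (i : ℕ) < k then β i else 0

theorem headSum_add (k : ℕ) (β γ : Fin n →₀ ℕ) : headSum k (β + γ) = headSum k β + headSum k γ := by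
  simp only [headSum, ← sum_add_distrib]
  refine sum_congr rfl fun i _ => ?_
  split_ifs <;> simp

theorem headSum_single (k : ℕ) (i : Fin n) (m : ℕ) :
    headSum k (Finsupp.single i m) = if (i : ℕ) < k then m else 0 := by
  rw [headSum, Finset.sum_eq_single i]
  · rw [Finsupp.single_eq_same]
  · intro j _ hj
    rw [Finsupp.single_apply, if_neg (Ne.symm hj), ite_self]
  · simp

theorem eq_of_headSum_eq {β γ : Fin n →₀ ℕ} (h : ∀ k, headSum k β = headSum k γ) : β = γ := by
  have hs : ∀ (δ : Fin n →₀ ℕ) (i : Fin n), headSum (i + 1) δ = headSum i δ + δ i := by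
    intro δ i
    have h1 : δ i = ∑ j : Fin n, if j = i then δ j else 0 := by simp
    rw [headSum, headSum, h1, ← sum_add_distrib]
    refine sum_congr rfl fun j _ => ?_
    by_cases hj : j = i
    · subst hj; simp
    · have : (j : ℕ) ≠ i := fun h => hj (Fin.ext h)
      rw [if_neg hj, add_zero]
      exact if_congr (by omega) rfl rfl
  ext i
  have h1 := h (i + 1)
  rw [hs, hs, h i] at h1
  omega

/-- The exponent is dominated by `v`. -/
def HeadLe (β v : Fin n →₀ ℕ) : Prop :=
  (∀ k, headSum k β ≤ headSum k v) ∧ headSum n β = headSum n v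

theorem HeadLe.add {β v γ w : Fin n →₀ ℕ} (h : HeadLe β v) (h' : HeadLe γ w) :
    HeadLe (β + γ) (v + w) :=
  ⟨fun k => by rw [headSum_add, headSum_add]; exact Nat.add_le_add (h.1 k) (h'.1 k), by
    rw [headSum_add, headSum_add, h.2, h'.2]⟩

/-- Equality of the sums forces every inequality between partial sums to be an equality, and the
partial sums determine an exponent. -/
theorem HeadLe.eq_of_add_eq {β v γ w : Fin n →₀ ℕ} (h : HeadLe β v) (h' : HeadLe γ w)
    (e : β + γ = v + w) : β = v := by
  refine eq_of_headSum_eq fun k => ?_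
  have h1 := congrArg (headSum k) e
  rw [headSum_add, headSum_add] at h1
  have := h.1 k
  have := h'.1 k
  omega

/-- All exponents of `f` are dominated by `v`, and the coefficient of `v` is `c`. -/
def HasLeading (v : Fin n →₀ ℕ) (c : R) (f : MvPolynomial (Fin n) R) : Prop :=
  (∀ β, MvPolynomial.coeff β f ≠ 0 → HeadLe β v) ∧ MvPolynomial.coeff v f = c

theorem HasLeading.add {v : Fin n →₀ ℕ} {c d : R} {f g : MvPolynomial (Fin n) R}
    (hf : HasLeading v c f) (hg : HasLeading v d g) : HasLeading v (c + d) (f + g) := by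
  refine ⟨fun β hβ => ?_, by rw [MvPolynomial.coeff_add, hf.2, hg.2]⟩
  rw [MvPolynomial.coeff_add] at hβ
  by_cases h : MvPolynomial.coeff β f = 0
  · rw [h, zero_add] at hβ
    exact hg.1 β hβ
  · exact hf.1 β h

theorem HasLeading.zero (v : Fin n →₀ ℕ) : HasLeading v 0 (0 : MvPolynomial (Fin n) R) :=
  ⟨fun β h => absurd (MvPolynomial.coeff_zero β) h, MvPolynomial.coeff_zero v⟩

theorem HasLeading.sum {ι : Type*} (s : Finset ι) {v : Fin n →₀ ℕ} {c : ι → R}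
    {f : ι → MvPolynomial (Fin n) R} (h : ∀ i ∈ s, HasLeading v (c i) (f i)) :
    HasLeading v (∑ i ∈ s, c i) (∑ i ∈ s, f i) := by
  classical
  induction s using Finset.induction_on with
  | empty => exact HasLeading.zero v
  | insert i s hi ih =>
    rw [sum_insert hi, sum_insert hi]
    exact (h i (mem_insert_self i s)).add (ih fun j hj => h j (mem_insert_of_mem hj))

theorem HasLeading.C_mul {v : Fin n →₀ ℕ} {c : R} {f : MvPolynomial (Fin n) R}
    (hf : HasLeading v c f) (a : R) : HasLeading v (a * c) (MvPolynomial.C a * f) := by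
  refine ⟨fun β hβ => hf.1 β fun h => hβ ?_, by rw [MvPolynomial.coeff_C_mul, hf.2]⟩
  rw [MvPolynomial.coeff_C_mul, h, mul_zero]

/-- The exponent v + w arises in only one way from exponents of the two factors, by
`HeadLe.eq_of_add_eq`. -/
theorem HasLeading.mul {v w : Fin n →₀ ℕ} {c d : R} {f g : MvPolynomial (Fin n) R}
    (hf : HasLeading v c f) (hg : HasLeading w d g) : HasLeading (v + w) (c * d) (f * g) := by
  constructor
  · intro β hβ
    rw [MvPolynomial.coeff_mul] at hβ
    obtain ⟨x, hx, hx'⟩ := exists_ne_zero_of_sum_ne_zero hβ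
    rw [← HasAntidiagonal.mem_antidiagonal.1 hx]
    exact (hf.1 _ (left_ne_zero_of_mul hx')).add (hg.1 _ (right_ne_zero_of_mul hx'))
  · have key : ∀ x ∈ antidiagonal (v + w), x ≠ (v, w) →
        MvPolynomial.coeff x.1 f * MvPolynomial.coeff x.2 g = 0 := by
      intro x hx hne
      by_contra h0
      have hx1 := hf.1 _ (left_ne_zero_of_mul h0)
      have hx2 := hg.1 _ (right_ne_zero_of_mul h0)
      have e2 := HasAntidiagonal.mem_antidiagonal.1 hx
      have e1 := hx1.eq_of_add_eq hx2 e2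
      rw [e1] at e2
      exact hne (Prod.ext e1 (add_left_cancel e2))
    have hm : (v, w) ∈ antidiagonal (v + w) := by rw [HasAntidiagonal.mem_antidiagonal]
    rw [MvPolynomial.coeff_mul, Finset.sum_eq_single_of_mem (v, w) hm key, hf.2, hg.2]

theorem HasLeading.one : HasLeading (0 : Fin n →₀ ℕ) 1 (1 : MvPolynomial (Fin n) R) := by
  classical
  refine ⟨fun β hβ => ?_, MvPolynomial.coeff_zero_one⟩
  rw [MvPolynomial.coeff_one] at hβ
  have : 0 = β := by by_contra h; exact hβ (if_neg h)
  rw [← this]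
  exact ⟨fun k => le_rfl, rfl⟩

theorem HasLeading.prod {ι : Type*} (s : Finset ι) {v : ι → Fin n →₀ ℕ} {c : ι → R}
    {f : ι → MvPolynomial (Fin n) R} (h : ∀ i ∈ s, HasLeading (v i) (c i) (f i)) :
    HasLeading (∑ i ∈ s, v i) (∏ i ∈ s, c i) (∏ i ∈ s, f i) := by
  classical
  induction s using Finset.induction_on with
  | empty => exact HasLeading.one
  | insert i s hi ih =>
    rw [sum_insert hi, prod_insert hi, prod_insert hi]
    exact (h i (mem_insert_self i s)).mul (ih fun j hj => h j (mem_insert_of_mem hj))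

theorem hasLeading_pair {i j : Fin n} (hij : i < j) (a b : R) :
    HasLeading (Finsupp.single i 1) a
      (MvPolynomial.C a * MvPolynomial.X i - MvPolynomial.C b * MvPolynomial.X j) := by
  classical
  constructor
  · intro β hβ
    rw [MvPolynomial.coeff_sub, MvPolynomial.coeff_C_mul, MvPolynomial.coeff_C_mul,
      MvPolynomial.coeff_X, MvPolynomial.coeff_X] at hβ
    by_cases h1 : Finsupp.single i 1 = β
    · rw [← h1]; exact ⟨fun k => le_rfl, rfl⟩
    · rw [if_neg h1] at hβ
      have h2 : Finsupp.single j 1 = β := by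
        by_contra h2
        rw [if_neg h2] at hβ
        simp at hβ
      rw [← h2]
      refine ⟨fun k => ?_, ?_⟩
      · rw [headSum_single, headSum_single]
        have : (i : ℕ) < j := hij
        split_ifs <;> omega
      · rw [headSum_single, headSum_single, if_pos i.2, if_pos j.2]
  · rw [MvPolynomial.coeff_sub, MvPolynomial.coeff_C_mul, MvPolynomial.coeff_C_mul,
      MvPolynomial.coeff_X, MvPolynomial.coeff_X, if_pos rfl, if_neg]
    · ring
    · intro h
      exact hij.ne (Finsupp.single_left_injective one_ne_zero h).symm

/-- The substitution that marks the first `k` variables by the polynomial variable. -/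
def headHom (R : Type*) [CommRing R] (n k : ℕ) :
    MvPolynomial (Fin n) R →ₐ[R] Polynomial (MvPolynomial (Fin n) R) :=
  MvPolynomial.aeval fun i =>
    Polynomial.C (MvPolynomial.X i) * Polynomial.X ^ (if (i : ℕ) < k then 1 else 0)

theorem headHom_monomial (k : ℕ) (β : Fin n →₀ ℕ) (c : R) :
    headHom R n k (MvPolynomial.monomial β c) =
      Polynomial.monomial (headSum k β) (MvPolynomial.monomial β c) := by
  rw [headHom, MvPolynomial.aeval_monomial, Finsupp.prod_fintype _ _ fun i => pow_zero _]
  simp only [mul_pow, prod_mul_distrib, ← pow_mul, prod_pow_eq_pow_sum, ← map_pow, ← map_prod]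
  rw [IsScalarTower.algebraMap_apply R (MvPolynomial (Fin n) R), ← mul_assoc]
  change Polynomial.C (MvPolynomial.C c) * _ * _ = _
  rw [← map_mul, Polynomial.C_mul_X_pow_eq_monomial, MvPolynomial.monomial_eq,
    Finsupp.prod_fintype _ _ fun i => pow_zero _, headSum]
  congr 2
  refine sum_congr rfl fun i _ => ?_
  split_ifs <;> simp

theorem coeff_headHom (k m : ℕ) (β : Fin n →₀ ℕ) (f : MvPolynomial (Fin n) R) :
    MvPolynomial.coeff β ((headHom R n k f).coeff m) =
      if headSum k β = m then MvPolynomial.coeff β f else 0 := by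
  induction f using MvPolynomial.induction_on' with
  | monomial γ c =>
    rw [headHom_monomial, Polynomial.coeff_monomial, MvPolynomial.coeff_monomial]
    by_cases h : γ = β
    · subst h; split_ifs <;> simp_all
    · rw [if_neg h, ite_self]
      split_ifs
      · rw [MvPolynomial.coeff_monomial, if_neg h]
      · rw [MvPolynomial.coeff_zero]
  | add f g hf hg =>
    rw [map_add, Polynomial.coeff_add, MvPolynomial.coeff_add, hf, hg, MvPolynomial.coeff_add]
    split_ifs <;> simp

theorem natDegree_headHom_le_iff (k N : ℕ) (f : MvPolynomial (Fin n) R) :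
    (headHom R n k f).natDegree ≤ N ↔ ∀ β, MvPolynomial.coeff β f ≠ 0 → headSum k β ≤ N := by
  rw [Polynomial.natDegree_le_iff_coeff_eq_zero]
  constructor
  · intro h β hβ
    by_contra! hN
    have := congrArg (MvPolynomial.coeff β) (h _ hN)
    rw [coeff_headHom, if_pos rfl, MvPolynomial.coeff_zero] at this
    exact hβ this
  · intro h m hm
    ext β
    rw [coeff_headHom, MvPolynomial.coeff_zero]
    split_ifs with he
    · by_contra h0
      have := h β h0
      omega
    · rfl

theorem headHom_eq_C_mul_X_pow_iff (N : ℕ) (f : MvPolynomial (Fin n) R) :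
    headHom R n n f = Polynomial.C f * Polynomial.X ^ N ↔
      ∀ β, MvPolynomial.coeff β f ≠ 0 → headSum n β = N := by
  constructor
  · intro h β hβ
    have := congrArg (fun p => MvPolynomial.coeff β (Polynomial.coeff p (headSum n β))) h
    simp only [coeff_headHom, if_true, Polynomial.coeff_C_mul_X_pow] at this
    by_contra hne
    rw [if_neg hne, MvPolynomial.coeff_zero] at this
    exact hβ this
  · intro h
    ext m β
    rw [coeff_headHom, Polynomial.coeff_C_mul_X_pow]
    by_cases hβ : MvPolynomial.coeff β f = 0
    · rw [hβ, ite_self]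
      split_ifs <;> simp [hβ]
    · rw [h β hβ]
      by_cases hm : m = N
      · rw [if_pos hm, if_pos hm.symm]
      · rw [if_neg hm, if_neg (Ne.symm hm), MvPolynomial.coeff_zero]

/-- Division by a polynomial with leading coefficient 1, needed to remove the Vandermonde product.
Marking the first k variables makes the largest k-th partial sum a degree, and degrees add in a
domain; this bounds the exponents of g. For k = n, homogeneity of the product and of f gives that of
g by cancellation. -/
theorem HasLeading.of_mul [IsDomain R] {v w : Fin n →₀ ℕ} {d : R} {f g : MvPolynomial (Fin n) R}
    (hf : HasLeading v 1 f) (h : HasLeading (v + w) d (f * g)) : HasLeading w d g := by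
  have hf0 : f ≠ 0 := by
    rintro rfl
    exact one_ne_zero (hf.2.symm.trans (MvPolynomial.coeff_zero v))
  have hinj : ∀ k, headHom R n k f ≠ 0 := fun k h0 => by
    have := coeff_headHom k (headSum k v) v f
    rw [h0, if_pos rfl, hf.2] at this
    simp at this
  have hg : ∀ β, MvPolynomial.coeff β g ≠ 0 → HeadLe β w := by
    intro β hβ
    have hg0 : ∀ k, headHom R n k g ≠ 0 := fun k h0 => by
      have := coeff_headHom k (headSum k β) β g
      rw [h0, if_pos rfl] at this
      exact hβ (by simpa using this.symm)
    constructor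
    · intro k
      have h1 : (headHom R n k (f * g)).natDegree ≤ headSum k (v + w) :=
        (natDegree_headHom_le_iff k _ _).2 fun γ hγ => (h.1 γ hγ).1 k
      rw [map_mul, Polynomial.natDegree_mul (hinj k) (hg0 k), headSum_add] at h1
      have h2 : headSum k v ≤ (headHom R n k f).natDegree :=
        (natDegree_headHom_le_iff k _ f).1 le_rfl v (by rw [hf.2]; exact one_ne_zero)
      exact (natDegree_headHom_le_iff k _ g).1 (by omega) β hβ
    · refine (headHom_eq_C_mul_X_pow_iff (headSum n w) g).1 ?_ β hβ
      have h1 := (headHom_eq_C_mul_X_pow_iff (headSum n (v + w)) (f * g)).2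
        fun γ hγ => (h.1 γ hγ).2
      have h2 := (headHom_eq_C_mul_X_pow_iff (headSum n v) f).2 fun γ hγ => (hf.1 γ hγ).2
      have h3 : headHom R n n f * headHom R n n g =
          headHom R n n f * (Polynomial.C g * Polynomial.X ^ headSum n w) := by
        rw [← map_mul, h1, h2, headSum_add, pow_add, map_mul]
        ring
      exact mul_left_cancel₀ (hinj n) h3
  have h1 : HasLeading w (MvPolynomial.coeff w g) g := ⟨hg, rfl⟩
  have h2 := (hf.mul h1).2
  rw [h.2, one_mul] at h2
  exact ⟨hg, h2.symm⟩

/-- Outside the common part, the values on S are at most f k, those on the initial segment at least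
f k, and S has no more elements there. -/
theorem sum_le_sum_range_of_antitone {f : ℕ → ℕ} (hf : Antitone f) (S : Finset ℕ) (k : ℕ)
    (hS : S.card ≤ k) : ∑ i ∈ S, f i ≤ ∑ i ∈ range k, f i := by
  rw [← sum_inter_add_sum_sdiff S (range k) f, ← sum_inter_add_sum_sdiff (range k) S f, inter_comm]
  refine Nat.add_le_add_left ?_ _
  have h1 : ∑ i ∈ S \ range k, f i ≤ (S \ range k).card * f k := by
    rw [← smul_eq_mul]
    refine sum_le_card_nsmul _ _ _ fun i hi => hf ?_
    simpa using (mem_sdiff.1 hi).2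
  have h2 : (range k \ S).card * f k ≤ ∑ i ∈ range k \ S, f i := by
    rw [← smul_eq_mul]
    refine card_nsmul_le_sum _ _ _ fun i hi => hf ?_
    exact (mem_range.1 (mem_sdiff.1 hi).1).le
  have h3 : (S \ range k).card ≤ (range k \ S).card := by
    have e1 := card_sdiff_add_card_inter S (range k)
    have e2 := card_sdiff_add_card_inter (range k) S
    rw [inter_comm, card_range] at e2
    omega
  exact h1.trans ((Nat.mul_le_mul_right _ h3).trans h2)

theorem headSum_rowExp (k : ℕ) {μ : YoungDiagram} (h : μ.colLen 0 ≤ n) :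
    headSum k (rowExp n μ) = ∑ i ∈ range k, μ.rowLen i := by
  have h0 : ∀ i, n ≤ i → μ.rowLen i = 0 := fun i hi => by
    by_contra h0
    have := (rowLen_pos_iff μ i).1 (Nat.pos_of_ne_zero h0)
    omega
  rw [headSum]
  simp only [rowExp_apply]
  rw [Fin.sum_univ_eq_sum_range (fun i => if i < k then μ.rowLen i else 0) n, ← sum_filter]
  refine sum_subset (fun i hi => ?_) fun i hi hi' => h0 i ?_
  · exact mem_range.2 (mem_filter.1 hi).2
  · by_contra! hlt
    exact hi' (mem_filter.2 ⟨mem_range.2 hlt, mem_range.1 hi⟩)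

theorem card_eq_sum_rowLen (μ : YoungDiagram) {N : ℕ} (h : μ.colLen 0 ≤ N) :
    μ.card = ∑ i ∈ range N, μ.rowLen i := by
  have : μ.cells = (range N).biUnion μ.row := by
    ext c
    rw [mem_biUnion]
    constructor
    · intro hc
      refine ⟨c.1, mem_range.2 ?_, YoungDiagram.mem_row_iff.2 ⟨hc, rfl⟩⟩
      have : (c.1, 0) ∈ μ := μ.up_left_mem le_rfl (Nat.zero_le c.2) hc
      exact (YoungDiagram.mem_iff_lt_colLen.1 this).trans_le h
    · rintro ⟨i, -, hi⟩
      exact (YoungDiagram.mem_row_iff.1 hi).1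
  rw [YoungDiagram.card, this, card_biUnion]
  · exact sum_congr rfl fun i _ => (μ.rowLen_eq_card).symm
  · intro i _ j _ hij
    refine disjoint_left.2 fun c hc hc' => hij ?_
    rw [← (YoungDiagram.mem_row_iff.1 hc).2, ← (YoungDiagram.mem_row_iff.1 hc').2]

/-- The exponents of m_μ rearrange the rows of μ, and no k rows have a larger sum than the first k.
-/
theorem hasLeading_monomialSymm {μ : YoungDiagram} (h : μ.colLen 0 ≤ n) :
    HasLeading (rowExp n μ) 1 (monomialSymm n μ) := by
  classical
  refine ⟨fun β hβ => ?_, by rw [coeff_rowExp_monomialSymm h, if_pos rfl]⟩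
  rw [coeff_monomialSymm] at hβ
  have hβ' : β.support.val.map β = (μ.rowLens : Multiset ℕ) := by
    by_contra h'
    exact hβ (if_neg h')
  constructor
  · intro k
    have h' : (univ : Finset {i // i ∈ β.support}).val.map (fun i : {i // i ∈ β.support} => β i) =
        univ.val.map (fun i => (rowTuple μ i : ℕ)) := by
      rw [map_rowTuple, ← hβ']
      conv_rhs => rw [← Finset.attach_map_val (s := β.support), map_val, Multiset.map_map]
      rfl
    obtain ⟨e, he⟩ := exists_equiv_of_map_eq h'
    rw [headSum_rowExp k h]
    have h1 : headSum k β = ∑ j : Fin (μ.colLen 0),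
        if ((e j : Fin n) : ℕ) < k then μ.rowLen j else 0 := by
      have h2 : headSum k β = ∑ i ∈ β.support, if (i : ℕ) < k then β i else 0 := by
        refine (sum_subset (subset_univ _) fun i _ hi => ?_).symm
        rw [Finsupp.notMem_support_iff.1 hi, ite_self]
      rw [h2, ← sum_coe_sort, ← e.sum_comp]
      refine sum_congr rfl fun j _ => ?_
      have := he j
      rw [this]
      rfl
    rw [h1, ← sum_filter]
    refine le_trans (le_of_eq ?_) (sum_le_sum_range_of_antitone
      (f := μ.rowLen) (fun i j hij => μ.rowLen_anti i j hij)
      ((univ.filter fun j => ((e j : Fin n) : ℕ) < k).map Fin.valEmbedding) k ?_)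
    · rw [sum_map]
      rfl
    · rw [card_map, ← card_range k]
      refine card_le_card_of_injOn (fun j => ((e j : Fin n) : ℕ)) (fun j hj => ?_) ?_
      · simpa using hj
      · intro i _ j _ hij
        exact e.injective (Subtype.ext (Fin.ext hij))
  · have h1 : ∀ γ : Fin n →₀ ℕ, headSum n γ = (γ.support.val.map γ).sum := fun γ => by
      have : headSum n γ = ∑ i, γ i := by
        rw [headSum]
        exact sum_congr rfl fun i _ => if_pos i.2
      rw [this]
      exact (sum_subset (subset_univ _) fun i _ hi => Finsupp.notMem_support_iff.1 hi).symm
    rw [h1, h1, hβ', map_rowExp h]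

end Leading

/-! ### Triangularity of the modified Macdonald operators -/

section Clearing

variable {n : ℕ}

/-- The factor `t` of a pair that is separated by `I`. -/
def sepFactor {M : Type*} [One M] (t : M) (I : Finset (Fin n)) (i j : Fin n) : M :=
  if i ∈ I ∧ j ∉ I then t else 1

/-- Each denominator occurs in the Vandermonde product. For i < j with j alone in I, the signs of
x_j - x_i and x_i - x_j cancel and x_i - t x_j results, so no global sign appears. -/
theorem prod_crossing {K : Type*} [Field K] {x : Fin n → K} (hx : Function.Injective x) (t : K)
    (I : Finset (Fin n)) :
    (∏ i, ∏ j ∈ Ioi i, (x i - x j)) * ∏ i ∈ I, ∏ j ∈ Iᶜ, (t * x i - x j) / (x i - x j) =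
      ∏ i, ∏ j ∈ Ioi i, (sepFactor t I i j * x i - sepFactor t I j i * x j) := by
  classical
  set h : Fin n → Fin n → K := fun i j =>
    if i ∈ I ∧ j ∉ I then (t * x i - x j) / (x i - x j) else 1 with hh
  have h1 : ∏ i ∈ I, ∏ j ∈ Iᶜ, (t * x i - x j) / (x i - x j) = ∏ i, ∏ j ∈ {i}ᶜ, h i j := by
    rw [← prod_subset (subset_univ I)]
    · refine prod_congr rfl fun i hi => ?_
      refine (prod_congr rfl fun j hj => ?_).trans
        (prod_subset (s₁ := Iᶜ) (s₂ := {i}ᶜ) (f := h i) (fun j hj => ?_) fun j _ hj => ?_)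
      · exact (if_pos ⟨hi, mem_compl.1 hj⟩).symm
      · rw [mem_compl, mem_singleton]
        rintro rfl
        exact mem_compl.1 hj hi
      · exact if_neg fun hij => hj (mem_compl.2 hij.2)
    · intro i _ hi
      exact prod_eq_one fun j _ => if_neg fun hij => hi hij.1
  rw [h1, ← prod_prod_Ioi_mul_eq_prod_prod_off_diag (fun j i => h i j), ← prod_mul_distrib]
  refine prod_congr rfl fun i _ => ?_
  rw [← prod_mul_distrib]
  refine prod_congr rfl fun j hj => ?_
  have hij : x i - x j ≠ 0 := sub_ne_zero.2 fun e => (mem_Ioi.1 hj).ne (hx e)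
  have hji : x j - x i ≠ 0 := sub_ne_zero.2 fun e => (mem_Ioi.1 hj).ne' (hx e)
  simp only [hh, sepFactor]
  by_cases hi : i ∈ I <;> by_cases hj : j ∈ I <;> simp only [hi, hj, not_true, not_false_eq_true,
    and_true, and_false, if_true, if_false, one_mul, mul_one]
  · field_simp
  · field_simp
    ring

/-- For i ∈ I each of the n - 1 - i larger indices j gives one factor t: from the prefactor if j ∈
I, which counts pairs inside I, and from the separated pair otherwise. -/
theorem prod_sepFactor {M : Type*} [CommMonoid M] (t : M) (I : Finset (Fin n)) :
    t ^ (I.card * (I.card - 1) / 2) * ∏ i, ∏ j ∈ Ioi i, sepFactor t I i j =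
      ∏ i ∈ I, t ^ (n - 1 - (i : ℕ)) := by
  classical
  set b : Fin n → Fin n → ℕ := fun i j => if i ∈ I ∧ j ∈ I then 1 else 0 with hb
  have h1 : ∑ i, ∑ j ∈ Ioi i, b i j = I.card * (I.card - 1) / 2 := by
    have h2 := sum_sum_Ioi_add_eq_sum_sum_off_diag b
    have h3 : ∀ i j, b j i + b i j = 2 * b i j := fun i j => by
      simp only [hb, and_comm (a := j ∈ I)]; ring
    simp only [h3, ← mul_sum] at h2
    have h4 : ∑ i, ∑ j ∈ {i}ᶜ, b j i = I.card * (I.card - 1) := by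
      rw [← sum_subset (subset_univ I), ← smul_eq_mul, ← sum_const]
      · refine sum_congr rfl fun i hi => ?_
        rw [← card_erase_of_mem hi, card_eq_sum_ones]
        refine (sum_subset_zero_on_sdiff ?_ ?_ ?_).symm
        · intro j hj
          simpa using ne_of_mem_erase hj
        · intro j hj
          simp only [mem_sdiff, mem_compl, mem_singleton, mem_erase, not_and] at hj
          exact if_neg fun h => hj.2 hj.1 h.1
        · intro j hj
          exact (if_pos ⟨mem_of_mem_erase hj, hi⟩).symm
      · intro i _ hi
        exact sum_eq_zero fun j _ => if_neg fun h => hi h.2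
    omega
  rw [← h1, ← prod_pow_eq_pow_sum, ← prod_mul_distrib, ← prod_subset (subset_univ I)]
  · refine prod_congr rfl fun i hi => ?_
    rw [← prod_pow_eq_pow_sum, ← prod_mul_distrib, ← Fin.card_Ioi, ← prod_const]
    refine prod_congr rfl fun j _ => ?_
    by_cases hj : j ∈ I <;> simp [hb, sepFactor, hi, hj]
  · intro i _ hi
    rw [← prod_pow_eq_pow_sum, ← prod_mul_distrib]
    exact prod_eq_one fun j _ => by simp [hb, sepFactor, hi]

end Clearing

/-! ### Leading terms of the modified Macdonald operators -/

section Triangular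

attribute [local instance] isDomain_CQ noZeroDivisors_CQT charZero_CQT

/-- The product of the differences of the variables. -/
def diffProd (n : ℕ) : MvPolynomial (Fin n) CQT :=
  ∏ i, ∏ j ∈ Ioi i, (MvPolynomial.C 1 * MvPolynomial.X i - MvPolynomial.C 1 * MvPolynomial.X j)

/-- Macdonald's operator multiplied by the product of the differences. -/
def macdonaldNum (n r : ℕ) (f : MvPolynomial (Fin n) CQT) : MvPolynomial (Fin n) CQT :=
  ∑ I ∈ powersetCard r (univ : Finset (Fin n)), MvPolynomial.C (tv ^ (r * (r - 1) / 2)) *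
    ((∏ i, ∏ j ∈ Ioi i, (MvPolynomial.C (sepFactor tv I i j) * MvPolynomial.X i -
      MvPolynomial.C (sepFactor tv I j i) * MvPolynomial.X j)) * shiftVars n I f)

theorem algebraMap_C_ratVars (n : ℕ) (c : CQT) :
    algebraMap (MvPolynomial (Fin n) CQT) (RatVars n) (MvPolynomial.C c) =
      algebraMap CQT (RatVars n) c :=
  (IsScalarTower.algebraMap_apply CQT (MvPolynomial (Fin n) CQT) (RatVars n) c).symm

theorem diffProd_mul_macdonaldD (n r : ℕ) (f : MvPolynomial (Fin n) CQT) :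
    algebraMap (MvPolynomial (Fin n) CQT) (RatVars n) (diffProd n) * macdonaldD n r f =
      algebraMap (MvPolynomial (Fin n) CQT) (RatVars n) (macdonaldNum n r f) := by
  have hd : algebraMap (MvPolynomial (Fin n) CQT) (RatVars n) (diffProd n) =
      ∏ i, ∏ j ∈ Ioi i, (xVar n i - xVar n j) := by
    rw [diffProd, map_prod]
    refine prod_congr rfl fun i _ => ?_
    rw [map_prod]
    refine prod_congr rfl fun j _ => ?_
    rw [map_one, one_mul, one_mul, map_sub]
    rfl
  rw [macdonaldD, macdonaldNum, map_sum, mul_sum]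
  refine sum_congr rfl fun I _ => ?_
  have hp := prod_crossing (xVar_injective n) (algebraMap CQT (RatVars n) tv) I
  have hs : ∀ i j, algebraMap (MvPolynomial (Fin n) CQT) (RatVars n)
      (MvPolynomial.C (sepFactor tv I i j)) = sepFactor (algebraMap CQT (RatVars n) tv) I i j := by
    intro i j
    rw [algebraMap_C_ratVars, sepFactor, sepFactor, apply_ite (algebraMap CQT (RatVars n)), map_one]
  have hq : algebraMap (MvPolynomial (Fin n) CQT) (RatVars n)
      (∏ i, ∏ j ∈ Ioi i, (MvPolynomial.C (sepFactor tv I i j) * MvPolynomial.X i -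
        MvPolynomial.C (sepFactor tv I j i) * MvPolynomial.X j)) =
      ∏ i, ∏ j ∈ Ioi i, (sepFactor (algebraMap CQT (RatVars n) tv) I i j * xVar n i -
        sepFactor (algebraMap CQT (RatVars n) tv) I j i * xVar n j) := by
    rw [map_prod]
    refine prod_congr rfl fun i _ => ?_
    rw [map_prod]
    refine prod_congr rfl fun j _ => ?_
    rw [map_sub, map_mul, map_mul, hs, hs]
    rfl
  rw [map_mul, map_mul, hq, ← hp, hd, algebraMap_C_ratVars]
  ring

/-- The modified Macdonald operator multiplied by the product of the differences. -/
def tildeNum (n r : ℕ) (f : MvPolynomial (Fin n) CQT) : MvPolynomial (Fin n) CQT :=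
  ∑ j ∈ range (r + 1),
    MvPolynomial.C (eTail n j * tv⁻¹ ^ ((r - j) * n)) * macdonaldNum n (r - j) f

theorem IsTildeE.diffProd_mul {r : ℕ} {T : Module.End CQT SymFun} (h : IsTildeE r T) (n : ℕ)
    (f : SymFun) : diffProd n * restrictVars n (T f) = tildeNum n r (restrictVars n f) := by
  refine IsFractionRing.injective (MvPolynomial (Fin n) CQT) (RatVars n) ?_
  rw [map_mul, h n f, tildeEn, tildeNum, map_sum, mul_sum]
  refine sum_congr rfl fun j _ => ?_
  rw [map_mul (algebraMap (MvPolynomial (Fin n) CQT) (RatVars n)), ← diffProd_mul_macdonaldD,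
    algebraMap_C_ratVars]
  ring

theorem hasLeading_diffProd (n : ℕ) :
    HasLeading (∑ i : Fin n, ∑ _j ∈ Ioi i, Finsupp.single i 1) 1 (diffProd n) := by
  have := HasLeading.prod (univ : Finset (Fin n)) fun i _ =>
    HasLeading.prod (Ioi i) fun j hj => hasLeading_pair (mem_Ioi.1 hj) (1 : CQT) 1
  simp only [prod_const_one] at this
  exact this

theorem coeff_shiftVars (n : ℕ) (I : Finset (Fin n)) (f : MvPolynomial (Fin n) CQT)
    (β : Fin n →₀ ℕ) : MvPolynomial.coeff β (shiftVars n I f) =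
      (∏ i ∈ I, qv ^ β i) * MvPolynomial.coeff β f := by
  classical
  induction f using MvPolynomial.induction_on' with
  | monomial γ c =>
    have : shiftVars n I (MvPolynomial.monomial γ c) =
        MvPolynomial.monomial γ ((∏ i ∈ I, qv ^ γ i) * c) := by
      rw [shiftVars, MvPolynomial.aeval_monomial, Finsupp.prod_fintype _ _ fun i => pow_zero _]
      have h1 : ∀ i, (if i ∈ I then MvPolynomial.C qv * MvPolynomial.X i else MvPolynomial.X i :
          MvPolynomial (Fin n) CQT) ^ γ i =
          MvPolynomial.C (if i ∈ I then qv ^ γ i else 1) * MvPolynomial.X i ^ γ i := by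
        intro i
        split_ifs
        · rw [mul_pow, map_pow]
        · rw [map_one, one_mul]
      simp only [h1, prod_mul_distrib, ← map_prod]
      rw [MvPolynomial.monomial_eq, Finsupp.prod_fintype _ _ fun i => pow_zero _,
        MvPolynomial.algebraMap_eq, ← mul_assoc, ← map_mul, prod_ite_mem, univ_inter, mul_comm c]
    rw [this, MvPolynomial.coeff_monomial, MvPolynomial.coeff_monomial]
    split_ifs with h
    · rw [h]
    · rw [mul_zero]
  | add f g hf hg => rw [map_add, MvPolynomial.coeff_add, hf, hg, MvPolynomial.coeff_add, mul_add]

theorem HasLeading.shiftVars {n : ℕ} {v : Fin n →₀ ℕ} {c : CQT} {f : MvPolynomial (Fin n) CQT}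
    (hf : HasLeading v c f) (I : Finset (Fin n)) :
    HasLeading v ((∏ i ∈ I, qv ^ v i) * c) (shiftVars n I f) := by
  refine ⟨fun β hβ => hf.1 β fun h => hβ ?_, by rw [coeff_shiftVars, hf.2]⟩
  rw [coeff_shiftVars, h, mul_zero]

/-- The eigenvalue of `Ẽ^r` on the Macdonald function of a partition, computed in `n` variables. -/
def tildeEigen (n r : ℕ) (μ : YoungDiagram) : CQT :=
  ∑ j ∈ range (r + 1), eTail n j * tv⁻¹ ^ ((r - j) * n) *
    ∑ I ∈ powersetCard (r - j) (univ : Finset (Fin n)),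
      ∏ i ∈ I, (tv ^ (n - 1 - (i : ℕ)) * qv ^ μ.rowLen i)

theorem hasLeading_tildeNum (n r : ℕ) (μ : YoungDiagram) {f : MvPolynomial (Fin n) CQT}
    (hf : HasLeading (rowExp n μ) 1 f) :
    HasLeading (∑ i : Fin n, ∑ _j ∈ Ioi i, Finsupp.single i 1 + rowExp n μ) (tildeEigen n r μ)
      (tildeNum n r f) := by
  refine HasLeading.sum _ fun j _ => HasLeading.C_mul ?_ _
  refine HasLeading.sum _ fun I hI => ?_
  have h1 := HasLeading.prod (univ : Finset (Fin n)) fun i _ =>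
    HasLeading.prod (Ioi i) fun j hj => hasLeading_pair (mem_Ioi.1 hj) (sepFactor tv I i j)
      (sepFactor tv I j i)
  have h2 := (h1.mul (hf.shiftVars I)).C_mul (tv ^ ((r - j) * (r - j - 1) / 2))
  rw [← (mem_powersetCard.1 hI).2, mul_one, ← mul_assoc, prod_sepFactor, ← prod_mul_distrib] at h2
  rw [← (mem_powersetCard.1 hI).2]
  exact h2

/-- After multiplication by `diffProd n` the operator is a sum of products of linear factors and
shifts, whose leading terms multiply; the Vandermonde product is then divided out. -/
theorem IsTildeE.hasLeading {r : ℕ} {T : Module.End CQT SymFun} (h : IsTildeE r T) {n : ℕ}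
    {μ : YoungDiagram} (hn : μ.colLen 0 ≤ n) :
    HasLeading (rowExp n μ) (tildeEigen n r μ) (restrictVars n (T (monoFun μ))) := by
  have hIsD : IsDomain CQT := inferInstance
  refine (hasLeading_diffProd n).of_mul ?_
  rw [h.diffProd_mul]
  refine hasLeading_tildeNum n r μ ?_
  rw [restrictVars_monoFun]
  exact hasLeading_monomialSymm hn

theorem strictlyDominated_of_headLe {n : ℕ} {μ lam : YoungDiagram} (hμ : μ.colLen 0 ≤ n)
    (hlam : lam.colLen 0 ≤ n) (h : HeadLe (rowExp n μ) (rowExp n lam)) (hne : μ ≠ lam) :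
    StrictlyDominated μ lam := by
  refine ⟨?_, hne, fun k => ?_⟩
  · rw [card_eq_sum_rowLen μ hμ, card_eq_sum_rowLen lam hlam, ← headSum_rowExp n hμ,
      ← headSum_rowExp n hlam]
    exact h.2
  · rw [← headSum_rowExp k hμ, ← headSum_rowExp k hlam]
    exact h.1 k

theorem IsTildeE.repr_self {r : ℕ} {T : Module.End CQT SymFun} (h : IsTildeE r T) {n : ℕ}
    {μ : YoungDiagram} (hn : μ.colLen 0 ≤ n) :
    monoBasis.repr (T (monoFun μ)) μ = tildeEigen n r μ := by
  rw [monoBasis_repr hn]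
  exact (h.hasLeading hn).2

theorem IsTildeE.repr_ne_zero {r : ℕ} {T : Module.End CQT SymFun} (h : IsTildeE r T)
    {μ lam : YoungDiagram} (hne : monoBasis.repr (T (monoFun lam)) μ ≠ 0) (hμ : μ ≠ lam) :
    StrictlyDominated μ lam := by
  set n := max (μ.colLen 0) (lam.colLen 0)
  rw [monoBasis_repr (le_max_left _ (lam.colLen 0))] at hne
  exact strictlyDominated_of_headLe (le_max_left _ _) (le_max_right _ _)
    ((h.hasLeading (le_max_right (μ.colLen 0) _)).1 _ hne) hμ

end Triangular

/-! ### Hahn series related by an automorphism of the exponents -/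

section HahnRel

set_option linter.unusedSectionVars false

variable {Γ : Type*} [AddCommGroup Γ] [LinearOrder Γ] [IsOrderedAddMonoid Γ]
variable {R : Type*} [CommRing R]

/-- The coefficients of `y` are those of `x`, permuted by `σ`. -/
def HahnRel (σ : Γ ≃+ Γ) (x y : HahnSeries Γ R) : Prop := ∀ γ, x.coeff (σ γ) = y.coeff γ

/-- The automorphism need not respect the order, so it does not act on all Hahn series. Relating two
given series is still compatible with convolution. -/
theorem HahnRel.mul {σ : Γ ≃+ Γ} {x y x' y' : HahnSeries Γ R} (h : HahnRel σ x y)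
    (h' : HahnRel σ x' y') : HahnRel σ (x * x') (y * y') := by
  intro γ
  rw [hahn_coeff_mul, hahn_coeff_mul, ← finsum_comp_equiv σ.toEquiv]
  refine finsum_congr fun i => ?_
  rw [← h i, ← h' (γ - i), map_sub]
  rfl

theorem HahnRel.add {σ : Γ ≃+ Γ} {x y x' y' : HahnSeries Γ R} (h : HahnRel σ x y)
    (h' : HahnRel σ x' y') : HahnRel σ (x + x') (y + y') := fun γ => by
  rw [HahnSeries.coeff_add, HahnSeries.coeff_add, h, h']

theorem HahnRel.sub {σ : Γ ≃+ Γ} {x y x' y' : HahnSeries Γ R} (h : HahnRel σ x y)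
    (h' : HahnRel σ x' y') : HahnRel σ (x - x') (y - y') := fun γ => by
  rw [HahnSeries.coeff_sub, HahnSeries.coeff_sub, h, h']

theorem HahnRel.single {σ : Γ ≃+ Γ} {a b : Γ} (h : σ b = a) (c : R) :
    HahnRel σ (HahnSeries.single a c) (HahnSeries.single b c) := by
  classical
  intro γ
  rw [HahnSeries.coeff_single, HahnSeries.coeff_single, ← h, σ.injective.eq_iff]

theorem HahnRel.C (σ : Γ ≃+ Γ) (c : R) :
    HahnRel σ (HahnSeries.C c : HahnSeries Γ R) (HahnSeries.C c) :=
  HahnRel.single (map_zero σ) c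

theorem HahnRel.one (σ : Γ ≃+ Γ) : HahnRel σ (1 : HahnSeries Γ R) 1 := HahnRel.C σ 1

theorem HahnRel.zero (σ : Γ ≃+ Γ) : HahnRel σ (0 : HahnSeries Γ R) 0 := fun _ => rfl

theorem HahnRel.prod {ι : Type*} (s : Finset ι) {σ : Γ ≃+ Γ} {x y : ι → HahnSeries Γ R}
    (h : ∀ i ∈ s, HahnRel σ (x i) (y i)) : HahnRel σ (∏ i ∈ s, x i) (∏ i ∈ s, y i) := by
  classical
  induction s using Finset.induction_on with
  | empty => exact HahnRel.one σ
  | insert i s hi ih =>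
    rw [prod_insert hi, prod_insert hi]
    exact (h i (mem_insert_self i s)).mul (ih fun j hj => h j (mem_insert_of_mem hj))

theorem HahnRel.sum {ι : Type*} (s : Finset ι) {σ : Γ ≃+ Γ} {x y : ι → HahnSeries Γ R}
    (h : ∀ i ∈ s, HahnRel σ (x i) (y i)) : HahnRel σ (∑ i ∈ s, x i) (∑ i ∈ s, y i) := by
  classical
  induction s using Finset.induction_on with
  | empty => exact HahnRel.zero σ
  | insert i s hi ih =>
    rw [sum_insert hi, sum_insert hi]
    exact (h i (mem_insert_self i s)).add (ih fun j hj => h j (mem_insert_of_mem hj))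

theorem HahnRel.powAlong {σ : Γ ≃+ Γ} {a b : Γ} (ha : 0 < a) (hb : 0 < b) (h : σ b = a)
    (f : PowerSeries R) : HahnRel σ (powAlong ha f) (powAlong hb f) := by
  intro γ
  have he : ∀ n, expMul a n = σ (expMul b n) := fun n => by
    rw [← h]; exact (map_nsmul σ n b).symm
  by_cases hγ : ∃ n : ℕ, expMul b n = γ
  · obtain ⟨n, rfl⟩ := hγ
    rw [coeff_powAlong_nsmul, ← he, coeff_powAlong_nsmul]
  · push Not at hγ
    rw [coeff_powAlong_of_notMem hb f hγ, coeff_powAlong_of_notMem ha]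
    intro n hn
    rw [he] at hn
    exact hγ n (σ.injective hn)

end HahnRel

/-! ### Derivations applied to coefficients -/

section HahnDer

set_option linter.unusedSectionVars false

variable {Γ : Type*} [AddCommGroup Γ] [LinearOrder Γ] [IsOrderedAddMonoid Γ]
variable {k R : Type*} [CommRing k] [CommRing R] [Algebra k R]

/-- A derivation applied to the coefficients of a Hahn series. -/
def hahnDer (D : Derivation k R R) (x : HahnSeries Γ R) : HahnSeries Γ R := x.map D

theorem hahnDer_coeff (D : Derivation k R R) (x : HahnSeries Γ R) (a : Γ) :
    (hahnDer D x).coeff a = D (x.coeff a) := by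
  rw [hahnDer, HahnSeries.map_coeff]

theorem hahnDer_add (D : Derivation k R R) (x y : HahnSeries Γ R) :
    hahnDer D (x + y) = hahnDer D x + hahnDer D y := by
  ext a
  simp only [hahnDer_coeff, HahnSeries.coeff_add, map_add]

theorem hahnDer_mul (D : Derivation k R R) (x y : HahnSeries Γ R) :
    hahnDer D (x * y) = hahnDer D x * y + x * hahnDer D y := by
  ext a
  rw [hahnDer_coeff, HahnSeries.coeff_add, hahn_coeff_mul, hahn_coeff_mul, hahn_coeff_mul]
  have h1 := hahn_finite_support_mul (hahnDer D x) y a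
  have h2 := hahn_finite_support_mul x (hahnDer D y) a
  rw [← finsum_add_distrib h1 h2]
  have h3 := AddMonoidHom.map_finsum (D : R →ₗ[k] R).toAddMonoidHom
    (hahn_finite_support_mul x y a)
  refine h3.trans (finsum_congr fun i => ?_)
  rw [hahnDer_coeff, hahnDer_coeff]
  change D _ = _
  rw [Derivation.leibniz, smul_eq_mul, smul_eq_mul]
  ring

theorem hahnDer_single (D : Derivation k R R) (a : Γ) (c : R) :
    hahnDer D (HahnSeries.single a c) = HahnSeries.single a (D c) := by
  classical
  ext b
  rw [hahnDer_coeff, HahnSeries.coeff_single, HahnSeries.coeff_single]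
  split_ifs
  · rfl
  · exact map_zero D

theorem hahnDer_sum {ι : Type*} (s : Finset ι) (D : Derivation k R R) (x : ι → HahnSeries Γ R) :
    hahnDer D (∑ i ∈ s, x i) = ∑ i ∈ s, hahnDer D (x i) := by
  ext a
  simp only [hahnDer_coeff, HahnSeries.coeff_sum, map_sum]

theorem hahnDer_prod {ι : Type*} (s : Finset ι) (D : Derivation k R R)
    {x u : ι → HahnSeries Γ R} (h : ∀ i ∈ s, hahnDer D (x i) = u i * x i) :
    hahnDer D (∏ i ∈ s, x i) = (∑ i ∈ s, u i) * ∏ i ∈ s, x i := by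
  classical
  induction s using Finset.induction_on with
  | empty =>
    rw [prod_empty, sum_empty, zero_mul]
    ext a
    rw [hahnDer_coeff, HahnSeries.coeff_one, HahnSeries.coeff_zero]
    split_ifs
    · exact D.map_one_eq_zero
    · exact map_zero D
  | insert i s hi ih =>
    rw [prod_insert hi, sum_insert hi, hahnDer_mul, h i (mem_insert_self i s),
      ih fun j hj => h j (mem_insert_of_mem hj)]
    ring

/-- A derivation applied to the coefficients of a power series. -/
def seriesDer (D : Derivation k R R) (F : PowerSeries R) : PowerSeries R :=
  PowerSeries.mk fun n => D (PowerSeries.coeff n F)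

theorem coeff_seriesDer (D : Derivation k R R) (F : PowerSeries R) (n : ℕ) :
    PowerSeries.coeff n (seriesDer D F) = D (PowerSeries.coeff n F) := PowerSeries.coeff_mk _ _

theorem seriesDer_mul (D : Derivation k R R) (F G : PowerSeries R) :
    seriesDer D (F * G) = seriesDer D F * G + F * seriesDer D G := by
  ext n
  rw [coeff_seriesDer, map_add, PowerSeries.coeff_mul, PowerSeries.coeff_mul,
    PowerSeries.coeff_mul, map_sum, ← sum_add_distrib]
  refine sum_congr rfl fun p _ => ?_
  rw [coeff_seriesDer, coeff_seriesDer, Derivation.leibniz, smul_eq_mul, smul_eq_mul]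
  ring

theorem derivative_seriesDer (D : Derivation k R R) (F : PowerSeries R) :
    PowerSeries.derivative R (seriesDer D F) = seriesDer D (PowerSeries.derivative R F) := by
  ext n
  rw [PowerSeries.coeff_derivative, coeff_seriesDer, coeff_seriesDer, PowerSeries.coeff_derivative,
    Derivation.leibniz]
  have : D ((n : R) + 1) = 0 := by
    rw [map_add, Derivation.map_natCast, Derivation.map_one_eq_zero, add_zero]
  rw [this, smul_zero, zero_add, smul_eq_mul, mul_comm]

theorem hahnDer_powAlong (D : Derivation k R R) {g : Γ} (hg : 0 < g) (F : PowerSeries R) :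
    hahnDer D (powAlong hg F) = powAlong hg (seriesDer D F) := by
  refine eq_powAlong hg _ _ (fun n => ?_) fun a ha => ?_
  · rw [hahnDer_coeff, coeff_powAlong_nsmul, coeff_seriesDer]
  · rw [hahnDer_coeff, coeff_powAlong_of_notMem hg F ha, map_zero]

-- Heuristically F = exp ∫A, so D F = B F with B' = D A. To prove this, F + (D F - B F) is shown to
-- have the same logarithmic derivative and constant term as F, hence to equal F.
open PowerSeries in
theorem HasLogDeriv.seriesDer_eq [Algebra ℚ R] {A F G B : PowerSeries R} (D : Derivation k R R)
    (h : HasLogDeriv A F) (hB : seriesDer D A = derivative R B) (hB0 : constantCoeff B = 0)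
    (hG : G = B * F) : seriesDer D F = G := by
  have h1 : HasLogDeriv A (F + (seriesDer D F - G)) := by
    constructor
    · rw [map_add, map_sub, h.1, hG, map_mul, hB0, zero_mul, sub_zero,
        ← coeff_zero_eq_constantCoeff_apply, coeff_seriesDer, coeff_zero_eq_constantCoeff_apply,
        h.1, D.map_one_eq_zero, add_zero]
    · rw [map_add, map_sub, derivative_seriesDer, h.2, seriesDer_mul, hB, hG, Derivation.leibniz,
        h.2, smul_eq_mul, smul_eq_mul]
      ring
  have h2 := h1.unique h
  rw [add_eq_left] at h2
  exact sub_eq_zero.1 h2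

end HahnDer

/-! ### The scalar product -/

section ScalarProduct

attribute [local instance] isDomain_CQ noZeroDivisors_CQT charZero_CQT

/-- The square length of a monomial in the power sums. -/
def lengthFactor (k : ℕ+) (m : ℕ) : CQT :=
  ((k : ℕ) : CQT) ^ m * (m.factorial : CQT) * ((1 - qv ^ (k : ℕ)) / (1 - tv ^ (k : ℕ))) ^ m

theorem lengthFactor_zero (k : ℕ+) : lengthFactor k 0 = 1 := by simp [lengthFactor]

theorem scalarProd_eq_sum (f g : SymFun) {s : Finset (ℕ+ →₀ ℕ)} (hs : f.support ⊆ s) :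
    scalarProd f g = ∑ d ∈ s, MvPolynomial.coeff d f * MvPolynomial.coeff d g *
      d.prod lengthFactor := by
  refine sum_subset hs fun d _ hd => ?_
  rw [MvPolynomial.notMem_support_iff.1 hd, zero_mul, zero_mul]

theorem scalarProd_comm (f g : SymFun) : scalarProd f g = scalarProd g f := by
  classical
  rw [scalarProd_eq_sum f g (subset_union_left (s₂ := g.support)),
    scalarProd_eq_sum g f (subset_union_right (s₁ := f.support))]
  exact sum_congr rfl fun d _ => by rw [mul_comm (MvPolynomial.coeff d f)]

/-- The scalar product with a fixed symmetric function. -/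
def scalarWith (f : SymFun) : SymFun →ₗ[CQT] CQT where
  toFun g := scalarProd f g
  map_add' g h := by
    simp only [scalarProd, ← sum_add_distrib]
    refine sum_congr rfl fun d _ => ?_
    rw [MvPolynomial.coeff_add, mul_add, add_mul]
  map_smul' c g := by
    simp only [scalarProd, smul_eq_mul, RingHom.id_apply, mul_sum]
    refine sum_congr rfl fun d _ => ?_
    rw [MvPolynomial.coeff_smul, smul_eq_mul]
    ring

theorem scalarWith_apply (f g : SymFun) : scalarWith f g = scalarProd f g := rfl

theorem scalarWith_comm (f g : SymFun) : scalarWith f g = scalarWith g f := scalarProd_comm f g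

theorem scalarWith_monomial (f : SymFun) (d : ℕ+ →₀ ℕ) (c : CQT) :
    scalarWith f (MvPolynomial.monomial d c) = MvPolynomial.coeff d f * c * d.prod lengthFactor := by
  classical
  rw [scalarWith_apply, scalarProd_eq_sum f _ (subset_insert d f.support),
    Finset.sum_eq_single_of_mem d (mem_insert_self _ _)]
  · rw [MvPolynomial.coeff_monomial, if_pos rfl]
  · intro e _ he
    rw [MvPolynomial.coeff_monomial, if_neg (Ne.symm he), mul_zero, zero_mul]

theorem qv_pow_injective : Function.Injective fun k : ℕ => qv ^ k := by
  intro a b h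
  have h1 : (RatFunc.C ((RatFunc.X : CQ) ^ a) : CQT) = RatFunc.C ((RatFunc.X : CQ) ^ b) := by
    rw [map_pow, map_pow]; exact h
  have h2 : (RatFunc.X : CQ) ^ a = RatFunc.X ^ b := (RatFunc.C : CQ →+* CQT).injective h1
  have h3 : ∀ n, (RatFunc.X : CQ) ^ n =
      algebraMap (Polynomial ℂ) CQ (Polynomial.X ^ n) := fun n => by
    rw [map_pow, RatFunc.algebraMap_X]
  rw [h3, h3] at h2
  have h4 := RatFunc.algebraMap_injective ℂ h2
  have := congrArg Polynomial.natDegree h4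
  simpa using this

theorem one_sub_qv_pow_ne_zero {k : ℕ} (hk : 0 < k) : 1 - qv ^ k ≠ 0 := by
  intro h
  have h1 : qv ^ 0 = qv ^ k := by rw [pow_zero]; exact sub_eq_zero.1 h
  exact hk.ne (qv_pow_injective h1)

theorem one_sub_tv_pow_ne_zero {k : ℕ} (hk : 0 < k) : 1 - tv ^ k ≠ 0 := by
  rw [← neg_sub]
  exact neg_ne_zero.2 (tv_pow_sub_one_ne_zero k hk)

theorem lengthFactor_ne_zero (k : ℕ+) (m : ℕ) : lengthFactor k m ≠ 0 :=
  mul_ne_zero (mul_ne_zero (pow_ne_zero _ (Nat.cast_ne_zero.2 k.ne_zero))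
    (Nat.cast_ne_zero.2 m.factorial_ne_zero))
    (pow_ne_zero _ (div_ne_zero (one_sub_qv_pow_ne_zero k.pos) (one_sub_tv_pow_ne_zero k.pos)))

theorem scalarWith_nondegenerate {f : SymFun} (h : scalarWith f = 0) : f = 0 := by
  ext d
  have h1 := LinearMap.congr_fun h (MvPolynomial.monomial d 1)
  rw [scalarWith_monomial, mul_one, LinearMap.zero_apply] at h1
  rw [MvPolynomial.coeff_zero]
  exact (mul_eq_zero.1 h1).resolve_right
    (prod_ne_zero_field (k := CQT) fun k _ => lengthFactor_ne_zero k _)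

/-- The constant `k (1 - q^k) / (1 - t^k)`. -/
def perpConst (k : ℕ+) : CQT := ((k : ℕ) : CQT) * ((1 - qv ^ (k : ℕ)) / (1 - tv ^ (k : ℕ)))

/-- The adjoint of the multiplication by a power sum. -/
def perp (k : ℕ+) : Derivation CQT SymFun SymFun := perpConst k • MvPolynomial.pderiv k

theorem perp_apply (k : ℕ+) (f : SymFun) : perp k f = perpConst k • MvPolynomial.pderiv k f := rfl

theorem lengthFactor_succ (k : ℕ+) (m : ℕ) :
    lengthFactor k (m + 1) = perpConst k * ((m + 1 : ℕ) : CQT) * lengthFactor k m := by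
  rw [lengthFactor, lengthFactor, perpConst, Nat.factorial_succ, pow_succ, pow_succ, Nat.cast_mul]
  ring

theorem prod_lengthFactor_add_single (d : ℕ+ →₀ ℕ) (k : ℕ+) :
    (d + Finsupp.single k 1).prod lengthFactor =
      perpConst k * ((d k + 1 : ℕ) : CQT) * d.prod lengthFactor := by
  classical
  have h1 : ∀ e : ℕ+ →₀ ℕ, e.support ⊆ insert k d.support →
      e.prod lengthFactor = lengthFactor k (e k) *
        ∏ i ∈ (insert k d.support).erase k, lengthFactor i (e i) := by
    intro e he
    rw [Finsupp.prod_of_support_subset e he _ fun i _ => lengthFactor_zero i,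
      ← mul_prod_erase _ _ (mem_insert_self k d.support)]
  rw [h1 d (subset_insert _ _), h1 (d + Finsupp.single k 1)]
  · rw [Finsupp.add_apply, Finsupp.single_eq_same, lengthFactor_succ, mul_assoc, mul_assoc,
      mul_assoc]
    congr 3
    refine prod_congr rfl fun i hi => ?_
    rw [Finsupp.add_apply, Finsupp.single_apply, if_neg (Ne.symm (ne_of_mem_erase hi)), add_zero]
  · refine Finsupp.support_add.trans (union_subset (subset_insert _ _) fun i hi => ?_)
    have := Finsupp.support_single_subset hi
    rw [mem_singleton] at this
    rw [this]
    exact mem_insert_self _ _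

/-- On monomials this is the ratio of the square lengths of p_k p_d and p_d, computed in
`prod_lengthFactor_add_single`. -/
theorem scalarWith_X_mul (k : ℕ+) (f g : SymFun) :
    scalarWith (MvPolynomial.X k * f) g = scalarWith f (perp k g) := by
  classical
  induction g using MvPolynomial.induction_on' with
  | monomial e c =>
    rw [scalarWith_monomial, perp_apply, map_smul, MvPolynomial.pderiv_monomial,
      scalarWith_monomial, mul_comm (MvPolynomial.X k), MvPolynomial.coeff_mul_X']
    split_ifs with h
    · have he : e = (e - Finsupp.single k 1) + Finsupp.single k 1 :=
        (tsub_add_cancel_of_le (Finsupp.single_le_iff.2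
          (Nat.one_le_iff_ne_zero.2 (Finsupp.mem_support_iff.1 h)))).symm
      set d := e - Finsupp.single k 1 with hd
      have hek : e k = d k + 1 := by rw [he, Finsupp.add_apply, Finsupp.single_eq_same]
      rw [hek, he, prod_lengthFactor_add_single, smul_eq_mul]
      ring
    · rw [Finsupp.notMem_support_iff.1 h]
      simp
  | add g h hg hh => rw [map_add, map_add, map_add, hg, hh]

end ScalarProduct

/-! ### Self-adjointness of vertex operators -/

section SelfAdjoint

attribute [local instance] isDomain_CQ noZeroDivisors_CQT charZero_CQT

theorem perp_X (k l : ℕ+) : perp k (MvPolynomial.X l) =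
    if k = l then (MvPolynomial.C (perpConst k) : SymFun) else 0 := by
  classical
  rw [perp_apply, MvPolynomial.pderiv_X]
  by_cases h : k = l
  · subst h
    rw [if_pos rfl, Pi.single_eq_same, MvPolynomial.smul_eq_C_mul, mul_one]
  · rw [if_neg h, Pi.single_eq_of_ne (Ne.symm h), smul_zero]

/-- The factor t⁻ᵏ, from (1 - t⁻ᵏ)/(1 - tᵏ) = -t⁻ᵏ, is the source of the power of t in
`CoeffAdjoint`. -/
theorem perpConst_mul (k : ℕ+) : perpConst k * (1 - tv⁻¹ ^ (k : ℕ)) =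
    -(1 - qv ^ (k : ℕ)) * tv⁻¹ ^ (k : ℕ) * (k : ℕ) := by
  have h1 := one_sub_tv_pow_ne_zero k.pos
  have h2 : tv ^ (k : ℕ) ≠ 0 := pow_ne_zero _ tv_ne_zero
  rw [perpConst, inv_pow]
  field_simp
  ring

theorem seriesDer_creationSeries (k : ℕ+) : seriesDer (perp k) creationSeries =
    PowerSeries.C (MvPolynomial.C (-(1 - qv ^ (k : ℕ)) * tv⁻¹ ^ (k : ℕ)) : SymFun) *
      PowerSeries.X ^ (k : ℕ) * creationSeries := by
  refine hasLogDeriv_creationSeries.seriesDer_eq (perp k)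
    (B := PowerSeries.C (MvPolynomial.C (-(1 - qv ^ (k : ℕ)) * tv⁻¹ ^ (k : ℕ)) : SymFun) *
      PowerSeries.X ^ (k : ℕ)) ?_ ?_ rfl
  · ext1 n
    rw [coeff_seriesDer, PowerSeries.coeff_mk, PowerSeries.coeff_derivative, PowerSeries.coeff_C_mul,
      PowerSeries.coeff_X_pow, Derivation.leibniz, perp_X, ← MvPolynomial.algebraMap_eq,
      Derivation.map_algebraMap, smul_zero, add_zero]
    by_cases h : k = n.succPNat
    · rw [if_pos h, if_pos (by rw [h]; rfl), mul_one, MvPolynomial.algebraMap_eq, smul_eq_mul,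
        ← map_mul, mul_comm]
      have h1 := perpConst_mul k
      have h2 : (k : ℕ) = n + 1 := by rw [h]; rfl
      rw [h2] at h1 ⊢
      rw [h1, map_mul, map_natCast, Nat.cast_succ]
    · rw [if_neg h, if_neg, smul_zero, mul_zero, zero_mul]
      intro h'
      exact h (PNat.coe_injective h'.symm)
  · rw [map_mul, map_pow, PowerSeries.constantCoeff_X, zero_pow k.ne_zero, mul_zero]

/-- The series `exp(…) exp(…) f` of which a vertex operator takes a constant term. -/
def vertexSeries (r : ℕ) (f : SymFun) : HahnSeries (Expo r) SymFun := creation r * annihilation r f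

theorem hahnDer_creation (r : ℕ) (k : ℕ+) : hahnDer (perp k) (creation r) =
    (∑ α : Fin r, HahnSeries.single (expoSingle α ((k : ℕ) : ℤ))
      (MvPolynomial.C (-(1 - qv ^ (k : ℕ)) * tv⁻¹ ^ (k : ℕ)) : SymFun)) * creation r := by
  refine hahnDer_prod univ (perp k) fun α _ => ?_
  rw [inVariable_eq_powAlong, hahnDer_powAlong, seriesDer_creationSeries, map_mul, map_mul,
    powAlong_C, map_pow, powAlong_X, HahnSeries.single_pow, one_pow, HahnSeries.C_apply,
    HahnSeries.single_mul_single, zero_add, mul_one]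
  congr 2
  refine congrArg (fun a : Expo r => (HahnSeries.single a : ZeroHom SymFun _)) ?_
  exact (expMul_expoSingle α k 1).trans (by rw [mul_one])

/-- A translation by constants commutes with a constant-coefficient derivation. -/
theorem hahnDer_annihilation (r : ℕ) (k : ℕ+) (f : SymFun) :
    hahnDer (perp k) (annihilation r f) = annihilation r (perp k f) := by
  induction f using MvPolynomial.induction_on with
  | C a =>
    rw [← MvPolynomial.algebraMap_eq, AlgHom.commutes, Derivation.map_algebraMap, map_zero,
      algebraMap_hahn, HahnSeries.C_apply, hahnDer_single, Derivation.map_algebraMap,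
      HahnSeries.single_eq_zero]
  | add f g hf hg => rw [map_add, hahnDer_add, hf, hg, map_add, map_add]
  | mul_X f l hf =>
    have hX : hahnDer (perp k) (annihilation r (MvPolynomial.X l)) =
        annihilation r (perp k (MvPolynomial.X l)) := by
      have h0 : ∀ c : CQT, perp k (MvPolynomial.C c) = 0 := fun c => by
        rw [← MvPolynomial.algebraMap_eq, Derivation.map_algebraMap]
      rw [annihilation_eq_translation, translation_X, sub_eq_add_neg, hahnDer_add,
        ← sum_neg_distrib, hahnDer_sum, HahnSeries.C_apply, hahnDer_single, perp_X]
      have h1 : ∑ α : Fin r, hahnDer (perp k) (-HahnSeries.single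
          (expoSingle α (-((l : ℕ) : ℤ))) (algebraMap CQT SymFun (1 - qv ^ (l : ℕ)))) = 0 := by
        refine sum_eq_zero fun α _ => ?_
        rw [← HahnSeries.single_neg, hahnDer_single, map_neg, Derivation.map_algebraMap, neg_zero,
          HahnSeries.single_eq_zero]
      rw [h1, add_zero]
      by_cases h : k = l
      · rw [if_pos h, ← MvPolynomial.algebraMap_eq, AlgHom.commutes, algebraMap_hahn,
          HahnSeries.C_apply]
      · rw [if_neg h, HahnSeries.single_eq_zero, map_zero]
    rw [map_mul, hahnDer_mul, hf, hX, Derivation.leibniz, smul_eq_mul, smul_eq_mul, map_add,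
      map_mul, map_mul]
    ring

theorem vertexSeries_X_mul_coeff (r : ℕ) (k : ℕ+) (f : SymFun) (γ : Expo r) :
    (vertexSeries r (MvPolynomial.X k * f)).coeff γ =
      MvPolynomial.X k * (vertexSeries r f).coeff γ -
        (1 - qv ^ (k : ℕ)) • ∑ α : Fin r, (vertexSeries r f).coeff (γ + expoSingle α (k : ℕ)) := by
  have h1 : vertexSeries r (MvPolynomial.X k * f) =
      HahnSeries.C (MvPolynomial.X k) * vertexSeries r f -
        ∑ α : Fin r, HahnSeries.single (expoSingle α (-((k : ℕ) : ℤ)))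
          (MvPolynomial.C (1 - qv ^ (k : ℕ))) * vertexSeries r f := by
    rw [vertexSeries, map_mul, annihilation_eq_translation, translation_X, ← sum_mul,
      MvPolynomial.algebraMap_eq, vertexSeries, annihilation_eq_translation]
    ring
  rw [h1, HahnSeries.coeff_sub, hahn_coeff_C_mul, HahnSeries.coeff_sum, smul_sum]
  congr 1
  refine sum_congr rfl fun α _ => ?_
  have h2 : γ = (γ + expoSingle α (k : ℕ)) + expoSingle α (-((k : ℕ) : ℤ)) := by
    rw [add_assoc, ← expoSingle_add, add_neg_cancel, expoSingle_zero, add_zero]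
  conv_lhs => rw [h2, HahnSeries.coeff_single_mul_add]
  rw [MvPolynomial.smul_eq_C_mul]

/-- Together with `vertexSeries_X_mul_coeff` this describes how p_k and its adjoint pass through the
vertex series. Up to t⁻ᵏ the two relations are exchanged by inverting the variables. -/
theorem perp_vertexSeries_coeff (r : ℕ) (k : ℕ+) (f : SymFun) (γ : Expo r) :
    perp k ((vertexSeries r f).coeff γ) = (vertexSeries r (perp k f)).coeff γ -
      ((1 - qv ^ (k : ℕ)) * tv⁻¹ ^ (k : ℕ)) •
        ∑ α : Fin r, (vertexSeries r f).coeff (γ - expoSingle α (k : ℕ)) := by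
  have h1 : hahnDer (perp k) (vertexSeries r f) = vertexSeries r (perp k f) +
      ∑ α : Fin r, HahnSeries.single (expoSingle α ((k : ℕ) : ℤ))
        (MvPolynomial.C (-(1 - qv ^ (k : ℕ)) * tv⁻¹ ^ (k : ℕ)) : SymFun) * vertexSeries r f := by
    rw [vertexSeries, hahnDer_mul, hahnDer_creation, hahnDer_annihilation, ← sum_mul, vertexSeries]
    ring
  rw [← hahnDer_coeff, h1, HahnSeries.coeff_add, HahnSeries.coeff_sum, smul_sum,
    eq_sub_iff_add_eq, add_assoc, ← sum_add_distrib, sum_eq_zero, add_zero]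
  intro α _
  have h2 : (HahnSeries.single (expoSingle α ((k : ℕ) : ℤ))
      (MvPolynomial.C (-(1 - qv ^ (k : ℕ)) * tv⁻¹ ^ (k : ℕ)) : SymFun) * vertexSeries r f).coeff γ =
      MvPolynomial.C (-(1 - qv ^ (k : ℕ)) * tv⁻¹ ^ (k : ℕ)) *
        (vertexSeries r f).coeff (γ - expoSingle α (k : ℕ)) := by
    conv_lhs => rw [← sub_add_cancel γ (expoSingle α ((k : ℕ) : ℤ)),
      HahnSeries.coeff_single_mul_add]
  rw [h2, neg_mul, map_neg, MvPolynomial.smul_eq_C_mul]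
  ring

/-- The total degree of an exponent. -/
def expoDeg (r : ℕ) : Expo r →+ ℤ where
  toFun γ := ∑ α, ofLex γ α
  map_zero' := sum_eq_zero fun _ _ => rfl
  map_add' a b := by rw [← sum_add_distrib]; rfl

theorem expoDeg_single {r : ℕ} (α : Fin r) (n : ℤ) : expoDeg r (expoSingle α n) = n := by
  change ∑ β, Pi.single (M := fun _ : Fin r => ℤ) α n β = n
  rw [Finset.sum_pi_single']
  simp

theorem scalarWith_one (f : SymFun) : scalarWith 1 f = MvPolynomial.coeff 0 f := by
  rw [scalarWith_comm, ← MvPolynomial.C_1, MvPolynomial.C_apply, scalarWith_monomial]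
  simp

theorem coeff_zero_creation (r : ℕ) (γ : Expo r) :
    MvPolynomial.coeff 0 ((creation r).coeff γ) = if γ = 0 then 1 else 0 := by
  have h1 : MvPolynomial.coeff 0 ((creation r).coeff γ) =
      (hahnMap (MvPolynomial.constantCoeff : SymFun →+* CQT) (creation r)).coeff γ := rfl
  have h2 : creationSeries.map (MvPolynomial.constantCoeff : SymFun →+* CQT) = 1 := by
    refine map_creationSeries_eq _ (0 : PowerSeries CQT) _ HasLogDeriv.one fun n => ?_
    rw [MvPolynomial.constantCoeff_X, mul_zero, map_zero]
  rw [h1, creation_eq_seriesProd, hahnMap_seriesProd, h2, seriesProd]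
  simp only [map_one, prod_const_one]
  rw [HahnSeries.coeff_one]
  split_ifs <;> rfl

/-- The adjointness of the coefficients of vertex operators. -/
def CoeffAdjoint (r : ℕ) (f g : SymFun) : Prop :=
  ∀ γ : Expo r, scalarWith ((vertexSeries r f).coeff γ) g =
    tv ^ (-expoDeg r γ) * scalarWith ((vertexSeries r g).coeff (-γ)) f

theorem CoeffAdjoint.symm {r : ℕ} {f g : SymFun} (h : CoeffAdjoint r f g) : CoeffAdjoint r g f := by
  intro γ
  rw [h (-γ), neg_neg, map_neg, neg_neg, ← mul_assoc, ← zpow_add₀ tv_ne_zero, neg_add_cancel,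
    zpow_zero, one_mul]

/-- On one side p_k is commuted through the series and moved to g as its adjoint; on the other the
adjoint is commuted through. The shifted terms match because raising the degree by k costs exactly
t⁻ᵏ. -/
theorem CoeffAdjoint.X_mul {r : ℕ} {k : ℕ+} {f g : SymFun} (h : CoeffAdjoint r f g)
    (h' : CoeffAdjoint r f (perp k g)) : CoeffAdjoint r (MvPolynomial.X k * f) g := by
  intro γ
  rw [vertexSeries_X_mul_coeff, scalarWith_comm _ g, map_sub, map_smul, map_sum,
    scalarWith_comm g, scalarWith_X_mul, h' γ, scalarWith_comm _ (MvPolynomial.X k * f),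
    scalarWith_X_mul, perp_vertexSeries_coeff, map_sub, map_smul, map_sum, scalarWith_comm f,
    mul_sub, smul_eq_mul, smul_eq_mul, ← mul_assoc, mul_sum, mul_sum]
  congr 1
  refine sum_congr rfl fun α _ => ?_
  rw [scalarWith_comm, h (γ + expoSingle α (k : ℕ)), map_add, expoDeg_single, neg_add,
    zpow_add₀ tv_ne_zero, zpow_neg tv ((k : ℕ) : ℤ), zpow_natCast, inv_pow, neg_add',
    scalarWith_comm f]
  ring

theorem CoeffAdjoint.C_right {r : ℕ} {f : SymFun} (h : CoeffAdjoint r f 1) (c : CQT) :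
    CoeffAdjoint r f (MvPolynomial.C c) := by
  have hv : vertexSeries r (MvPolynomial.C c) =
      HahnSeries.C (MvPolynomial.C c) * vertexSeries r 1 := by
    rw [vertexSeries, vertexSeries, map_one, mul_one, ← MvPolynomial.algebraMap_eq,
      AlgHom.commutes, algebraMap_hahn, mul_comm]
  intro γ
  have h1 := h γ
  rw [hv, hahn_coeff_C_mul, ← MvPolynomial.smul_eq_C_mul, scalarWith_comm _ f, map_smul,
    scalarWith_comm f, ← mul_one (MvPolynomial.C c), ← MvPolynomial.smul_eq_C_mul, map_smul, h1,
    smul_eq_mul, smul_eq_mul]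
  ring

theorem CoeffAdjoint.add_right {r : ℕ} {f g g' : SymFun} (h : CoeffAdjoint r f g)
    (h' : CoeffAdjoint r f g') : CoeffAdjoint r f (g + g') := by
  intro γ
  have hv : vertexSeries r (g + g') = vertexSeries r g + vertexSeries r g' := by
    rw [vertexSeries, map_add, mul_add]; rfl
  rw [hv, HahnSeries.coeff_add, map_add, h γ, h' γ, scalarWith_comm (_ + _) f, map_add,
    scalarWith_comm f, scalarWith_comm f, mul_add]

theorem coeffAdjoint_of_one {r : ℕ} (h : ∀ f : SymFun, CoeffAdjoint r f 1) (f g : SymFun) :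
    CoeffAdjoint r f g := by
  induction g using MvPolynomial.induction_on generalizing f with
  | C c => exact (h f).C_right c
  | add g g' hg hg' => exact (hg f).add_right (hg' f)
  | mul_X g k hg =>
    rw [mul_comm]
    exact ((hg f).symm.X_mul (hg (perp k f)).symm).symm

/-- The adjoint of p_k kills 1, so peeling power sums off g reduces everything to g = 1. There only
constant terms of the creation part occur, and they vanish for γ ≠ 0. -/
theorem coeffAdjoint_one (r : ℕ) (g : SymFun) : CoeffAdjoint r 1 g := by
  have h11 : CoeffAdjoint r 1 1 := by
    intro γ
    rw [scalarWith_comm, scalarWith_one, scalarWith_comm, scalarWith_one, vertexSeries, map_one,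
      mul_one, coeff_zero_creation, coeff_zero_creation]
    by_cases h : γ = 0
    · rw [if_pos h, if_pos (by rw [h, neg_zero]), h, map_zero, neg_zero, zpow_zero, one_mul]
    · rw [if_neg h, if_neg (by rwa [neg_eq_zero]), mul_zero]
  induction g using MvPolynomial.induction_on with
  | C c => exact h11.C_right c
  | add g g' hg hg' => exact hg.add_right hg'
  | mul_X g k hg =>
    rw [mul_comm]
    refine (hg.symm.X_mul ?_).symm
    rw [Derivation.map_one_eq_zero, ← MvPolynomial.C_0]
    exact hg.symm.C_right 0

theorem coeffAdjoint (r : ℕ) (f g : SymFun) : CoeffAdjoint r f g :=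
  coeffAdjoint_of_one (fun f => (coeffAdjoint_one r f).symm) f g

end SelfAdjoint

/-! ### Symmetry of the kernel and self-adjointness of the modified Macdonald operators -/

section SelfAdjointKernel

attribute [local instance] isDomain_CQ noZeroDivisors_CQT charZero_CQT

/-- The reversal of the order of the variables. -/
def expoRev (r : ℕ) : Expo r ≃+ Expo r where
  toFun γ := toLex fun i => ofLex γ (Fin.rev i)
  invFun γ := toLex fun i => ofLex γ (Fin.rev i)
  left_inv γ := by
    refine congrArg toLex (funext fun i => ?_)
    change ofLex γ (Fin.rev (Fin.rev i)) = ofLex γ i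
    rw [Fin.rev_rev]
  right_inv γ := by
    refine congrArg toLex (funext fun i => ?_)
    change ofLex γ (Fin.rev (Fin.rev i)) = ofLex γ i
    rw [Fin.rev_rev]
  map_add' _ _ := rfl

theorem expoRev_single {r : ℕ} (α : Fin r) (n : ℤ) :
    expoRev r (expoSingle (Fin.rev α) n) = expoSingle α n := by
  refine congrArg toLex (funext fun i => ?_)
  change Pi.single (M := fun _ : Fin r => ℤ) (Fin.rev α) n (Fin.rev i) =
    Pi.single (M := fun _ : Fin r => ℤ) α n i
  rw [Pi.single_apply, Pi.single_apply]
  exact if_congr Fin.rev_inj rfl rfl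

/-- The inversion of all variables, followed by the reversal of their order. -/
def expoNegRev (r : ℕ) : Expo r ≃+ Expo r := (expoRev r).trans (AddEquiv.neg _)

theorem expoNegRev_apply {r : ℕ} (γ : Expo r) : expoNegRev r γ = -expoRev r γ := rfl

theorem expoNegRev_pair {r : ℕ} (α β : Fin r) :
    expoNegRev r (expoPair (Fin.rev β) (Fin.rev α)) = expoPair α β := by
  rw [expoNegRev_apply, expoPair, map_add, expoRev_single, expoRev_single, neg_add, neg_expoSingle,
    neg_expoSingle, neg_neg, expoPair, add_comm]

/-- Inversion turns z_α/z_β into z_β/z_α, and reversal restores the order of the indices, so the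
factors are merely permuted. -/
theorem hahnRel_pairKernel {R : Type*} [CommRing R] (c : R) (r : ℕ) :
    HahnRel (expoNegRev r) (pairKernel c r) (pairKernel c r) := by
  have h1 : HahnRel (expoNegRev r) (pairKernel c r)
      (∏ β : Fin r, ∏ α : Fin r, pairFactor c (Fin.rev β) (Fin.rev α)) := by
    refine HahnRel.prod _ fun β _ => HahnRel.prod _ fun α _ => ?_
    by_cases h : α < β
    · rw [pairFactor, pairFactor, dif_pos h, dif_pos (Fin.rev_lt_rev.2 h)]
      exact HahnRel.powAlong _ _ (expoNegRev_pair α β) _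
    · rw [pairFactor, pairFactor, dif_neg h, dif_neg fun h' => h (Fin.rev_lt_rev.1 h')]
      exact HahnRel.one _
  have h2 : ∏ β : Fin r, ∏ α : Fin r, pairFactor c (Fin.rev β) (Fin.rev α) = pairKernel c r := by
    refine (Equiv.prod_comp Fin.revPerm fun β => ∏ α : Fin r, pairFactor c β (Fin.rev α)).trans ?_
    rw [pairKernel, prod_comm]
    exact Equiv.prod_comp Fin.revPerm (fun α => ∏ β : Fin r, pairFactor c β α)
  rwa [h2] at h1

theorem hahnRel_creation (r : ℕ) : HahnRel (expoRev r) (creation r) (creation r) := by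
  have h1 : HahnRel (expoRev r) (creation r)
      (∏ α : Fin r, inVariable (Fin.rev α) creationSeries) := by
    refine HahnRel.prod _ fun α _ => ?_
    rw [inVariable_eq_powAlong, inVariable_eq_powAlong]
    exact HahnRel.powAlong _ _ (expoRev_single α 1) _
  have h2 := Equiv.prod_comp Fin.revPerm fun α : Fin r => inVariable α creationSeries
  simp only [Fin.revPerm_apply] at h2
  rwa [h2] at h1

theorem hahnRel_annihilation (r : ℕ) (f : SymFun) :
    HahnRel (expoRev r) (annihilation r f) (annihilation r f) := by
  induction f using MvPolynomial.induction_on with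
  | C a =>
    rw [← MvPolynomial.algebraMap_eq, AlgHom.commutes, algebraMap_hahn]
    exact HahnRel.C _ _
  | add f g hf hg => rw [map_add]; exact hf.add hg
  | mul_X f k hf =>
    rw [map_mul]
    refine hf.mul ?_
    rw [annihilation_eq_translation, translation_X]
    refine (HahnRel.C _ _).sub ?_
    have h1 := HahnRel.sum (univ : Finset (Fin r)) (σ := expoRev r)
      (x := fun α => HahnSeries.single (expoSingle α (-((k : ℕ) : ℤ)))
        (algebraMap CQT SymFun (1 - qv ^ (k : ℕ))))
      (y := fun α => HahnSeries.single (expoSingle (Fin.rev α) (-((k : ℕ) : ℤ)))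
        (algebraMap CQT SymFun (1 - qv ^ (k : ℕ))))
      fun α _ => HahnRel.single (expoRev_single α _) _
    have h2 := Equiv.sum_comp Fin.revPerm fun α : Fin r => (HahnSeries.single
      (expoSingle α (-((k : ℕ) : ℤ))) (algebraMap CQT SymFun (1 - qv ^ (k : ℕ))) :
        HahnSeries (Expo r) SymFun)
    simp only [Fin.revPerm_apply] at h2
    rwa [h2] at h1

theorem hahnRel_vertexSeries (r : ℕ) (f : SymFun) :
    HahnRel (expoRev r) (vertexSeries r f) (vertexSeries r f) :=
  (hahnRel_creation r).mul (hahnRel_annihilation r f)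

theorem vertexOp_apply_eq_finsum (r : ℕ) (κ : HahnSeries (Expo r) CQT) (f : SymFun) :
    vertexOp r κ f = ∑ᶠ γ, κ.coeff γ • (vertexSeries r f).coeff (-γ) := by
  have h : vertexOp r κ f = (kernelSeries r κ * vertexSeries r f).coeff 0 := by
    rw [vertexSeries, ← mul_assoc]; rfl
  rw [h, hahn_coeff_mul]
  refine finsum_congr fun γ => ?_
  rw [zero_sub, MvPolynomial.smul_eq_C_mul, kernelSeries, HahnSeries.map_coeff]

theorem finite_support_vertexOp (r : ℕ) (κ : HahnSeries (Expo r) CQT) (f : SymFun) :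
    (Function.support fun γ => κ.coeff γ • (vertexSeries r f).coeff (-γ)).Finite := by
  refine (hahn_finite_support_mul (kernelSeries r κ) (vertexSeries r f) 0).subset fun γ hγ => ?_
  rw [Function.mem_support, zero_sub, kernelSeries, HahnSeries.map_coeff]
  rwa [Function.mem_support, MvPolynomial.smul_eq_C_mul] at hγ

/-- By `coeffAdjoint` the adjoint inverts the variables, up to a power of t that is trivial in
degree 0. The symmetry of κ undoes the inversion at the price of a reversal, which the vertex
series, symmetric in its variables, does not notice. -/
theorem scalarWith_vertexOp {r : ℕ} {κ : HahnSeries (Expo r) CQT}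
    (hσ : HahnRel (expoNegRev r) κ κ) (hdeg : ∀ γ, κ.coeff γ ≠ 0 → expoDeg r γ = 0)
    (f g : SymFun) : scalarWith (vertexOp r κ f) g = scalarWith f (vertexOp r κ g) := by
  have hlin : ∀ f g : SymFun, scalarWith g (vertexOp r κ f) =
      ∑ᶠ γ, κ.coeff γ * scalarWith g ((vertexSeries r f).coeff (-γ)) := by
    intro f g
    rw [vertexOp_apply_eq_finsum]
    refine (AddMonoidHom.map_finsum (scalarWith g).toAddMonoidHom
      (finite_support_vertexOp r κ f)).trans (finsum_congr fun γ => ?_)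
    exact (scalarWith g).map_smul _ _
  rw [scalarWith_comm, hlin, hlin, ← finsum_comp_equiv (expoNegRev r).toEquiv]
  refine finsum_congr fun γ => ?_
  change κ.coeff (expoNegRev r γ) * scalarWith g
    ((vertexSeries r f).coeff (-expoNegRev r γ)) = _
  rw [hσ γ, expoNegRev_apply, neg_neg, hahnRel_vertexSeries r f γ]
  by_cases h : κ.coeff γ = 0
  · rw [h, zero_mul, zero_mul]
  · rw [scalarWith_comm g, coeffAdjoint r f g γ, hdeg γ h, neg_zero, zpow_zero, one_mul,
      scalarWith_comm f]

/-- Every factor is a series in a ratio of two variables. -/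
theorem pairKernel_deg {R : Type*} [CommRing R] (c : R) (r : ℕ) (γ : Expo r)
    (h : (pairKernel c r).coeff γ ≠ 0) : expoDeg r γ = 0 := by
  have h1 : pairKernel c r ∈ hahnSupported R (AddMonoidHom.mker (expoDeg r)) := by
    refine Subring.prod_mem _ fun β _ => Subring.prod_mem _ fun α _ => ?_
    by_cases hαβ : α < β
    · rw [pairFactor, dif_pos hαβ]
      refine powAlong_mem_hahnSupported _ ?_ _
      rw [AddMonoidHom.mem_mker, expoPair, map_add, expoDeg_single, expoDeg_single, add_neg_cancel]
    · rw [pairFactor, dif_neg hαβ]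
      exact Subring.one_mem _
  exact mem_hahnSupported.1 h1 γ h

theorem scalarWith_tildeE (r : ℕ) (f g : SymFun) :
    scalarWith (vertexOp r (tildeKernel r) f) g =
      scalarWith f (vertexOp r (tildeKernel r) g) := by
  refine scalarWith_vertexOp ?_ (fun γ hγ => pairKernel_deg tv⁻¹ r γ fun h => hγ ?_) f g
  · exact (HahnRel.C _ _).mul (hahnRel_pairKernel _ _)
  · rw [tildeKernel, hahn_coeff_C_mul, h, mul_zero]

theorem IsTildeE.scalarWith_apply {r : ℕ} {T : Module.End CQT SymFun} (h : IsTildeE r T)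
    (f g : SymFun) : scalarWith (T f) g = scalarWith f (T g) := by
  rw [h.eq_vertexOp, scalarWith_tildeE]

end SelfAdjointKernel

/-! ### Triangular operators -/

section TriangularOperators

variable {K V ι : Type*} [Field K] [AddCommGroup V] [Module K V]

/-- The span of the basis vectors below an index. -/
def lowSpan (b : Module.Basis ι K V) (lt : ι → ι → Prop) (i : ι) : Submodule K V :=
  Submodule.span K (b '' {j | lt j i})

theorem mem_lowSpan {b : Module.Basis ι K V} {lt : ι → ι → Prop} {i : ι} {v : V} :
    v ∈ lowSpan b lt i ↔ ∀ j, b.repr v j ≠ 0 → lt j i := by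
  rw [lowSpan, Module.Basis.mem_span_image]
  exact ⟨fun h j hj => h (Finsupp.mem_support_iff.2 hj), fun h j hj =>
    h j (Finsupp.mem_support_iff.1 hj)⟩

theorem basis_mem_lowSpan {b : Module.Basis ι K V} {lt : ι → ι → Prop} {i j : ι} (h : lt j i) :
    b j ∈ lowSpan b lt i := Submodule.subset_span ⟨j, h, rfl⟩

theorem lowSpan_mono {b : Module.Basis ι K V} {lt : ι → ι → Prop}
    (htrans : ∀ i j k, lt i j → lt j k → lt i k) {i j : ι} (h : lt j i) :
    lowSpan b lt j ≤ lowSpan b lt i :=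
  Submodule.span_mono (Set.image_mono fun k hk => htrans k j i hk h)

theorem basis_mem_span_of_unitriangular {b : Module.Basis ι K V} {lt : ι → ι → Prop}
    (hwf : WellFounded lt) {p : ι → V} (S : Set ι) (hS : ∀ i j, lt j i → i ∈ S → j ∈ S)
    (hp : ∀ i ∈ S, p i - b i ∈ lowSpan b lt i) {i : ι} (hi : i ∈ S) :
    b i ∈ Submodule.span K (p '' S) := by
  induction i using hwf.induction with
  | _ i ih =>
    rw [← sub_sub_cancel (p i) (b i)]
    refine Submodule.sub_mem _ (Submodule.subset_span ⟨i, hi, rfl⟩) ?_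
    refine (Submodule.span_le.2 ?_ : lowSpan b lt i ≤ _) (hp i hi)
    rintro _ ⟨j, hj, rfl⟩
    exact ih j hj (hS i j hj hi)

/-- By induction the space below i is spanned by eigenvectors with eigenvalues other than a_i, so T
- a_i can be solved there. Subtracting from b_i the solution w of (T - a_i) w = (T - a_i) b_i gives
the eigenvector. -/
theorem exists_triangular_eigenvector {b : Module.Basis ι K V} {lt : ι → ι → Prop}
    (hwf : WellFounded lt) (htrans : ∀ i j k, lt i j → lt j k → lt i k) {T : Module.End K V}
    {a : ι → K} (hT : ∀ i, T (b i) - a i • b i ∈ lowSpan b lt i)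
    (ha : ∀ i j, lt j i → a j ≠ a i) (i : ι) :
    ∃ p : V, T p = a i • p ∧ p - b i ∈ lowSpan b lt i := by
  induction i using hwf.induction with
  | _ i ih =>
    choose! p hp hp' using ih
    have hmem : ∀ j, lt j i → p j ∈ lowSpan b lt i := fun j hj => by
      rw [← sub_add_cancel (p j) (b j)]
      exact Submodule.add_mem _ (lowSpan_mono htrans hj (hp' j hj)) (basis_mem_lowSpan hj)
    have hle : lowSpan b lt i ≤ Submodule.span K (p '' {j | lt j i}) := by
      refine Submodule.span_le.2 ?_
      rintro _ ⟨j, hj, rfl⟩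
      exact basis_mem_span_of_unitriangular hwf {j | lt j i}
        (fun k l hkl hk => htrans l k i hkl hk) (fun k hk => hp' k hk) hj
    have hsolve : ∀ y ∈ Submodule.span K (p '' {j | lt j i}),
        ∃ w ∈ lowSpan b lt i, T w - a i • w = y := by
      intro y hy
      induction hy using Submodule.span_induction with
      | mem y hy =>
        obtain ⟨j, hj, rfl⟩ := hy
        have hne : a j - a i ≠ 0 := sub_ne_zero.2 (ha i j hj)
        refine ⟨(a j - a i)⁻¹ • p j, Submodule.smul_mem _ _ (hmem j hj), ?_⟩
        rw [map_smul, hp j hj, smul_comm (a i), ← smul_sub, ← sub_smul, smul_smul,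
          inv_mul_cancel₀ hne, one_smul]
      | zero => exact ⟨0, Submodule.zero_mem _, by simp⟩
      | add y z _ _ ihy ihz =>
        obtain ⟨w, hw, hw'⟩ := ihy
        obtain ⟨x, hx, hx'⟩ := ihz
        refine ⟨w + x, Submodule.add_mem _ hw hx, ?_⟩
        rw [map_add, smul_add, ← hw', ← hx']
        abel
      | smul c y _ ihy =>
        obtain ⟨w, hw, hw'⟩ := ihy
        refine ⟨c • w, Submodule.smul_mem _ _ hw, ?_⟩
        rw [map_smul, smul_comm (a i), ← smul_sub, hw']
    obtain ⟨w, hw, hw'⟩ := hsolve _ (hle (hT i))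
    refine ⟨b i - w, ?_, ?_⟩
    · rw [map_sub, smul_sub, sub_eq_sub_iff_sub_eq_sub, ← hw']
    · rw [sub_sub_cancel_left]
      exact Submodule.neg_mem _ hw

theorem map_lowSpan {b : Module.Basis ι K V} {lt : ι → ι → Prop}
    (htrans : ∀ i j k, lt i j → lt j k → lt i k) {T : Module.End K V}
    {a : ι → K} (hT : ∀ i, T (b i) - a i • b i ∈ lowSpan b lt i) {i : ι} {v : V}
    (hv : v ∈ lowSpan b lt i) : T v ∈ lowSpan b lt i := by
  refine (Submodule.span_le.2 ?_ : lowSpan b lt i ≤ (lowSpan b lt i).comap T) hv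
  rintro _ ⟨j, hj, rfl⟩
  change T (b j) ∈ lowSpan b lt i
  rw [← sub_add_cancel (T (b j)) (a j • b j)]
  exact Submodule.add_mem _ (lowSpan_mono htrans hj (hT j))
    (Submodule.smul_mem _ _ (basis_mem_lowSpan hj))

/-- A self-adjoint triangular operator is diagonal in every unitriangular orthogonal basis. -/
theorem apply_eq_smul_of_selfAdjoint {b P : Module.Basis ι K V} {lt : ι → ι → Prop}
    (hwf : WellFounded lt) (htrans : ∀ i j k, lt i j → lt j k → lt i k) {T : Module.End K V}
    {a : ι → K} (hT : ∀ i, T (b i) - a i • b i ∈ lowSpan b lt i)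
    (hP : ∀ i, P i - b i ∈ lowSpan b lt i) (B : V → V →ₗ[K] K) (hsymm : ∀ v w, B v w = B w v)
    (hnd : ∀ v, B v = 0 → v = 0) (horth : ∀ i j, i ≠ j → B (P i) (P j) = 0)
    (hsa : ∀ v w, B (T v) w = B v (T w)) (i : ι) : T (P i) = a i • P i := by
  classical
  have hirr : ∀ i, ¬lt i i := fun i h => hwf.asymmetric _ _ h h
  have hasym : ∀ i j, lt i j → ¬lt j i := fun i j h h' => hirr i (htrans i j i h h')
  have hdiag : ∀ i v, B (P i) v = P.repr v i * B (P i) (P i) := by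
    intro i v
    have : B (P i) = B (P i) (P i) • P.coord i := P.ext fun j => by
      rw [LinearMap.smul_apply, Module.Basis.coord_apply, Module.Basis.repr_self,
        Finsupp.single_apply, smul_eq_mul]
      by_cases h : j = i
      · rw [h, if_pos rfl, mul_one]
      · rw [if_neg h, mul_zero, horth i j (Ne.symm h)]
    conv_lhs => rw [this]
    rw [LinearMap.smul_apply, Module.Basis.coord_apply, smul_eq_mul, mul_comm]
  -- An isotropic member of an orthogonal basis would pair to zero with everything, against
  -- nondegeneracy.
  have hnorm : ∀ i, B (P i) (P i) ≠ 0 := fun i h0 => P.ne_zero i (hnd _ (LinearMap.ext fun v => by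
    rw [hdiag, h0, mul_zero, LinearMap.zero_apply]))
  have hlow : ∀ i, T (P i) - a i • b i ∈ lowSpan b lt i := fun i => by
    have h1 := map_lowSpan htrans hT (hP i)
    rw [map_sub] at h1
    have h2 := Submodule.add_mem _ h1 (hT i)
    rwa [sub_add_sub_cancel] at h2
  have htri : ∀ i j, P.repr (T (P i)) j ≠ 0 → j = i ∨ lt j i := by
    intro i j hj
    have hS : T (P i) ∈ Submodule.span K (P '' {j | j = i ∨ lt j i}) := by
      have hle : ∀ k, (k = i ∨ lt k i) → b k ∈ Submodule.span K (P '' {j | j = i ∨ lt j i}) := by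
        intro k hk
        refine basis_mem_span_of_unitriangular hwf _ ?_ (fun k _ => hP k) hk
        rintro k l hkl (rfl | hk)
        · exact Or.inr hkl
        · exact Or.inr (htrans l k i hkl hk)
      rw [← sub_add_cancel (T (P i)) (a i • b i)]
      refine Submodule.add_mem _ ?_ (Submodule.smul_mem _ _ (hle i (Or.inl rfl)))
      refine (Submodule.span_le.2 ?_ : lowSpan b lt i ≤ _) (hlow i)
      rintro _ ⟨k, hk, rfl⟩
      exact hle k (Or.inr hk)
    rw [Module.Basis.mem_span_image] at hS
    exact hS (Finsupp.mem_support_iff.2 hj)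
  -- A coefficient of T P_i at some j below i is, by self-adjointness, proportional to the
  -- coefficient of T P_j at i, which triangularity excludes.
  have hoff : ∀ j, j ≠ i → P.repr (T (P i)) j = 0 := by
    intro j hji
    by_contra h0
    have hlt := (htri i j h0).resolve_left hji
    have h1 : B (P j) (T (P i)) = B (P i) (T (P j)) := by rw [← hsa, hsymm]
    rw [hdiag, hdiag i] at h1
    have h2 : P.repr (T (P j)) i = 0 := by
      by_contra h3
      rcases htri j i h3 with h | h
      · exact hji h.symm
      · exact hasym j i hlt h
    rw [h2, zero_mul] at h1
    exact h0 ((mul_eq_zero.1 h1).resolve_right (hnorm j))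
  have hmul : T (P i) = P.repr (T (P i)) i • P i := by
    refine P.ext_elem fun j => ?_
    rw [map_smul, Finsupp.smul_apply, P.repr_self, Finsupp.single_apply, smul_eq_mul]
    by_cases h : i = j
    · rw [if_pos h, mul_one, h]
    · rw [if_neg h, mul_zero, hoff j (Ne.symm h)]
  have hself : ∀ v, v - b i ∈ lowSpan b lt i → b.repr v i = 1 := fun v hv => by
    have h1 : b.repr (v - b i) i = 0 := by
      by_contra h
      exact hirr i (mem_lowSpan.1 hv i h)
    rw [map_sub, Finsupp.sub_apply, b.repr_self, Finsupp.single_eq_same, sub_eq_zero] at h1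
    exact h1
  have hcoef : b.repr (T (P i)) i = a i := by
    have h1 : b.repr (T (P i) - a i • b i) i = 0 := by
      by_contra h
      exact hirr i (mem_lowSpan.1 (hlow i) i h)
    rw [map_sub, Finsupp.sub_apply, map_smul, Finsupp.smul_apply, b.repr_self,
      Finsupp.single_eq_same, smul_eq_mul, mul_one, sub_eq_zero] at h1
    exact h1
  have h2 : b.repr (T (P i)) i = P.repr (T (P i)) i := by
    conv_lhs => rw [hmul]
    rw [map_smul, Finsupp.smul_apply, hself _ (hP i), smul_eq_mul, mul_one]
  rw [hmul, ← h2, hcoef]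

end TriangularOperators

/-! ### The basis of Macdonald functions -/

section MacdonaldBasis

attribute [local instance] isDomain_CQ noZeroDivisors_CQT charZero_CQT

theorem youngDiagram_ext_rowLen {μ ν : YoungDiagram} (h : ∀ i, μ.rowLen i = ν.rowLen i) :
    μ = ν := by
  refine YoungDiagram.ext (Finset.ext fun c => ?_)
  have h1 : c ∈ μ.cells ↔ c.2 < μ.rowLen c.1 := YoungDiagram.mem_iff_lt_rowLen (j := c.2)
  have h2 : c ∈ ν.cells ↔ c.2 < ν.rowLen c.1 := YoungDiagram.mem_iff_lt_rowLen (j := c.2)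
  rw [h1, h2, h c.1]

theorem StrictlyDominated.trans {μ ν lam : YoungDiagram} (h : StrictlyDominated μ ν)
    (h' : StrictlyDominated ν lam) : StrictlyDominated μ lam := by
  refine ⟨h.1.trans h'.1, ?_, fun k => (h.2.2 k).trans (h'.2.2 k)⟩
  rintro rfl
  refine h.2.1 ?_
  have hs : ∀ k, ∑ i ∈ range k, μ.rowLen i = ∑ i ∈ range k, ν.rowLen i := fun k =>
    le_antisymm (h.2.2 k) (h'.2.2 k)
  refine youngDiagram_ext_rowLen fun i => ?_
  have := hs (i + 1)
  rw [sum_range_succ, sum_range_succ, hs i] at this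
  exact Nat.add_left_cancel this

theorem rowLen_eq_zero {μ : YoungDiagram} {i : ℕ} (h : μ.colLen 0 ≤ i) : μ.rowLen i = 0 := by
  by_contra h0
  have := (rowLen_pos_iff μ i).1 (Nat.pos_of_ne_zero h0)
  omega

theorem colLen_zero_le_card (μ : YoungDiagram) : μ.colLen 0 ≤ μ.card := by
  rw [μ.colLen_eq_card]
  exact card_le_card (filter_subset _ _)

/-- The sum of all partial row sums strictly increases along the order. Partial sums up to the
number of cells suffice, because later rows are empty. -/
theorem wellFounded_strictlyDominated : WellFounded StrictlyDominated := by
  refine Subrelation.wf (r := InvImage (· < ·) fun μ : YoungDiagram =>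
    ∑ k ∈ range (μ.card + 1), ∑ i ∈ range k, μ.rowLen i) (fun {μ ν} h => ?_)
    (InvImage.wf _ wellFounded_lt)
  change ∑ k ∈ range (μ.card + 1), ∑ i ∈ range k, μ.rowLen i <
    ∑ k ∈ range (ν.card + 1), ∑ i ∈ range k, ν.rowLen i
  rw [h.1]
  refine sum_lt_sum (fun k _ => h.2.2 k) ?_
  by_contra! hcon
  have hs : ∀ k, k ≤ ν.card → ∑ i ∈ range k, μ.rowLen i = ∑ i ∈ range k, ν.rowLen i :=
    fun k hk => le_antisymm (h.2.2 k) (hcon k (mem_range.2 (by omega)))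
  refine h.2.1 (youngDiagram_ext_rowLen fun i => ?_)
  by_cases hi : i < ν.card
  · have := hs (i + 1) hi
    rw [sum_range_succ, sum_range_succ, hs i hi.le] at this
    exact Nat.add_left_cancel this
  · have h1 := colLen_zero_le_card μ
    have h2 := colLen_zero_le_card ν
    rw [h.1] at h1
    rw [rowLen_eq_zero (by omega), rowLen_eq_zero (by omega)]

/-- The eigenvalue of `Ẽ^r` on the Macdonald function of a partition. -/
def eigenTilde (r : ℕ) (μ : YoungDiagram) : CQT := tildeEigen (μ.colLen 0) r μ

/-- Both sides are the same diagonal coefficient of the operator on the monomial basis, which does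
not know n. -/
theorem tildeEigen_eq {n : ℕ} (r : ℕ) {μ : YoungDiagram} (h : μ.colLen 0 ≤ n) :
    tildeEigen n r μ = eigenTilde r μ := by
  rw [← (isTildeE_vertexOp r).repr_self h, (isTildeE_vertexOp r).repr_self le_rfl, eigenTilde]

theorem IsTildeE.sub_mem_lowSpan {r : ℕ} {T : Module.End CQT SymFun} (h : IsTildeE r T)
    (μ : YoungDiagram) :
    T (monoBasis μ) - eigenTilde r μ • monoBasis μ ∈ lowSpan monoBasis StrictlyDominated μ := by
  classical
  rw [mem_lowSpan]
  intro ν hν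
  rw [map_sub, Finsupp.sub_apply, map_smul, Finsupp.smul_apply, Module.Basis.repr_self,
    Finsupp.single_apply, monoBasis_apply] at hν
  by_cases he : μ = ν
  · subst he
    rw [if_pos rfl, h.repr_self le_rfl, smul_eq_mul, mul_one, eigenTilde, sub_self] at hν
    exact absurd rfl hν
  · rw [if_neg he, smul_zero, sub_zero] at hν
    exact h.repr_ne_zero hν (Ne.symm he)

/-- In enough variables for both diagrams, the eigenvalue of Ẽ^1 is, up to a fixed factor and
summand, a polynomial in t with coefficients q^{λ_i}; these determine the rows. -/
theorem eigenTilde_one_injective : Function.Injective (eigenTilde 1) := by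
  intro μ ν h
  set n := max (μ.colLen 0) (ν.colLen 0) with hn
  rw [← tildeEigen_eq 1 (le_max_left (μ.colLen 0) (ν.colLen 0)),
    ← tildeEigen_eq 1 (le_max_right (μ.colLen 0) (ν.colLen 0)), ← hn] at h
  have hone : ∀ lam : YoungDiagram, tildeEigen n 1 lam =
      tv⁻¹ ^ n * (∑ i : Fin n, tv ^ (n - 1 - (i : ℕ)) * qv ^ lam.rowLen i) + eTail n 1 := by
    intro lam
    have h0 : eTail n 0 = 1 := by simp [eTail]
    rw [tildeEigen, sum_range_succ, sum_range_one, h0, one_mul, Nat.sub_zero, one_mul, Nat.sub_self,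
      zero_mul, pow_zero, mul_one, powersetCard_zero, sum_singleton, prod_empty, mul_one,
      powersetCard_one, sum_map]
    simp only [Function.Embedding.coeFn_mk, prod_singleton]
  rw [hone, hone] at h
  have h1 := mul_left_cancel₀ (pow_ne_zero n (inv_ne_zero tv_ne_zero)) (add_right_cancel h)
  set p : YoungDiagram → Polynomial CQ := fun lam => ∑ i : Fin n,
    Polynomial.C ((RatFunc.X : CQ) ^ lam.rowLen i) * Polynomial.X ^ (n - 1 - (i : ℕ)) with hp
  have hpm : ∀ lam, algebraMap (Polynomial CQ) CQT (p lam) =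
      ∑ i : Fin n, tv ^ (n - 1 - (i : ℕ)) * qv ^ lam.rowLen i := by
    intro lam
    rw [hp, map_sum]
    refine sum_congr rfl fun i _ => ?_
    rw [map_mul, map_pow (algebraMap (Polynomial CQ) CQT), RatFunc.algebraMap_X,
      RatFunc.algebraMap_C, map_pow, mul_comm]
    rfl
  rw [← hpm, ← hpm] at h1
  have h2 := RatFunc.algebraMap_injective CQ h1
  have hcoeff : ∀ lam (i : Fin n), (p lam).coeff (n - 1 - i) = (RatFunc.X : CQ) ^ lam.rowLen i := by
    intro lam i
    rw [hp, Polynomial.finsetSum_coeff, Finset.sum_eq_single i]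
    · rw [Polynomial.coeff_C_mul_X_pow, if_pos rfl]
    · intro j _ hj
      rw [Polynomial.coeff_C_mul_X_pow, if_neg]
      intro he
      exact hj (Fin.ext (by have := i.2; have := j.2; omega))
    · simp
  refine youngDiagram_ext_rowLen fun i => ?_
  by_cases hi : i < n
  · have h3 := hcoeff μ ⟨i, hi⟩
    rw [h2, hcoeff ν ⟨i, hi⟩] at h3
    refine qv_pow_injective ?_
    have h4 := congrArg (RatFunc.C : CQ →+* CQT) h3
    rw [map_pow, map_pow] at h4
    exact h4.symm
  · have h5 := le_max_left (μ.colLen 0) (ν.colLen 0)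
    have h6 := le_max_right (μ.colLen 0) (ν.colLen 0)
    rw [rowLen_eq_zero (by omega), rowLen_eq_zero (by omega)]

theorem sub_mem_lowSpan_iff (f : SymFun) (lam : YoungDiagram) :
    f - monoBasis lam ∈ lowSpan monoBasis StrictlyDominated lam ↔
      ∃ u : YoungDiagram →₀ CQT, (∀ μ ∈ u.support, StrictlyDominated μ lam) ∧
        ∀ n : ℕ, restrictVars n f =
          monomialSymm n lam + u.sum fun μ c => c • monomialSymm n μ := by
  have hrestr : ∀ (u : YoungDiagram →₀ CQT) n,
      restrictVars n (Finsupp.linearCombination CQT monoBasis u) =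
        u.sum fun μ c => c • monomialSymm n μ := by
    intro u n
    rw [Finsupp.linearCombination_apply, Finsupp.sum, map_sum]
    refine sum_congr rfl fun μ _ => ?_
    rw [map_smul, monoBasis_apply, restrictVars_monoFun]
  rw [mem_lowSpan]
  constructor
  · intro h
    refine ⟨monoBasis.repr (f - monoBasis lam), fun μ hμ => h μ (Finsupp.mem_support_iff.1 hμ),
      fun n => ?_⟩
    rw [← hrestr, monoBasis.linearCombination_repr, map_sub, monoBasis_apply, restrictVars_monoFun,
      add_sub_cancel]
  · rintro ⟨u, hu, h⟩
    have he : f - monoBasis lam = Finsupp.linearCombination CQT monoBasis u := by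
      refine symFun_ext fun n => ?_
      rw [hrestr, map_sub, h, monoBasis_apply, restrictVars_monoFun, add_sub_cancel_left]
    intro μ hμ
    rw [he, monoBasis.repr_linearCombination] at hμ
    exact hu μ (Finsupp.mem_support_iff.2 hμ)

/-- No separation of eigenvalues enters here, so the argument covers every r and every Macdonald
basis at once. -/
theorem IsMacdonaldBasis.apply_eq_smul {P : Module.Basis YoungDiagram CQT SymFun}
    (hP : IsMacdonaldBasis P) {r : ℕ} {T : Module.End CQT SymFun} (h : IsTildeE r T)
    (lam : YoungDiagram) : T (P lam) = eigenTilde r lam • P lam :=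
  apply_eq_smul_of_selfAdjoint wellFounded_strictlyDominated
    (fun _ _ _ h h' => StrictlyDominated.trans h h') h.sub_mem_lowSpan
    (fun lam => (sub_mem_lowSpan_iff _ lam).2 (hP.triangular lam)) scalarWith scalarWith_comm
    (fun _ => scalarWith_nondegenerate) hP.orthogonal h.scalarWith_apply lam

/-- The basis consists of the unitriangular eigenvectors of Ẽ^1. Distinct eigenvalues give linear
independence and, with self-adjointness, orthogonality; triangularity gives spanning. -/
theorem exists_isMacdonaldBasis :
    ∃ P : Module.Basis YoungDiagram CQT SymFun, IsMacdonaldBasis P := by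
  set T := vertexOp 1 (tildeKernel 1)
  have hT : IsTildeE 1 T := isTildeE_vertexOp 1
  choose p hp hp' using exists_triangular_eigenvector wellFounded_strictlyDominated
    (fun _ _ _ h h' => StrictlyDominated.trans h h') hT.sub_mem_lowSpan
    (fun μ ν h => eigenTilde_one_injective.ne h.2.1)
  have hp0 : ∀ μ, p μ ≠ 0 := by
    intro μ h0
    have h1 := hp' μ
    rw [h0, zero_sub, mem_lowSpan] at h1
    have h2 := h1 μ (by
      rw [map_neg, Finsupp.neg_apply, monoBasis.repr_self, Finsupp.single_eq_same]
      exact neg_ne_zero.2 one_ne_zero)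
    exact h2.2.1 rfl
  have hli : LinearIndependent CQT p :=
    Module.End.eigenvectors_linearIndependent' T (eigenTilde 1) eigenTilde_one_injective p
      fun μ => ⟨Module.End.mem_eigenspace_iff.2 (hp μ), hp0 μ⟩
  have hspan : ⊤ ≤ Submodule.span CQT (Set.range p) := by
    rw [← monoBasis.span_eq, Submodule.span_le]
    rintro _ ⟨μ, rfl⟩
    have := basis_mem_span_of_unitriangular wellFounded_strictlyDominated Set.univ
      (fun _ _ _ _ => trivial) (fun μ _ => hp' μ) (Set.mem_univ μ)
    rwa [Set.image_univ] at this
  refine ⟨Module.Basis.mk hli hspan, fun lam => ?_, fun lam μ hne => ?_⟩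
  · rw [Module.Basis.mk_apply]
    exact (sub_mem_lowSpan_iff _ _).1 (hp' lam)
  · rw [Module.Basis.mk_apply, Module.Basis.mk_apply]
    have h1 := hT.scalarWith_apply (p lam) (p μ)
    rw [hp, hp, map_smul, scalarWith_comm, map_smul, scalarWith_comm, smul_eq_mul, smul_eq_mul,
      ← sub_eq_zero, ← sub_mul] at h1
    exact (mul_eq_zero.1 h1).resolve_left (sub_ne_zero.2 (eigenTilde_one_injective.ne hne))

theorem IsMacdonaldBasis.commute {P : Module.Basis YoungDiagram CQT SymFun}
    (hP : IsMacdonaldBasis P) {r s : ℕ} {S T : Module.End CQT SymFun} (hS : IsTildeE r S)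
    (hT : IsTildeE s T) : Commute S T := P.ext fun lam => by
  rw [Module.End.mul_apply, Module.End.mul_apply, hP.apply_eq_smul hT, map_smul,
    hP.apply_eq_smul hS, map_smul, hP.apply_eq_smul hT, smul_comm]

end MacdonaldBasis

/-! ### Generating series of symmetric polynomials -/

section Generating

open PowerSeries

variable {R : Type*} [CommRing R]

theorem coeff_prod_one_add_C_mul_X {ι : Type*} (s : Finset ι) (w : ι → R) (m : ℕ) :
    coeff m (∏ i ∈ s, (1 + C (w i) * X)) = ∑ I ∈ powersetCard m s, ∏ i ∈ I, w i := by
  classical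
  rw [prod_one_add, map_sum]
  have h : ∀ I ∈ s.powerset, coeff m (∏ i ∈ I, (C (w i) * X : PowerSeries R)) =
      if I.card = m then ∏ i ∈ I, w i else 0 := by
    intro I _
    rw [prod_mul_distrib, ← map_prod, prod_const, coeff_C_mul, coeff_X_pow]
    by_cases hm : m = I.card
    · rw [if_pos hm, if_pos hm.symm, mul_one]
    · rw [if_neg hm, if_neg (Ne.symm hm), mul_zero]
  rw [sum_congr rfl h, ← sum_filter, ← powersetCard_eq_filter]

theorem coeff_prod_one_add_eq_esymm {ι K : Type*} [Fintype ι] [CommRing K] [Algebra K R]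
    (w : ι → R) (m : ℕ) :
    coeff m (∏ i, (1 + C (w i) * X)) = MvPolynomial.aeval w (MvPolynomial.esymm ι K m) := by
  rw [coeff_prod_one_add_C_mul_X, MvPolynomial.esymm, map_sum]
  refine sum_congr rfl fun I _ => ?_
  rw [map_prod]
  exact prod_congr rfl fun i _ => (MvPolynomial.aeval_X _ _).symm

theorem coeff_prod_geom_eq_hsymm {ι K : Type*} [Fintype ι] [DecidableEq ι] [CommRing K]
    [Algebra K R] (w : ι → R) (m : ℕ) :
    coeff m (∏ i, geom (w i)) = MvPolynomial.aeval w (MvPolynomial.hsymm ι K m) := by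
  rw [coeff_prod, MvPolynomial.hsymm, map_sum]
  simp only [geom, coeff_mk]
  refine (sum_bij (fun (s : Sym ι m) _ => Multiset.toFinsupp s.1) (fun s _ => ?_)
    (fun s _ s' _ h => ?_) (fun d hd => ?_) fun s _ => ?_).symm
  · rw [mem_finsuppAntidiag]
    refine ⟨?_, subset_univ _⟩
    have : ∑ i, Multiset.toFinsupp s.1 i = (Multiset.toFinsupp s.1).sum fun _ => id := by
      rw [Finsupp.sum_fintype _ _ fun _ => rfl]; rfl
    rw [this, Multiset.toFinsupp_sum_eq]
    exact s.2
  · exact Subtype.ext (Multiset.toFinsupp.injective h)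
  · rw [mem_finsuppAntidiag] at hd
    refine ⟨⟨Finsupp.toMultiset d, ?_⟩, mem_univ _, Finsupp.toMultiset_toFinsupp d⟩
    rw [Finsupp.card_toMultiset, Finsupp.sum_fintype _ _ fun _ => rfl]
    exact hd.1
  · generalize s.1 = u
    rw [map_multiset_prod, Multiset.map_map]
    have : (u.map ((MvPolynomial.aeval w : MvPolynomial ι K →ₐ[K] R) ∘ MvPolynomial.X)).prod =
        (u.map w).prod := by
      congr 1
      exact Multiset.map_congr rfl fun i _ => MvPolynomial.aeval_X _ _
    rw [this, prod_multiset_map_count]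
    refine prod_subset (subset_univ _) fun i _ hi => ?_
    rw [Multiset.count_eq_zero.2 fun h => hi (Multiset.mem_toFinset.2 h), pow_zero]

theorem prod_one_add_mul_rescale_geom {ι : Type*} (s : Finset ι) (w : ι → R) :
    (∏ i ∈ s, (1 + C (w i) * X)) * rescale (-1) (∏ i ∈ s, geom (w i)) = 1 := by
  rw [map_prod, ← prod_mul_distrib]
  refine prod_eq_one fun i _ => ?_
  have h1 := congrArg (rescale (-1 : R)) (one_sub_mul_geom (w i))
  have h2 : rescale (-1 : R) (C (w i)) = C (w i) := by
    ext n
    rw [coeff_rescale, coeff_C]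
    by_cases h : n = 0
    · rw [if_pos h, h, pow_zero, one_mul]
    · rw [if_neg h, mul_zero]
  rw [map_mul, map_one, map_sub, map_one, map_mul, rescale_X, h2] at h1
  have h3 : (1 : PowerSeries R) - C (w i) * (C (-1) * X) = 1 + C (w i) * X := by
    rw [map_neg, map_one]
    ring
  rwa [h3] at h1

theorem hasLogDeriv_one_add (x : R) :
    HasLogDeriv (mk fun n => (-1) ^ n * x ^ (n + 1)) (1 + C x * X) := by
  have h := hasLogDeriv_one_sub (-x)
  have h1 : (1 : PowerSeries R) - C (-x) * X = 1 + C x * X := by rw [map_neg]; ring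
  have h2 : -(C (-x) * geom (-x)) = mk fun n => (-1) ^ n * x ^ (n + 1) := by
    ext n
    rw [map_neg, coeff_C_mul, geom, coeff_mk, coeff_mk, neg_pow x n]
    ring
  rwa [h1, h2] at h

theorem derivative_rescale (a : R) (F : PowerSeries R) :
    d⁄dX R (rescale a F) = C a * rescale a (d⁄dX R F) := by
  ext n
  rw [coeff_derivative, coeff_rescale, coeff_C_mul, coeff_rescale, coeff_derivative, pow_succ]
  ring

theorem HasLogDeriv.rescale {A F : PowerSeries R} (h : HasLogDeriv A F) (a : R) :
    HasLogDeriv (C a * PowerSeries.rescale a A) (PowerSeries.rescale a F) := by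
  refine ⟨?_, by rw [derivative_rescale, h.2, map_mul, mul_assoc]⟩
  rw [← coeff_zero_eq_constantCoeff_apply, coeff_rescale, pow_zero, one_mul,
    coeff_zero_eq_constantCoeff_apply, h.1]

theorem HasLogDeriv.eq [IsDomain R] {A B F : PowerSeries R} (h : HasLogDeriv A F)
    (h' : HasLogDeriv B F) : A = B := by
  have hF : F ≠ 0 := by
    rintro rfl
    exact one_ne_zero (h.1.symm.trans (map_zero _))
  exact mul_right_cancel₀ hF (h.2.symm.trans h'.2)

/-- A series is determined by its behaviour under a rescaling. -/
theorem eq_of_rescale_mul_eq [IsDomain R] {q : R} (hq : ∀ m : ℕ, 0 < m → q ^ m ≠ 1)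
    {A B F G : PowerSeries R} (hA : constantCoeff A = 1) (hB : constantCoeff B = 1)
    (hF : rescale q F * A = F * B) (hG : rescale q G * A = G * B)
    (h0 : constantCoeff F = constantCoeff G) : F = G := by
  have hfin : ∀ n, coeff n F = coeff n G := by
    intro n
    induction n using Nat.strong_induction_on with
    | _ n ih =>
      rcases Nat.eq_zero_or_pos n with hn | hn
      · rw [hn, coeff_zero_eq_constantCoeff_apply, coeff_zero_eq_constantCoeff_apply, h0]
      · have key : rescale q (F - G) * A = (F - G) * B := by
          rw [map_sub, sub_mul, sub_mul, hF, hG]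
        have hz : ∀ k < n, coeff k (F - G) = 0 := fun k hk => by rw [map_sub, ih k hk, sub_self]
        have h1 := congrArg (coeff n) key
        rw [coeff_mul, coeff_mul] at h1
        have hs : ∀ H D : PowerSeries R, (∀ k < n, coeff k H = 0) →
            ∑ p ∈ antidiagonal n, coeff p.1 H * coeff p.2 D = coeff n H * coeff 0 D := by
          intro H D hH
          refine Finset.sum_eq_single_of_mem (n, 0) ?_ fun p hp hne => ?_
          · rw [HasAntidiagonal.mem_antidiagonal, add_zero]
          · rw [HasAntidiagonal.mem_antidiagonal] at hp
            rw [hH p.1, zero_mul]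
            by_contra! hlt
            exact hne (Prod.ext (by change p.1 = n; omega) (by change p.2 = 0; omega))
        rw [hs _ _ hz, hs _ _ fun k hk => by rw [coeff_rescale, hz k hk, mul_zero],
          coeff_zero_eq_constantCoeff_apply, coeff_zero_eq_constantCoeff_apply, hA, hB, mul_one,
          mul_one, coeff_rescale] at h1
        -- At the first index where F and G might differ, only the constant terms of A and B
        -- contribute, and both are 1.
        have h2 : (q ^ n - 1) * coeff n (F - G) = 0 := by rw [sub_mul, h1, one_mul, sub_self]
        have h3 := (mul_eq_zero.1 h2).resolve_left (sub_ne_zero.2 (hq n hn))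
        rw [map_sub] at h3
        exact sub_eq_zero.1 h3
  exact ext hfin

theorem derivative_log_subst_mul [Algebra ℚ R] {u : PowerSeries R} (hu : constantCoeff u = 0) :
    d⁄dX R ((log R).subst u) * (1 + u) = d⁄dX R u := by
  have hs : HasSubst u := HasSubst.of_constantCoeff_zero' hu
  have h1 : (mk fun n => algebraMap ℚ R ((-1 : ℚ) ^ n)) * (1 + X) = 1 := by
    ext n
    rw [mul_add, mul_one, map_add, coeff_mk]
    cases n with
    | zero => simp
    | succ n =>
      rw [coeff_succ_mul_X, coeff_mk, coeff_one, if_neg (Nat.succ_ne_zero n), pow_succ]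
      simp
  have h2 := congrArg (PowerSeries.subst u) h1
  rw [subst_mul hs, subst_add hs, subst_X hs] at h2
  have h3 : (1 : PowerSeries R).subst u = 1 := by
    rw [← coe_substAlgHom hs, map_one]
  rw [h3] at h2
  rw [derivative_subst hs, deriv_log, mul_right_comm, h2, one_mul]

end Generating

/-! ### Weighted homogeneous polynomials and partitions -/

section Weighted

variable {K : Type*} [CommRing K]

/-- The polynomials in variables of weights `1, 2, …` that are homogeneous of weight `m`. -/
def partSpan (K : Type*) [CommRing K] (m : ℕ) : Submodule K (MvPolynomial ℕ K) where
  carrier := {Q | ∀ d, MvPolynomial.coeff d Q ≠ 0 →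
    ∃ lam : m.Partition, Multiset.toFinsupp lam.parts = d}
  add_mem' := by
    intro P Q hP hQ d hd
    rw [MvPolynomial.coeff_add] at hd
    by_cases h : MvPolynomial.coeff d P = 0
    · rw [h, zero_add] at hd
      exact hQ d hd
    · exact hP d h
  zero_mem' := fun d hd => absurd (MvPolynomial.coeff_zero d) hd
  smul_mem' := by
    intro c Q hQ d hd
    rw [MvPolynomial.coeff_smul] at hd
    exact hQ d (right_ne_zero_of_mul hd)

theorem mul_mem_partSpan {a b m : ℕ} (h : a + b = m) {P Q : MvPolynomial ℕ K}
    (hP : P ∈ partSpan K a) (hQ : Q ∈ partSpan K b) : P * Q ∈ partSpan K m := by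
  classical
  subst h
  intro d hd
  rw [MvPolynomial.coeff_mul] at hd
  obtain ⟨x, hx, hx'⟩ := exists_ne_zero_of_sum_ne_zero hd
  obtain ⟨lam, hlam⟩ := hP x.1 (left_ne_zero_of_mul hx')
  obtain ⟨ν, hν⟩ := hQ x.2 (right_ne_zero_of_mul hx')
  refine ⟨⟨lam.parts + ν.parts, fun {i} hi => ?_, ?_⟩, ?_⟩
  · rcases Multiset.mem_add.1 hi with h | h
    · exact lam.parts_pos h
    · exact ν.parts_pos h
  · rw [Multiset.sum_add, lam.parts_sum, ν.parts_sum]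
  · rw [Multiset.toFinsupp_add, hlam, hν]
    exact HasAntidiagonal.mem_antidiagonal.1 hx

theorem C_mem_partSpan (c : K) : MvPolynomial.C c ∈ partSpan K 0 := by
  classical
  intro d hd
  rw [MvPolynomial.coeff_C] at hd
  have : 0 = d := by by_contra h; exact hd (if_neg h)
  refine ⟨⟨0, fun {i} hi => absurd hi (Multiset.notMem_zero i), rfl⟩, ?_⟩
  rw [← this]
  exact Multiset.toFinsupp_zero

theorem X_mem_partSpan {m : ℕ} (hm : 0 < m) : (MvPolynomial.X m : MvPolynomial ℕ K) ∈
    partSpan K m := by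
  classical
  intro d hd
  rw [MvPolynomial.coeff_X] at hd
  have : Finsupp.single m 1 = d := by by_contra h; exact hd (if_neg h)
  refine ⟨⟨{m}, fun {i} hi => ?_, Multiset.sum_singleton m⟩, ?_⟩
  · rw [Multiset.mem_singleton.1 hi]; exact hm
  · rw [← this]
    exact Multiset.toFinsupp_singleton m

theorem toFinsupp_parts_injective (m : ℕ) :
    Function.Injective fun lam : m.Partition => Multiset.toFinsupp lam.parts := fun _ _ h =>
  Nat.Partition.ext (Multiset.toFinsupp.injective h)

theorem eval₂_eq_sum_partition {S : Type*} [CommRing S] (φ : K →+* S) (e : ℕ → S) {m : ℕ}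
    {Q : MvPolynomial ℕ K} (hQ : Q ∈ partSpan K m) :
    MvPolynomial.eval₂Hom φ e Q = ∑ lam : m.Partition,
      φ (MvPolynomial.coeff (Multiset.toFinsupp lam.parts) Q) * (lam.parts.map e).prod := by
  classical
  have h1 : MvPolynomial.eval₂Hom φ e Q = ∑ d ∈ univ.image
      (fun lam : m.Partition => Multiset.toFinsupp lam.parts),
        φ (MvPolynomial.coeff d Q) * d.prod fun i k => e i ^ k := by
    rw [MvPolynomial.coe_eval₂Hom, MvPolynomial.eval₂_eq]
    refine sum_subset (fun d hd => ?_) fun d _ hd => ?_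
    · obtain ⟨lam, hlam⟩ := hQ d (MvPolynomial.mem_support_iff.1 hd)
      exact mem_image.2 ⟨lam, mem_univ _, hlam⟩
    · rw [MvPolynomial.notMem_support_iff.1 hd, map_zero, zero_mul]
  rw [h1, sum_image fun _ _ _ _ h => toFinsupp_parts_injective m h]
  refine sum_congr rfl fun lam _ => ?_
  congr 1
  rw [prod_multiset_map_count]
  rfl

/-- The power series whose coefficients are homogeneous of the weight of the exponent. -/
def GradedSeries (F : PowerSeries (MvPolynomial ℕ K)) : Prop :=
  ∀ m, PowerSeries.coeff m F ∈ partSpan K m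

/-- Because F has constant term 1, the coefficients of G follow recursively from those of FG and F,
and each step preserves weights. -/
theorem GradedSeries.of_mul {F G : PowerSeries (MvPolynomial ℕ K)} (hF : GradedSeries F)
    (hF1 : PowerSeries.constantCoeff F = 1) (h : GradedSeries (F * G)) : GradedSeries G := by
  intro m
  induction m using Nat.strong_induction_on with
  | _ m ih =>
    have h1 := h m
    rw [PowerSeries.coeff_mul, ← sum_erase_add _ _ (HasAntidiagonal.mem_antidiagonal.2
      (zero_add m) : (0, m) ∈ antidiagonal m), PowerSeries.coeff_zero_eq_constantCoeff_apply, hF1,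
      one_mul] at h1
    refine (Submodule.add_mem_iff_right _ ?_).1 h1
    refine Submodule.sum_mem _ fun p hp => ?_
    have hp1 := HasAntidiagonal.mem_antidiagonal.1 (mem_of_mem_erase hp)
    refine mul_mem_partSpan hp1 (hF _) (ih _ ?_)
    by_contra! hlt
    exact ne_of_mem_erase hp (Prod.ext (by change p.1 = 0; omega) (by change p.2 = m; omega))

/-- The generic series `1 + ∑_{n ≥ 1} e_n z^n`. -/
def genericSeries (K : Type*) [CommRing K] : PowerSeries (MvPolynomial ℕ K) :=
  PowerSeries.mk fun n => if n = 0 then 1 else MvPolynomial.X n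

theorem constantCoeff_genericSeries : PowerSeries.constantCoeff (genericSeries K) = 1 := by
  rw [← PowerSeries.coeff_zero_eq_constantCoeff_apply, genericSeries, PowerSeries.coeff_mk,
    if_pos rfl]

theorem gradedSeries_generic : GradedSeries (genericSeries K) := by
  intro m
  rw [genericSeries, PowerSeries.coeff_mk]
  by_cases h : m = 0
  · subst h
    rw [if_pos rfl]
    exact C_mem_partSpan 1
  · rw [if_neg h]
    exact X_mem_partSpan (Nat.pos_of_ne_zero h)

theorem map_genericSeries {S : Type*} [CommRing S] (φ : K →+* S) (e : ℕ → S) (h0 : e 0 = 1) :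
    (genericSeries K).map (MvPolynomial.eval₂Hom φ e) = PowerSeries.mk e := by
  ext n
  rw [PowerSeries.coeff_map, genericSeries, PowerSeries.coeff_mk, PowerSeries.coeff_mk]
  by_cases h : n = 0
  · rw [if_pos h, map_one, h, h0]
  · rw [if_neg h, MvPolynomial.coe_eval₂Hom, MvPolynomial.eval₂_X]

end Weighted

/-! ### Generating series of the eigenvalues -/

section EigenSeries

attribute [local instance] isDomain_CQ noZeroDivisors_CQT charZero_CQT

open PowerSeries

/-- `∑ e_r(t⁻¹, t⁻², …) z^r`. -/
def tailSeries : PowerSeries CQT := mk (eTail 0)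

/-- The generating series of the eigenvalues of the operators `Ẽ^r`. -/
def eigenSeries (lam : YoungDiagram) : PowerSeries CQT := mk fun r => eigenTilde r lam

/-- The generating series of the elementary symmetric functions of the cell weights. -/
def cellSeries (lam : YoungDiagram) : PowerSeries CQT :=
  ∏ s : lam.cells, (1 + C (cellWeight lam s) * X)

theorem eTail_zero_zero : eTail 0 0 = 1 := by simp [eTail]

theorem eTail_zero_succ (n : ℕ) : eTail 0 (n + 1) * (tv ^ (n + 1) - 1) = eTail 0 n := by
  have h := tv_pow_sub_one_ne_zero (n + 1) n.succ_pos
  rw [eTail, eTail, prod_Icc_succ_top (Nat.le_add_left 1 n), mul_inv, mul_zero, mul_zero, pow_zero,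
    one_mul, one_mul, mul_assoc, inv_mul_cancel₀ h, mul_one]

theorem eTail_eq (n j : ℕ) : eTail n j = tv⁻¹ ^ (j * n) * eTail 0 j := by
  rw [eTail, eTail, mul_zero, pow_zero, one_mul]

theorem rescale_one_add {R : Type*} [CommRing R] (a w : R) :
    rescale a (1 + C w * X) = 1 + C (a * w) * X := by
  ext n
  rw [coeff_rescale, map_add, map_add, coeff_C_mul, coeff_C_mul, coeff_one, coeff_X]
  by_cases h : n = 1
  · subst h; simp
  · by_cases h' : n = 0
    · subst h'; simp
    · simp [h, h']

/-- Formally the series is ∏_{i≥1} (1 + t⁻ⁱ z), and replacing z by tz adds the factor 1 + z. On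
coefficients this is the recursion `eTail_zero_succ`. -/
theorem rescale_tailSeries : rescale tv tailSeries = (1 + X) * tailSeries := by
  ext n
  rw [coeff_rescale, tailSeries, add_mul, one_mul, map_add, coeff_mk]
  cases n with
  | zero => simp
  | succ n =>
    rw [mul_comm X, coeff_succ_mul_X, coeff_mk, ← eTail_zero_succ n]
    ring

theorem rescale_inv_tailSeries : rescale tv⁻¹ tailSeries * (1 + C tv⁻¹ * X) = tailSeries := by
  have h := congrArg (rescale tv⁻¹) rescale_tailSeries
  have h1 := rescale_one_add tv⁻¹ (1 : CQT)
  rw [map_one, one_mul, mul_one] at h1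
  rw [rescale_rescale, mul_inv_cancel₀ tv_ne_zero, rescale_one, map_mul, h1] at h
  rw [mul_comm, ← h, RingHom.id_apply]

theorem tailSeries_eq (n : ℕ) :
    rescale (tv⁻¹ ^ n) tailSeries * ∏ i ∈ range n, (1 + C (tv⁻¹ ^ (i + 1)) * X) = tailSeries := by
  induction n with
  | zero => rw [prod_range_zero, mul_one, pow_zero, rescale_one, RingHom.id_apply]
  | succ n ih =>
    have h := congrArg (rescale (tv⁻¹ ^ n)) rescale_inv_tailSeries
    rw [map_mul, rescale_rescale, rescale_one_add, ← pow_succ', ← pow_succ] at h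
    rw [prod_range_succ_comm, ← mul_assoc, h, ih]

/-- The formal product ∏_{i≥1} (1 + t⁻ⁱ q^{λ_i} z): the factors beyond the last row form the
rescaled tail. The weights agree since t⁻ⁿ t^{n-1-i} = t^{-(i+1)}. -/
theorem eigenSeries_eq (lam : YoungDiagram) :
    eigenSeries lam = rescale (tv⁻¹ ^ lam.colLen 0) tailSeries *
      ∏ i ∈ range (lam.colLen 0), (1 + C (tv⁻¹ ^ (i + 1) * qv ^ lam.rowLen i) * X) := by
  ext r
  rw [eigenSeries, coeff_mk, eigenTilde, tildeEigen,
    ← Fin.prod_univ_eq_prod_range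
      (fun i => (1 + C (tv⁻¹ ^ (i + 1) * qv ^ lam.rowLen i) * X : PowerSeries CQT)),
    coeff_mul, Nat.sum_antidiagonal_eq_sum_range_succ
      (fun a b => coeff a (rescale (tv⁻¹ ^ lam.colLen 0) tailSeries) * coeff b (∏ i : Fin (lam.colLen 0),
        (1 + C (tv⁻¹ ^ ((i : ℕ) + 1) * qv ^ lam.rowLen i) * X : PowerSeries CQT)))]
  refine sum_congr rfl fun j _ => ?_
  rw [coeff_prod_one_add_C_mul_X, coeff_rescale, tailSeries, coeff_mk, eTail_eq, ← pow_mul,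
    mul_comm (lam.colLen 0) j, mul_assoc _ (tv⁻¹ ^ ((r - j) * _)), mul_sum]
  congr 1
  refine sum_congr rfl fun I hI => ?_
  rw [pow_mul', ← (mem_powersetCard.1 hI).2, ← prod_const, ← prod_mul_distrib]
  refine prod_congr rfl fun i _ => ?_
  have h : tv⁻¹ ^ lam.colLen 0 = tv⁻¹ ^ ((i : ℕ) + 1) * tv⁻¹ ^ (lam.colLen 0 - 1 - (i : ℕ)) := by
    rw [← pow_add]
    congr 1
    have := i.2
    omega
  rw [h, mul_assoc, ← mul_assoc (tv⁻¹ ^ (lam.colLen 0 - 1 - (i : ℕ))), ← mul_pow,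
    inv_mul_cancel₀ tv_ne_zero, one_pow, one_mul]

theorem cellSeries_eq (lam : YoungDiagram) :
    cellSeries lam = ∏ i ∈ range (lam.colLen 0), ∏ j ∈ range (lam.rowLen i),
      (1 + C (tv⁻¹ ^ i * qv ^ j) * X) := by
  have h1 : cellSeries lam = ∏ s ∈ lam.cells, (1 + C (tv⁻¹ ^ s.1 * qv ^ s.2) * X) :=
    prod_coe_sort lam.cells fun s => (1 + C (tv⁻¹ ^ s.1 * qv ^ s.2) * X : PowerSeries CQT)
  rw [h1]
  refine prod_finset_product _ _ _ fun s => ?_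
  rw [mem_range, mem_range, YoungDiagram.mem_cells]
  constructor
  · intro h
    exact ⟨YoungDiagram.mem_iff_lt_colLen.1 (lam.up_left_mem le_rfl (Nat.zero_le _) h),
      YoungDiagram.mem_iff_lt_rowLen.1 h⟩
  · intro h
    exact YoungDiagram.mem_iff_lt_rowLen.2 h.2

/-- Both sides equal ∏_{j≤a} (1 + w q^j z), with the last or the first factor split off. -/
theorem row_telescope (w q : CQT) (a : ℕ) :
    (1 + C (w * q ^ a) * X) * ∏ j ∈ range a, (1 + C (w * q ^ j) * X) =
      (1 + C w * X) * rescale q (∏ j ∈ range a, (1 + C (w * q ^ j) * X)) := by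
  rw [mul_comm, ← prod_range_succ (fun j => (1 + C (w * q ^ j) * X : PowerSeries CQT)),
    prod_range_succ', pow_zero, mul_one, mul_comm, map_prod]
  congr 1
  refine prod_congr rfl fun j _ => ?_
  rw [rescale_one_add, pow_succ, mul_left_comm q, mul_comm q]

/-- The functional equation tying the eigenvalues to the cell weights. Each row telescopes, and the
factors of the empty rows agree on both sides. -/
theorem rescale_eigenSeries_mul (lam : YoungDiagram) :
    rescale tv (eigenSeries lam) * cellSeries lam =
      rescale tv tailSeries * rescale qv (cellSeries lam) := by
  have h1 : ∀ f : ℕ → CQT, rescale tv (∏ i ∈ range (lam.colLen 0), (1 + C (tv⁻¹ ^ (i + 1) * f i) * X)) =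
      ∏ i ∈ range (lam.colLen 0), (1 + C (tv⁻¹ ^ i * f i) * X) := by
    intro f
    rw [map_prod]
    refine prod_congr rfl fun i _ => ?_
    rw [rescale_one_add, ← mul_assoc, pow_succ', ← mul_assoc, mul_inv_cancel₀ tv_ne_zero, one_mul]
  have h2 := h1 fun _ => 1
  simp only [mul_one] at h2
  have h3 := tailSeries_eq (lam.colLen 0)
  rw [eigenSeries_eq]
  conv_rhs => rw [← h3]
  rw [map_mul, map_mul, h1 fun i => qv ^ lam.rowLen i, h2, mul_assoc, mul_assoc, cellSeries_eq,
    map_prod, ← prod_mul_distrib, ← prod_mul_distrib]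
  congr 1
  exact prod_congr rfl fun i _ => row_telescope _ _ _

theorem constantCoeff_tailSeries : constantCoeff tailSeries = 1 := by
  rw [← coeff_zero_eq_constantCoeff_apply, tailSeries, coeff_mk, eTail_zero_zero]

theorem constantCoeff_one_add_prod {ι R : Type*} [CommRing R] (s : Finset ι) (w : ι → R) :
    constantCoeff (∏ i ∈ s, (1 + C (w i) * X)) = 1 := by
  rw [map_prod]
  exact prod_eq_one fun i _ => by simp

theorem constantCoeff_rescale {R : Type*} [CommRing R] (a : R) (F : PowerSeries R) :
    constantCoeff (rescale a F) = constantCoeff F := by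
  rw [← coeff_zero_eq_constantCoeff_apply, coeff_rescale, pow_zero, one_mul,
    coeff_zero_eq_constantCoeff_apply]

theorem constantCoeff_cellSeries (lam : YoungDiagram) : constantCoeff (cellSeries lam) = 1 :=
  constantCoeff_one_add_prod _ _

theorem constantCoeff_eigenSeries (lam : YoungDiagram) : constantCoeff (eigenSeries lam) = 1 := by
  rw [eigenSeries_eq, map_mul, constantCoeff_one_add_prod, constantCoeff_rescale,
    constantCoeff_tailSeries, mul_one]

theorem eigenTilde_zero (lam : YoungDiagram) : eigenTilde 0 lam = 1 := by
  have h := constantCoeff_eigenSeries lam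
  rwa [← coeff_zero_eq_constantCoeff_apply, eigenSeries, coeff_mk] at h

end EigenSeries

/-! ### The universal series -/

section Universal

open PowerSeries

variable {R : Type*} [CommRing R]

/-- The coefficients of the solution of `G(q z) = G(z) ∑ u_n z^n`, where `v_n = (q^n - 1)⁻¹`. -/
def rescaleCoeff (v u : ℕ → R) : ℕ → R
  | 0 => 1
  | n + 1 => v (n + 1) * ∑ k : Fin (n + 1), rescaleCoeff v u k * u (n + 1 - k)

theorem rescaleCoeff_zero (v u : ℕ → R) : rescaleCoeff v u 0 = 1 := by rw [rescaleCoeff]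

theorem rescaleCoeff_succ (v u : ℕ → R) (n : ℕ) : rescaleCoeff v u (n + 1) =
    v (n + 1) * ∑ k ∈ range (n + 1), rescaleCoeff v u k * u (n + 1 - k) := by
  rw [rescaleCoeff, Fin.sum_univ_eq_sum_range fun k => rescaleCoeff v u k * u (n + 1 - k)]

/-- In degree n the equation reads (qⁿ - 1) G_n = ∑_{k<n} G_k u_{n-k}, which is the defining
recursion. -/
theorem rescale_mk_rescaleCoeff {q : R} {v : ℕ → R} (hv : ∀ n, 0 < n → v n * (q ^ n - 1) = 1)
    {u : ℕ → R} (hu : u 0 = 1) :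
    rescale q (mk (rescaleCoeff v u)) = mk (rescaleCoeff v u) * mk u := by
  ext n
  rw [coeff_rescale, coeff_mk, coeff_mul, Nat.sum_antidiagonal_eq_sum_range_succ
    (fun a b => coeff a (mk (rescaleCoeff v u)) * coeff b (mk u)), sum_range_succ]
  simp only [coeff_mk]
  rw [Nat.sub_self, hu, mul_one]
  cases n with
  | zero => simp
  | succ n =>
    have h := congrArg ((q ^ (n + 1) - 1) * ·) (rescaleCoeff_succ v u n)
    rw [← mul_assoc, mul_comm _ (v _), hv _ n.succ_pos, one_mul, sub_mul, one_mul] at h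
    rw [← h, sub_add_cancel]

theorem gradedSeries_one {K : Type*} [CommRing K] :
    GradedSeries (1 : PowerSeries (MvPolynomial ℕ K)) := by
  intro m
  rw [coeff_one]
  by_cases h : m = 0
  · subst h
    rw [if_pos rfl]
    exact C_mem_partSpan 1
  · rw [if_neg h]
    exact Submodule.zero_mem _

theorem gradedSeries_rescaleCoeff {K : Type*} [CommRing K] (v : ℕ → K) :
    GradedSeries (mk (rescaleCoeff (fun n => MvPolynomial.C (v n))
      fun n => coeff n (genericSeries K))) := by
  intro m
  induction m using Nat.strong_induction_on with
  | _ m ih =>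
    rw [coeff_mk]
    cases m with
    | zero =>
      rw [rescaleCoeff_zero]
      exact C_mem_partSpan 1
    | succ n =>
      rw [rescaleCoeff_succ]
      refine mul_mem_partSpan (zero_add _) (C_mem_partSpan _) (Submodule.sum_mem _ fun k hk => ?_)
      have hk' := mem_range.1 hk
      have h1 := ih k hk'
      rw [coeff_mk] at h1
      exact mul_mem_partSpan (by omega) h1 (gradedSeries_generic _)

end Universal

/-! ### Symmetric functions of the cell weights through the eigenvalues -/

section CellSeries

attribute [local instance] isDomain_CQ noZeroDivisors_CQT charZero_CQT

open PowerSeries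

/-- The universal series `G` with `G(q z) = G(z) (1 + ∑_{n ≥ 1} e_n z^n)`. -/
def universalSeries : PowerSeries (MvPolynomial ℕ CQ) :=
  mk (rescaleCoeff (fun n => MvPolynomial.C ((RatFunc.X ^ n - 1 : CQ)⁻¹))
    fun n => coeff n (genericSeries CQ))

theorem qX_pow_sub_one_ne_zero {n : ℕ} (hn : 0 < n) : (RatFunc.X ^ n - 1 : CQ) ≠ 0 := by
  intro h
  have h1 := congrArg (RatFunc.C : CQ →+* CQT) h
  rw [map_sub, map_pow, map_one, map_zero] at h1
  exact one_sub_qv_pow_ne_zero hn (by rw [← neg_eq_zero, neg_sub]; exact h1)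

theorem constantCoeff_universalSeries : constantCoeff universalSeries = 1 := by
  rw [← coeff_zero_eq_constantCoeff_apply, universalSeries, coeff_mk, rescaleCoeff_zero]

theorem rescale_universalSeries : rescale (MvPolynomial.C (RatFunc.X : CQ)) universalSeries =
    universalSeries * genericSeries CQ := by
  have hv : ∀ n, 0 < n → (MvPolynomial.C ((RatFunc.X ^ n - 1 : CQ)⁻¹) : MvPolynomial ℕ CQ) *
      (MvPolynomial.C (RatFunc.X : CQ) ^ n - 1) = 1 := by
    intro n hn
    rw [← map_pow, ← map_one MvPolynomial.C, ← map_sub, ← map_mul,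
      inv_mul_cancel₀ (qX_pow_sub_one_ne_zero hn)]
  have hu : coeff 0 (genericSeries CQ) = 1 := by
    rw [coeff_zero_eq_constantCoeff_apply, constantCoeff_genericSeries]
  have hmk : (PowerSeries.mk fun n => coeff n (genericSeries CQ)) = genericSeries CQ :=
    PowerSeries.ext fun n => coeff_mk _ _
  have h := rescale_mk_rescaleCoeff (u := fun n => coeff n (genericSeries CQ)) hv hu
  rwa [hmk] at h

/-- The inverse of the universal series. -/
def universalInv : PowerSeries (MvPolynomial ℕ CQ) := invOfUnit universalSeries 1

theorem universalSeries_mul_inv : universalSeries * universalInv = 1 :=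
  mul_invOfUnit _ _ constantCoeff_universalSeries

theorem gradedSeries_universal : GradedSeries universalSeries := gradedSeries_rescaleCoeff _

theorem gradedSeries_universalInv : GradedSeries universalInv :=
  gradedSeries_universal.of_mul constantCoeff_universalSeries
    (universalSeries_mul_inv ▸ gradedSeries_one)

/-- Evaluation of polynomials with coefficients in `ℂ(q)`. -/
def evalCQ (e : ℕ → CQT) : MvPolynomial ℕ CQ →+* CQT := MvPolynomial.eval₂Hom RatFunc.C e

theorem map_universalSeries_mul_inv (e : ℕ → CQT) :
    universalSeries.map (evalCQ e) * universalInv.map (evalCQ e) = 1 := by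
  rw [← map_mul, universalSeries_mul_inv, map_one]

theorem rescale_map_universalSeries {e : ℕ → CQT} (he : e 0 = 1) :
    rescale qv (universalSeries.map (evalCQ e)) = universalSeries.map (evalCQ e) * mk e := by
  have h : evalCQ e (MvPolynomial.C RatFunc.X) = qv := MvPolynomial.eval₂_C _ _ _
  rw [← h, rescale_map, rescale_universalSeries, map_mul, evalCQ, map_genericSeries _ _ he]

theorem rescale_map_universalInv {e : ℕ → CQT} (he : e 0 = 1) :
    rescale qv (universalInv.map (evalCQ e)) * mk e = universalInv.map (evalCQ e) := by
  have h1 := map_universalSeries_mul_inv e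
  have h2 := congrArg (rescale qv) h1
  rw [map_mul, map_one, rescale_map_universalSeries he] at h2
  calc _ = universalSeries.map (evalCQ e) * universalInv.map (evalCQ e) *
        (rescale qv (universalInv.map (evalCQ e)) * mk e) := by rw [h1, one_mul]
    _ = universalSeries.map (evalCQ e) * mk e * rescale qv (universalInv.map (evalCQ e)) *
        universalInv.map (evalCQ e) := by ring
    _ = _ := by rw [h2, one_mul]

/-- Both sides solve F(qz) T(tz) = F(z) E(tz) with constant term 1, where E and T are the series of
eigenvalues and of constants. The solution is unique because q is not a root of unity. -/
theorem cellSeries_eq_universal (lam : YoungDiagram) :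
    cellSeries lam = rescale tv (universalSeries.map (evalCQ fun r => eigenTilde r lam) *
      universalInv.map (evalCQ (eTail 0))) := by
  have hq : ∀ m : ℕ, 0 < m → qv ^ m ≠ 1 := fun m hm h =>
    one_sub_qv_pow_ne_zero hm (sub_eq_zero.2 h.symm)
  have hrr : ∀ F : PowerSeries CQT, rescale qv (rescale tv F) = rescale tv (rescale qv F) :=
    fun F => by rw [rescale_rescale, rescale_rescale, mul_comm]
  refine eq_of_rescale_mul_eq hq (A := rescale tv tailSeries)
    (B := rescale tv (eigenSeries lam)) ?_ ?_ ?_ ?_ ?_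
  · rw [constantCoeff_rescale, constantCoeff_tailSeries]
  · rw [constantCoeff_rescale, constantCoeff_eigenSeries]
  · rw [mul_comm, ← rescale_eigenSeries_mul, mul_comm]
  · rw [hrr, ← map_mul, ← map_mul]
    congr 1
    rw [map_mul, rescale_map_universalSeries (eigenTilde_zero lam), mul_assoc, tailSeries,
      rescale_map_universalInv eTail_zero_zero, mul_right_comm]
    rfl
  · have h := congrArg constantCoeff (map_universalSeries_mul_inv (eTail 0))
    have h1 : ∀ e, constantCoeff (universalSeries.map (evalCQ e)) = 1 := fun e => by
      rw [← coeff_zero_eq_constantCoeff_apply, coeff_map, coeff_zero_eq_constantCoeff_apply,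
        constantCoeff_universalSeries, map_one]
    rw [map_mul, h1, one_mul, map_one] at h
    rw [constantCoeff_cellSeries, constantCoeff_rescale, map_mul, h1, one_mul, h]

theorem coeff_map_mul_map {F G : PowerSeries (MvPolynomial ℕ CQ)} (hF : GradedSeries F)
    (hG : GradedSeries G) (e c : ℕ → CQT) (m : ℕ) :
    coeff m (F.map (evalCQ e) * G.map (evalCQ c)) = ∑ jk ∈ HasAntidiagonal.antidiagonal m,
      ∑ lam : jk.1.Partition, ∑ ν : jk.2.Partition,
        (RatFunc.C (MvPolynomial.coeff (Multiset.toFinsupp lam.parts) (coeff jk.1 F)) *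
          RatFunc.C (MvPolynomial.coeff (Multiset.toFinsupp ν.parts) (coeff jk.2 G)) *
            (ν.parts.map c).prod) * (lam.parts.map e).prod := by
  rw [coeff_mul]
  refine sum_congr rfl fun jk _ => ?_
  rw [coeff_map, coeff_map, evalCQ, evalCQ, eval₂_eq_sum_partition _ _ (hF _),
    eval₂_eq_sum_partition _ _ (hG _), sum_mul_sum]
  exact sum_congr rfl fun lam _ => sum_congr rfl fun ν _ => by ring

/-- Inverting `cellSeries` exchanges the universal series and its inverse, and z becomes -z; hence
the exchange of β and γ and the sign in (-t)^m. -/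
theorem prod_geom_cellWeight (lam : YoungDiagram) :
    ∏ s : lam.cells, geom (cellWeight lam s) = rescale (-tv)
      (universalInv.map (evalCQ fun r => eigenTilde r lam) *
        universalSeries.map (evalCQ (eTail 0))) := by
  have h1 : cellSeries lam * rescale (-1) (∏ s : lam.cells, geom (cellWeight lam s)) = 1 :=
    prod_one_add_mul_rescale_geom _ _
  have h2 : cellSeries lam * rescale tv (universalInv.map (evalCQ fun r => eigenTilde r lam) *
        universalSeries.map (evalCQ (eTail 0))) = 1 := by
    rw [cellSeries_eq_universal, ← map_mul, mul_mul_mul_comm, map_universalSeries_mul_inv,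
      mul_comm (universalInv.map _), map_universalSeries_mul_inv, mul_one, map_one]
  have h3 := congrArg (rescale (-1 : CQT)) (left_inv_eq_right_inv ((mul_comm _ _).trans h1) h2)
  rw [rescale_rescale, rescale_rescale, neg_mul_neg, mul_one, rescale_one, RingHom.id_apply,
    mul_neg_one] at h3
  exact h3

/-! ### Power sums of the cell weights -/

/-- The logarithm of the generic series. -/
def genericLog : PowerSeries (MvPolynomial ℕ ℚ) :=
  (log (MvPolynomial ℕ ℚ)).subst
    (mk fun n : ℕ => if n = 0 then (0 : MvPolynomial ℕ ℚ) else MvPolynomial.X n)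

theorem derivative_genericLog :
    d⁄dX _ genericLog * genericSeries ℚ = d⁄dX _ (genericSeries ℚ) := by
  have h1 : genericSeries ℚ = 1 +
      mk fun n : ℕ => if n = 0 then (0 : MvPolynomial ℕ ℚ) else MvPolynomial.X n := by
    ext1 n
    rw [genericSeries, map_add, coeff_mk, coeff_mk, coeff_one]
    by_cases h : n = 0
    · rw [if_pos h, if_pos h, if_pos h, add_zero]
    · rw [if_neg h, if_neg h, if_neg h, zero_add]
  have h2 := derivative_log_subst_mul (R := MvPolynomial ℕ ℚ)
    (u := mk fun n : ℕ => if n = 0 then (0 : MvPolynomial ℕ ℚ) else MvPolynomial.X n)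
    (by rw [← coeff_zero_eq_constantCoeff_apply, coeff_mk, if_pos rfl])
  rw [h1, genericLog, h2, map_add, (d⁄dX (MvPolynomial ℕ ℚ)).map_one_eq_zero, zero_add]

/-- Multiplying z times the derivative of the logarithm by the generic series gives a visibly graded
series; the generic factor can be removed, and then the factor m. -/
theorem genericLog_mem {m : ℕ} (hm : 0 < m) : coeff m genericLog ∈ partSpan ℚ m := by
  have hX : ∀ (F : PowerSeries (MvPolynomial ℕ ℚ)) (n : ℕ),
      coeff (n + 1) (X * d⁄dX _ F) = ((n : ℚ) + 1) • coeff (n + 1) F := by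
    intro F n
    rw [mul_comm, coeff_succ_mul_X, coeff_derivative, MvPolynomial.smul_eq_C_mul, mul_comm]
    simp
  have h1 : GradedSeries (genericSeries ℚ * (X * d⁄dX _ genericLog)) := by
    have : genericSeries ℚ * (X * d⁄dX _ genericLog) = X * d⁄dX _ (genericSeries ℚ) := by
      rw [← derivative_genericLog]; ring
    rw [this]
    intro m
    cases m with
    | zero => simp
    | succ n =>
      rw [hX]
      exact Submodule.smul_mem _ _ (gradedSeries_generic _)
  have h2 := gradedSeries_generic.of_mul constantCoeff_genericSeries h1 m
  obtain ⟨n, rfl⟩ := Nat.exists_eq_succ_of_ne_zero hm.ne'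
  rw [Nat.succ_eq_add_one, hX] at h2
  exact (Submodule.smul_mem_iff _ (by positivity)).1 h2

/-- Evaluation of polynomials with rational coefficients. -/
def evalRat (e : ℕ → CQT) : MvPolynomial ℕ ℚ →+* CQT :=
  MvPolynomial.eval₂Hom (algebraMap ℚ CQT) e

theorem evalRat_genericLog (e : ℕ → CQT) {m : ℕ} (hm : 0 < m) :
    evalRat e (coeff m genericLog) =
      ∑ lam : m.Partition, (alphaCoeff lam : CQT) * (lam.parts.map e).prod := by
  rw [evalRat, eval₂_eq_sum_partition _ _ (genericLog_mem hm)]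
  refine sum_congr rfl fun lam _ => ?_
  rw [eq_ratCast]
  rfl

theorem hasLogDeriv_mk {e : ℕ → CQT} (he : e 0 = 1) :
    HasLogDeriv (mk fun n => ((n : CQT) + 1) * evalRat e (coeff (n + 1) genericLog)) (mk e) := by
  have h1 : HasLogDeriv (d⁄dX _ genericLog) (genericSeries ℚ) :=
    ⟨constantCoeff_genericSeries, derivative_genericLog.symm⟩
  have h2 := h1.map (evalRat e)
  rw [evalRat, map_genericSeries _ _ he, ← evalRat] at h2
  convert h2 using 1
  ext n
  rw [coeff_mk, coeff_map, coeff_derivative, map_mul, map_add, map_natCast, map_one, mul_comm]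

theorem hasLogDeriv_cellSeries (lam : YoungDiagram) : HasLogDeriv
    (mk fun n => (-1) ^ n *
      MvPolynomial.aeval (cellWeight lam) (MvPolynomial.psum lam.cells CQT (n + 1)))
    (cellSeries lam) := by
  have h := HasLogDeriv.prod univ fun (s : lam.cells) _ => hasLogDeriv_one_add (cellWeight lam s)
  refine Eq.subst (motive := fun A => HasLogDeriv A (cellSeries lam)) ?_ h
  ext n
  rw [coeff_mk, map_sum, MvPolynomial.psum, map_sum, mul_sum]
  refine sum_congr rfl fun s _ => ?_
  rw [coeff_mk, map_pow, MvPolynomial.aeval_X]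

/-- Compare logarithmic derivatives in T(tz) = (1 + z) T(z). -/
theorem evalRat_genericLog_eTail {m : ℕ} (hm : 0 < m) :
    (m : CQT) * (tv ^ m - 1) * evalRat (eTail 0) (coeff m genericLog) = -(-1) ^ m := by
  obtain ⟨n, rfl⟩ := Nat.exists_eq_succ_of_ne_zero hm.ne'
  have h1 := (hasLogDeriv_mk eTail_zero_zero).rescale tv
  have h2 := (hasLogDeriv_one_add (1 : CQT)).mul (hasLogDeriv_mk eTail_zero_zero)
  have h3 : rescale tv (mk (eTail 0)) = (1 + C 1 * X) * PowerSeries.mk (eTail 0) := by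
    rw [map_one, one_mul]; exact rescale_tailSeries
  rw [h3] at h1
  have h4 := congrArg (coeff n) (h1.eq h2)
  rw [coeff_C_mul, coeff_rescale, coeff_mk, map_add, coeff_mk, coeff_mk, one_pow, mul_one] at h4
  rw [Nat.succ_eq_add_one, Nat.cast_add, Nat.cast_one, pow_succ, pow_succ (-1 : CQT)]
  linear_combination h4

/-- The logarithmic derivative of E(tz) C(z) = T(tz) C(qz), read off in degree m - 1; the factor 1 -
q^m comes from the two occurrences of C. -/
theorem psum_cellWeight (lam : YoungDiagram) {m : ℕ} (hm : 0 < m) :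
    (1 - qv ^ m) * MvPolynomial.aeval (cellWeight lam) (MvPolynomial.psum lam.cells CQT m) =
      (-1) ^ m * (m : CQT) * tv ^ m * (evalRat (fun r => eigenTilde r lam) (coeff m genericLog) -
        evalRat (eTail 0) (coeff m genericLog)) := by
  obtain ⟨n, rfl⟩ := Nat.exists_eq_succ_of_ne_zero hm.ne'
  have h1 := ((hasLogDeriv_mk (e := fun r => eigenTilde r lam) (eigenTilde_zero lam)).rescale tv).mul
    (hasLogDeriv_cellSeries lam)
  have h2 := ((hasLogDeriv_mk eTail_zero_zero).rescale tv).mul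
    ((hasLogDeriv_cellSeries lam).rescale qv)
  have h3 : rescale tv (mk fun r => eigenTilde r lam) * cellSeries lam =
      rescale tv (mk (eTail 0)) * rescale qv (cellSeries lam) := rescale_eigenSeries_mul lam
  rw [h3] at h1
  have h4 := congrArg (coeff n) (h1.eq h2)
  rw [map_add, map_add, coeff_C_mul, coeff_C_mul, coeff_C_mul, coeff_rescale, coeff_rescale,
    coeff_rescale, coeff_mk, coeff_mk, coeff_mk] at h4
  rw [Nat.succ_eq_add_one, Nat.cast_add, Nat.cast_one, pow_succ, pow_succ (-1 : CQT), pow_succ tv]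
  have h5 : ((-1 : CQT) ^ n) * (-1) ^ n = 1 := by rw [← mul_pow, neg_mul_neg, one_mul, one_pow]
  linear_combination (-1 : CQT) ^ n * h4 -
    (1 - qv ^ n * qv) * MvPolynomial.aeval (cellWeight lam)
      (MvPolynomial.psum lam.cells CQT (n + 1)) * h5

end CellSeries

/-! ### Polynomials in the modified Macdonald operators -/

section Formulas

attribute [local instance] isDomain_CQ noZeroDivisors_CQT charZero_CQT

variable {P : Module.Basis YoungDiagram CQT SymFun} {E : ℕ → Module.End CQT SymFun}

theorem diagOp_apply (P : Module.Basis YoungDiagram CQT SymFun) (c : YoungDiagram → CQT)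
    (μ : YoungDiagram) : diagOp P c (P μ) = c μ • P μ :=
  Module.Basis.constr_basis _ _ _ _

theorem eTailPart_eq {n : ℕ} (ν : n.Partition) : eTailPart ν = (ν.parts.map (eTail 0)).prod := rfl

theorem tildeEPart_apply (hP : IsMacdonaldBasis P) (hE : ∀ r, IsTildeE r (E r)) {n : ℕ}
    (lam : n.Partition) (μ : YoungDiagram) :
    tildeEPart E lam (P μ) = (lam.parts.map fun r => eigenTilde r μ).prod • P μ := by
  have h : ∀ l : List ℕ, (l.map E).prod (P μ) = (l.map fun r => eigenTilde r μ).prod • P μ := by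
    intro l
    induction l with
    | nil => rw [List.map_nil, List.map_nil, List.prod_nil, List.prod_nil, one_smul]; rfl
    | cons a l ih =>
      rw [List.map_cons, List.map_cons, List.prod_cons, List.prod_cons, Module.End.mul_apply, ih,
        map_smul, hP.apply_eq_smul (hE a), smul_smul, mul_comm]
  have h1 : (lam.parts.map fun r => eigenTilde r μ).prod =
      ((lam.parts.sort (· ≥ ·)).map fun r => eigenTilde r μ).prod := by
    conv_lhs => rw [← Multiset.sort_eq lam.parts (· ≥ ·)]
    rw [Multiset.map_coe, Multiset.prod_coe]
  rw [h1, ← h]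
  rfl

/-- All operators involved are diagonal in P, so identities between eigenvalues lift to operators.
Stated for two graded series so that Λ^m and Σ^m are both instances. -/
theorem diagOp_eq_sum (hP : IsMacdonaldBasis P) (hE : ∀ r, IsTildeE r (E r))
    {F G : PowerSeries (MvPolynomial ℕ CQ)} (hF : GradedSeries F) (hG : GradedSeries G) (s : CQT)
    (m : ℕ) (c : YoungDiagram → CQT) (hc : ∀ μ, c μ = PowerSeries.coeff m (PowerSeries.rescale s
      (F.map (evalCQ fun r => eigenTilde r μ) * G.map (evalCQ (eTail 0))))) :
    diagOp P c = s ^ m • ∑ jk ∈ HasAntidiagonal.antidiagonal m,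
      ∑ lam : jk.1.Partition, ∑ ν : jk.2.Partition,
        (RatFunc.C (MvPolynomial.coeff (Multiset.toFinsupp lam.parts)
            (PowerSeries.coeff jk.1 F)) *
          RatFunc.C (MvPolynomial.coeff (Multiset.toFinsupp ν.parts)
            (PowerSeries.coeff jk.2 G)) * eTailPart ν) • tildeEPart E lam := by
  refine P.ext fun μ => ?_
  rw [diagOp_apply, hc, PowerSeries.coeff_rescale, coeff_map_mul_map hF hG, LinearMap.smul_apply,
    mul_smul, LinearMap.sum_apply, sum_smul]
  congr 1
  refine sum_congr rfl fun jk _ => ?_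
  rw [LinearMap.sum_apply, sum_smul]
  refine sum_congr rfl fun lam _ => ?_
  rw [LinearMap.sum_apply, sum_smul]
  refine sum_congr rfl fun ν _ => ?_
  rw [LinearMap.smul_apply, tildeEPart_apply hP hE, smul_smul, eTailPart_eq]

/-- The coefficients of the universal series. -/
def gammaCoeff (n : ℕ) (lam : n.Partition) : CQ :=
  MvPolynomial.coeff (Multiset.toFinsupp lam.parts) (PowerSeries.coeff n universalSeries)

/-- The coefficients of the inverse of the universal series. -/
def betaCoeff (n : ℕ) (lam : n.Partition) : CQ :=
  MvPolynomial.coeff (Multiset.toFinsupp lam.parts) (PowerSeries.coeff n universalInv)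

theorem lambdaOp_eq (hP : IsMacdonaldBasis P) (hE : ∀ r, IsTildeE r (E r)) (m : ℕ) :
    LambdaOp P m = tv ^ m • ∑ jk ∈ HasAntidiagonal.antidiagonal m,
      ∑ lam : jk.1.Partition, ∑ ν : jk.2.Partition,
        (RatFunc.C (gammaCoeff jk.1 lam) * RatFunc.C (betaCoeff jk.2 ν) * eTailPart ν) •
          tildeEPart E lam :=
  diagOp_eq_sum hP hE gradedSeries_universal gradedSeries_universalInv tv m _ fun μ => by
    rw [← cellSeries_eq_universal, cellSeries, coeff_prod_one_add_eq_esymm (K := CQT)]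

theorem sigmaOp_eq (hP : IsMacdonaldBasis P) (hE : ∀ r, IsTildeE r (E r)) (m : ℕ) :
    SigmaOp P m = (-tv) ^ m • ∑ jk ∈ HasAntidiagonal.antidiagonal m,
      ∑ lam : jk.1.Partition, ∑ ν : jk.2.Partition,
        (RatFunc.C (betaCoeff jk.1 lam) * RatFunc.C (gammaCoeff jk.2 ν) * eTailPart ν) •
          tildeEPart E lam :=
  diagOp_eq_sum hP hE gradedSeries_universalInv gradedSeries_universal (-tv) m _ fun μ => by
    rw [← prod_geom_cellWeight, coeff_prod_geom_eq_hsymm (K := CQT)]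

theorem sum_alphaCoeff_eTailPart {m : ℕ} (hm : 0 < m) :
    1 / ((1 - qv ^ m) * (1 - tv⁻¹ ^ m)) =
      -((-1) ^ m * (m : CQT) * tv ^ m / (1 - qv ^ m)) *
        ∑ lam : m.Partition, (alphaCoeff lam : CQT) * eTailPart lam := by
  have h1 := evalRat_genericLog_eTail hm
  rw [evalRat_genericLog _ hm] at h1
  have hq := one_sub_qv_pow_ne_zero hm
  have ht := tv_pow_sub_one_ne_zero m hm
  have ht0 : tv ^ m ≠ 0 := pow_ne_zero _ tv_ne_zero
  have h5 : ((-1 : CQT) ^ m) * (-1) ^ m = 1 := by rw [← mul_pow, neg_mul_neg, one_mul, one_pow]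
  have h2 : 1 - tv⁻¹ ^ m = (tv ^ m - 1) / tv ^ m := by
    rw [sub_div, div_self ht0, inv_pow, one_div]
  simp only [eTailPart_eq]
  rw [h2]
  set S := ∑ lam : m.Partition, (alphaCoeff lam : CQT) * (lam.parts.map (eTail 0)).prod
  rw [neg_mul, div_mul_eq_mul_div, eq_comm, ← mul_div_assoc, one_div_div, ← neg_div,
    div_eq_div_iff hq (mul_ne_zero hq ht)]
  linear_combination (-(-1) ^ m * tv ^ m * (1 - qv ^ m)) * h1 + tv ^ m * (1 - qv ^ m) * h5

theorem psiOp_eq (hP : IsMacdonaldBasis P) (hE : ∀ r, IsTildeE r (E r)) {m : ℕ} (hm : 0 < m) :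
    PsiOp P m = ((-1) ^ m * (m : CQT) * tv ^ m / (1 - qv ^ m)) •
        ∑ lam : m.Partition, (alphaCoeff lam : CQT) • tildeEPart E lam +
      (1 / ((1 - qv ^ m) * (1 - tv⁻¹ ^ m))) • (1 : Module.End CQT SymFun) := by
  refine P.ext fun μ => ?_
  have h1 := psum_cellWeight μ hm
  rw [evalRat_genericLog _ hm, evalRat_genericLog _ hm] at h1
  have hq := one_sub_qv_pow_ne_zero hm
  rw [sum_alphaCoeff_eTailPart hm, PsiOp, diagOp_apply, LinearMap.add_apply, LinearMap.smul_apply,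
    LinearMap.smul_apply, LinearMap.sum_apply, Module.End.one_apply]
  simp only [LinearMap.smul_apply, tildeEPart_apply hP hE, smul_smul, eTailPart_eq]
  rw [← sum_smul, smul_smul, ← add_smul]
  congr 1
  refine mul_left_cancel₀ hq (h1.trans ?_)
  rw [mul_add, ← mul_assoc, ← mul_assoc, mul_neg, mul_div_cancel₀ _ hq]
  ring

end Formulas

/-! ### Products of vertex operators -/

section Contraction

open PowerSeries

variable {R S : Type*} [CommRing R] [CommRing S]

/-- The series `(1 - y z)(1 - q a y z) / ((1 - a y z)(1 - q y z))`. -/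
def contractSeries (a q y : R) : PowerSeries R :=
  ratioSeries (a * y) y * ratioSeries (q * y) (q * a * y)

theorem map_contractSeries (φ : R →+* S) (a q y : R) :
    (contractSeries a q y).map φ = contractSeries (φ a) (φ q) (φ y) := by
  rw [contractSeries, map_mul, map_ratioSeries, map_ratioSeries, contractSeries]
  simp only [map_mul]

theorem hasLogDeriv_contractSeries (a q y : R) :
    HasLogDeriv (mk fun n => -((1 - a ^ (n + 1)) * (1 - q ^ (n + 1)) * y ^ (n + 1)))
      (contractSeries a q y) := by
  have h := (hasLogDeriv_ratioSeries (a * y) y).mul (hasLogDeriv_ratioSeries (q * y) (q * a * y))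
  refine Eq.subst (motive := fun A => HasLogDeriv A _) ?_ h
  ext n
  rw [map_add, coeff_mk, coeff_mk, coeff_mk]
  simp only [mul_pow]
  ring

/-- Translating p_k by -(1 - q^k) y^k multiplies the creation exponential by exp(-∑ (1 - t⁻ⁿ)(1 -
qⁿ) yⁿ zⁿ/n), the rational function `contractSeries` of yz. -/
theorem map_creationSeries_eq_mul [Algebra ℚ R] (φ ψ : SymFun →+* R) {ι : Type*} (s : Finset ι)
    (y : ι → R) (hC : ∀ c, φ (MvPolynomial.C c) = ψ (MvPolynomial.C c))
    (hX : ∀ k : ℕ+, φ (MvPolynomial.X k) = ψ (MvPolynomial.X k) -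
      ∑ β ∈ s, ψ (MvPolynomial.C (1 - qv ^ (k : ℕ))) * y β ^ (k : ℕ)) :
    creationSeries.map φ = creationSeries.map ψ *
      ∏ β ∈ s, contractSeries (ψ (MvPolynomial.C tv⁻¹)) (ψ (MvPolynomial.C qv)) (y β) := by
  refine map_creationSeries_eq _ _ _ ((hasLogDeriv_creationSeries.map ψ).mul
    (HasLogDeriv.prod s fun β _ => hasLogDeriv_contractSeries _ _ _)) fun n => ?_
  rw [hC, hX, map_add, coeff_map, coeff_mk, map_sum, mul_sub, map_mul, sub_eq_add_neg, mul_sum,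
    ← sum_neg_distrib]
  congr 1
  refine sum_congr rfl fun β _ => ?_
  simp only [coeff_mk, map_sub, map_one, map_pow, Nat.succPNat_coe, Nat.succ_eq_add_one, mul_assoc]

end Contraction

/-! ### Normal ordering of a product of vertex operators -/

section Product

attribute [local instance] isDomain_CQ noZeroDivisors_CQT charZero_CQT

/-- The inverse of a variable. -/
def invVar (R : Type*) [CommRing R] {r : ℕ} (β : Fin r) : HahnSeries (Expo r) R :=
  HahnSeries.single (expoSingle β (-1)) 1

theorem invVar_pow {R : Type*} [CommRing R] {r : ℕ} (β : Fin r) (k : ℕ) :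
    invVar R β ^ k = HahnSeries.single (expoSingle β (-(k : ℤ))) 1 := by
  induction k with
  | zero => simp [expoSingle_zero]
  | succ k ih =>
    rw [pow_succ, ih, invVar, HahnSeries.single_mul_single, ← expoSingle_add, mul_one]
    congr 2
    push_cast
    ring_nf

/-- The annihilation part as a ring homomorphism. -/
def annihHom (r : ℕ) : SymFun →+* HahnSeries (Expo r) SymFun := (annihilation r).toRingHom

theorem annihHom_C (r : ℕ) (c : CQT) :
    annihHom r (MvPolynomial.C c) = HahnSeries.C (MvPolynomial.C c) :=
  (annihilation r).commutes c

theorem annihHom_X (r : ℕ) (k : ℕ+) : annihHom r (MvPolynomial.X k) =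
    HahnSeries.C (MvPolynomial.X k) -
      ∑ α : Fin r, HahnSeries.single (expoSingle α (-((k : ℕ) : ℤ)))
        (MvPolynomial.C (1 - qv ^ (k : ℕ)) : SymFun) := MvPolynomial.aeval_X _ _

/-- The contraction of the annihilation part in `r` variables with a creation part in one
variable. -/
def contraction (r : ℕ) : PowerSeries (HahnSeries (Expo r) CQT) :=
  ∏ β : Fin r, contractSeries (HahnSeries.C tv⁻¹) (HahnSeries.C qv) (invVar CQT β)

theorem map_contraction (r : ℕ) :
    (contraction r).map (hahnMap (MvPolynomial.C : CQT →+* SymFun)) =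
      ∏ β : Fin r, contractSeries (HahnSeries.C (MvPolynomial.C tv⁻¹))
        (HahnSeries.C (MvPolynomial.C qv)) (invVar SymFun β) := by
  rw [contraction, map_prod]
  refine prod_congr rfl fun β _ => ?_
  rw [map_contractSeries, hahnMap_C, hahnMap_C, invVar, hahnMap_single, map_one, invVar]

/-- Moving the annihilation part past a creation part costs a factor with coefficients in ℂ(q,t)
only. -/
theorem map_creationSeries_annihHom (r : ℕ) :
    creationSeries.map (annihHom r) = creationSeries.map HahnSeries.C *
        (contraction r).map (hahnMap (MvPolynomial.C : CQT →+* SymFun)) := by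
  rw [map_contraction]
  refine map_creationSeries_eq_mul _ _ univ _ (annihHom_C r) fun k => ?_
  rw [annihHom_X]
  congr 1
  refine sum_congr rfl fun β _ => ?_
  rw [invVar_pow, HahnSeries.C_apply, HahnSeries.single_mul_single, zero_add, mul_one]

/-- The kernel of a product of vertex operators. -/
def productKernel (s r : ℕ) (κ' : HahnSeries (Expo s) CQT) (κ : HahnSeries (Expo r) CQT) :
    HahnSeries (Expo (s + r)) CQT :=
  hahnJoin s r (HahnSeries.C κ * (hahnMap HahnSeries.C κ' * seriesProd (contraction r) s))

theorem hahnJoin_annihHom (s r : ℕ) (f : SymFun) :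
    hahnJoin s r (hahnMap (annihHom r) (annihHom s f)) = annihHom (s + r) f := by
  have h : ((hahnJoin s r).comp (hahnMap (annihHom r))).comp (annihHom s) = annihHom (s + r) := by
    refine MvPolynomial.ringHom_ext (fun a => ?_) fun k => ?_
    · rw [RingHom.comp_apply, RingHom.comp_apply, annihHom_C, hahnMap_C, annihHom_C, hahnJoin_C_C,
        annihHom_C]
    · have hl : ∀ α : Fin s, hahnJoin s r (hahnMap (annihHom r)
          (HahnSeries.single (expoSingle α (-((k : ℕ) : ℤ)))
            (MvPolynomial.C (1 - qv ^ (k : ℕ)) : SymFun))) =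
          HahnSeries.single (expoSingle (Fin.castAdd r α) (-((k : ℕ) : ℤ)))
            (MvPolynomial.C (1 - qv ^ (k : ℕ)) : SymFun) := fun α => by
        rw [hahnMap_single, annihHom_C, HahnSeries.C_apply, hahnJoin_single_single,
          expoAppend_single_left]
      have hr : ∀ α : Fin r, hahnJoin s r (HahnSeries.C
          (HahnSeries.single (expoSingle α (-((k : ℕ) : ℤ)))
            (MvPolynomial.C (1 - qv ^ (k : ℕ)) : SymFun))) =
          HahnSeries.single (expoSingle (Fin.natAdd s α) (-((k : ℕ) : ℤ)))
            (MvPolynomial.C (1 - qv ^ (k : ℕ)) : SymFun) := fun α => by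
        rw [HahnSeries.C_apply, hahnJoin_single_single, expoAppend_single_right]
      rw [RingHom.comp_apply, RingHom.comp_apply, annihHom_X s, annihHom_X (s + r),
        Fin.sum_univ_add, map_sub (hahnMap (annihHom r)), hahnMap_C, annihHom_X r,
        map_sub (hahnJoin s r), map_sub HahnSeries.C, map_sub (hahnJoin s r), hahnJoin_C_C,
        map_sum (hahnMap (annihHom r)), map_sum (hahnJoin s r), map_sum HahnSeries.C,
        map_sum (hahnJoin s r), sub_sub]
      simp only [hl, hr]
      exact congrArg _ (add_comm _ _)
  exact congrArg (fun φ : SymFun →+* _ => φ f) h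

theorem hahnJoin_creation (s r : ℕ) :
    hahnJoin s r (HahnSeries.C (creation r)) *
        hahnJoin s r (hahnMap HahnSeries.C (seriesProd creationSeries s)) = creation (s + r) := by
  rw [creation_eq_seriesProd, creation_eq_seriesProd, seriesProd, seriesProd, seriesProd,
    Fin.prod_univ_add, map_prod, map_prod, map_prod, map_prod, mul_comm]
  congr 1
  · refine prod_congr rfl fun α _ => ?_
    rw [hahnJoin_map_powAlong _ (by rw [expoAppend_single_left]; exact expoSingle_pos _)]
    exact powAlong_congr (expoAppend_single_left α 1) _ _ _
  · refine prod_congr rfl fun α _ => ?_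
    rw [hahnJoin_C_powAlong _ (by rw [expoAppend_single_right]; exact expoSingle_pos _)]
    exact powAlong_congr (expoAppend_single_right α 1) _ _ _

/-- Applying the second annihilation part to the first vertex series gives the joint creation and
annihilation parts times the contraction, a scalar that joins the kernel. The operator acting first
owns the first, more significant variables, since contractions expand in its variables divided by
those of the other. -/
theorem vertexOp_mul_vertexOp (s r : ℕ) (κ' : HahnSeries (Expo s) CQT)
    (κ : HahnSeries (Expo r) CQT) :
    vertexOp r κ * vertexOp s κ' = vertexOp (s + r) (productKernel s r κ' κ) := by
  refine LinearMap.ext fun f => ?_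
  have h1 : (vertexOp r κ * vertexOp s κ') f = (hahnJoin s r
      (HahnSeries.C (hahnMap MvPolynomial.C κ * creation r) * hahnMap (annihHom r)
        (hahnMap MvPolynomial.C κ' * creation s * annihHom s f))).coeff 0 := by
    rw [hahnJoin_coeff, expoLeft_zero, expoRight_zero, hahn_coeff_C_mul]
    rfl
  have h2 : hahnMap (annihHom r) (hahnMap (MvPolynomial.C : CQT →+* SymFun) κ') =
      hahnMap (hahnMap MvPolynomial.C) (hahnMap HahnSeries.C κ') := by
    ext1
    funext a
    exact (annihHom_C r _).trans (hahnMap_C _ _).symm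
  have h3 : hahnMap (annihHom r) (creation s) =
      hahnMap HahnSeries.C (seriesProd creationSeries s) *
        hahnMap (hahnMap MvPolynomial.C) (seriesProd (contraction r) s) := by
    rw [creation_eq_seriesProd, hahnMap_seriesProd, map_creationSeries_annihHom, seriesProd_mul,
      hahnMap_seriesProd, hahnMap_seriesProd]
  have h4 : HahnSeries.C (hahnMap (MvPolynomial.C : CQT →+* SymFun) κ) =
      hahnMap (hahnMap MvPolynomial.C) (HahnSeries.C κ : HahnSeries (Expo s) _) :=
    (hahnMap_C _ _).symm
  have h5 : vertexOp (s + r) (productKernel s r κ' κ) f =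
      (hahnMap MvPolynomial.C (productKernel s r κ' κ) * creation (s + r) *
        annihHom (s + r) f).coeff 0 := rfl
  have hM : ∀ x y : HahnSeries (Expo s) (HahnSeries (Expo r) CQT),
      hahnMap (hahnMap (MvPolynomial.C : CQT →+* SymFun)) (x * y) =
        hahnMap (hahnMap MvPolynomial.C) x * hahnMap (hahnMap MvPolynomial.C) y :=
    fun x y => map_mul _ x y
  have h6 : HahnSeries.C (hahnMap MvPolynomial.C κ * creation r) * hahnMap (annihHom r)
        (hahnMap MvPolynomial.C κ' * creation s * annihHom s f) =
      hahnMap (hahnMap MvPolynomial.C)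
        (HahnSeries.C κ * (hahnMap HahnSeries.C κ' * seriesProd (contraction r) s)) *
      (HahnSeries.C (creation r) * hahnMap HahnSeries.C (seriesProd creationSeries s)) *
      hahnMap (annihHom r) (annihHom s f) := by
    rw [map_mul HahnSeries.C, map_mul (hahnMap (annihHom r)), map_mul (hahnMap (annihHom r)), h2,
      h3, h4, hM, hM]
    have hring : ∀ a b c d e f : HahnSeries (Expo s) (HahnSeries (Expo r) SymFun),
        a * b * (c * (d * e) * f) = a * (c * e) * (b * d) * f := fun a b c d e f => by ring
    exact hring _ _ _ _ _ _
  rw [h1, h5, h6, productKernel, hahnMap_hahnJoin, ← hahnJoin_creation, ← hahnJoin_annihHom,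
    map_mul (hahnJoin s r), map_mul (hahnJoin s r),
    map_mul (hahnJoin s r) (HahnSeries.C (creation r))]

end Product

/-! ### Vertex realizability -/

section Realizable

attribute [local instance] isDomain_CQ noZeroDivisors_CQT charZero_CQT

variable {P : Module.Basis YoungDiagram CQT SymFun} {E : ℕ → Module.End CQT SymFun}

theorem IsVertexRealizableOfWeight.mul {r s : ℕ} {A B : Module.End CQT SymFun}
    (hA : IsVertexRealizableOfWeight P r A) (hB : IsVertexRealizableOfWeight P s B) :
    IsVertexRealizableOfWeight P (s + r) (A * B) := by
  obtain ⟨hA1, κ, rfl⟩ := hA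
  obtain ⟨hB1, κ', rfl⟩ := hB
  refine ⟨fun μ => ?_, _, vertexOp_mul_vertexOp s r κ' κ⟩
  obtain ⟨a, ha⟩ := hA1 μ
  obtain ⟨b, hb⟩ := hB1 μ
  exact ⟨b * a, by rw [Module.End.mul_apply, hb, map_smul, ha, smul_smul]⟩

theorem IsTildeE.isVertexRealizableOfWeight (hP : IsMacdonaldBasis P) {r : ℕ}
    {T : Module.End CQT SymFun} (h : IsTildeE r T) : IsVertexRealizableOfWeight P r T :=
  ⟨fun μ => ⟨_, hP.apply_eq_smul h μ⟩, _, h.eq_vertexOp⟩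

theorem isVertexRealizable_one : IsVertexRealizable P 1 :=
  Submodule.subset_span (Or.inl rfl)

/-- Weights add under products and all parts are positive, so a nonempty product has weight at least
1. The empty product is the scalar 1, hence the two alternatives. -/
theorem isVertexRealizable_tildeEPart (hP : IsMacdonaldBasis P) (hE : ∀ r, IsTildeE r (E r)) {n : ℕ}
    (lam : n.Partition) : IsVertexRealizable P (tildeEPart E lam) := by
  have h : ∀ l : List ℕ, (∀ r ∈ l, 0 < r) → (l.map E).prod = 1 ∨
      ∃ r, 1 ≤ r ∧ IsVertexRealizableOfWeight P r (l.map E).prod := by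
    intro l
    induction l with
    | nil => exact fun _ => Or.inl rfl
    | cons a l ih =>
      intro hl
      have ha : 1 ≤ a := hl a List.mem_cons_self
      have hEa := (hE a).isVertexRealizableOfWeight hP
      rw [List.map_cons, List.prod_cons]
      rcases ih fun r hr => hl r (List.mem_cons_of_mem _ hr) with h | ⟨r, _, h⟩
      · exact Or.inr ⟨a, ha, by rwa [h, mul_one]⟩
      · exact Or.inr ⟨r + a, le_add_left ha, hEa.mul h⟩
  rcases h (lam.parts.sort (· ≥ ·)) fun r hr => lam.parts_pos ((Multiset.mem_sort _).1 hr) with h | h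
  · exact Submodule.subset_span (Or.inl h)
  · exact Submodule.subset_span (Or.inr h)

theorem isVertexRealizable_sum (hP : IsMacdonaldBasis P) (hE : ∀ r, IsTildeE r (E r)) (m : ℕ)
    (s : CQT) (c : ∀ jk : ℕ × ℕ, jk.1.Partition → jk.2.Partition → CQT) :
    IsVertexRealizable P (s • ∑ jk ∈ HasAntidiagonal.antidiagonal m,
      ∑ lam : jk.1.Partition, ∑ ν : jk.2.Partition, c jk lam ν • tildeEPart E lam) :=
  Submodule.smul_mem _ _ <| Submodule.sum_mem _ fun _ _ => Submodule.sum_mem _ fun lam _ =>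
    Submodule.sum_mem _ fun _ _ => Submodule.smul_mem _ _ (isVertexRealizable_tildeEPart hP hE lam)

theorem isVertexRealizable_psiOp (hP : IsMacdonaldBasis P) (hE : ∀ r, IsTildeE r (E r)) {m : ℕ}
    (hm : 0 < m) : IsVertexRealizable P (PsiOp P m) := by
  rw [psiOp_eq hP hE hm]
  exact Submodule.add_mem _ (Submodule.smul_mem _ _ <| Submodule.sum_mem _ fun lam _ =>
    Submodule.smul_mem _ _ (isVertexRealizable_tildeEPart hP hE lam))
    (Submodule.smul_mem _ _ isVertexRealizable_one)

end Realizable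

end MacdonaldVertex

end

/-! ### The main theorem -/

theorem mainTheorem9 :
    (∃ P : Module.Basis YoungDiagram CQT SymFun, IsMacdonaldBasis P) ∧
    (∀ r : ℕ, ∃ T : Module.End CQT SymFun, IsTildeE r T) ∧
    ∀ (P : Module.Basis YoungDiagram CQT SymFun) (_hP : IsMacdonaldBasis P)
      (E : ℕ → Module.End CQT SymFun) (_hE : ∀ r : ℕ, IsTildeE r (E r)),
      (∀ r s : ℕ, Commute (E r) (E s)) ∧
      (∀ r : ℕ, 1 ≤ r → IsVertexRealizableOfWeight P r (E r)) ∧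
      (∃ β γ : (n : ℕ) → n.Partition → CQ, ∀ m : ℕ,
        LambdaOp P m = tv ^ m • ∑ jk ∈ Finset.HasAntidiagonal.antidiagonal m,
          ∑ lam : jk.1.Partition, ∑ ν : jk.2.Partition,
            (RatFunc.C (γ jk.1 lam) * RatFunc.C (β jk.2 ν) * eTailPart ν) • tildeEPart E lam ∧
        SigmaOp P m = (-tv) ^ m • ∑ jk ∈ Finset.HasAntidiagonal.antidiagonal m,
          ∑ lam : jk.1.Partition, ∑ ν : jk.2.Partition,
            (RatFunc.C (β jk.1 lam) * RatFunc.C (γ jk.2 ν) * eTailPart ν) • tildeEPart E lam) ∧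
      (∀ m : ℕ, 1 ≤ m →
        PsiOp P m =
          ((-1) ^ m * (m : CQT) * tv ^ m / (1 - qv ^ m)) •
              ∑ lam : m.Partition, (alphaCoeff lam : CQT) • tildeEPart E lam +
            (1 / ((1 - qv ^ m) * (1 - tv⁻¹ ^ m))) • (1 : Module.End CQT SymFun) ∧
        1 / ((1 - qv ^ m) * (1 - tv⁻¹ ^ m)) =
          -((-1) ^ m * (m : CQT) * tv ^ m / (1 - qv ^ m)) *
            ∑ lam : m.Partition, (alphaCoeff lam : CQT) * eTailPart lam) ∧
      (∀ m : ℕ, IsVertexRealizable P (LambdaOp P m) ∧ IsVertexRealizable P (SigmaOp P m)) ∧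
      (∀ m : ℕ, 1 ≤ m → IsVertexRealizable P (PsiOp P m)) := by
  refine ⟨exists_isMacdonaldBasis, fun r => ⟨_, isTildeE_vertexOp r⟩, fun P hP E hE =>
    ⟨fun r s => hP.commute (hE r) (hE s), fun r _ => (hE r).isVertexRealizableOfWeight hP,
      ⟨betaCoeff, gammaCoeff, fun m => ⟨lambdaOp_eq hP hE m, sigmaOp_eq hP hE m⟩⟩,
      fun m hm => ⟨psiOp_eq hP hE hm, sum_alphaCoeff_eTailPart hm⟩, fun m => ⟨?_, ?_⟩,
      fun m hm => isVertexRealizable_psiOp hP hE hm⟩⟩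
  · rw [lambdaOp_eq hP hE]
    exact isVertexRealizable_sum hP hE m _ _
  · rw [sigmaOp_eq hP hE]
    exact isVertexRealizable_sum hP hE m _ _
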